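/- **Theorem (classification of standard potentials up to fourth order, Types I–IV).** Let $\hbar\ge 0$ ($\hbar=0$ is the classical case, $\hbar>0$ the quantum case), let $J_1,J_2\subseteq\mathbb R$ be non-empty open intervals, let $V_i\colon J_i\to\mathbb R$ be smooth, and let $$H=\tfrac12(p_1^2+p_2^2)+V_1(q_1)+V_2(q_2).$$ For functions on phase space that are polynomial in the momenta put $$(f,g)=\sum_{k_1+k_2\ge 1}\frac{1}{k_1!\,k_2!}\Big(\frac{\hbar}{\sqrt{-1}}\Big)^{k_1+k_2-1}\Big(\partial_{q}^{k}f\;\partial_{p}^{k}g-\partial_{p}^{k}f\;\partial_{q}^{k}g\Big),\qquad \partial_q^k=\partial_{q_1}^{k_1}\partial_{q_2}^{k_2},\quad \partial_p^k=\partial_{p_1}^{k_1}\partial_{p_2}^{k_2},$$ which is the Poisson bracket when $\hbar=0$ and, when $\hbar>0$, is $1/(\hbar\sqrt{-1})$ times the symbol (momenta on the right) of the commutator of the operators with symbols $f$ and $g$. Suppose $H$ has an integral of order $n\le 4$, that is, a function $$X=\sum_{a+b\le n}c_{ab}(q_1,q_2)\,p_1^a p_2^b$$ with complex-valued coefficients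 smooth on $J_1\times J_2$, $(X,H)=0$ on $J_1\times J_2$ for all momenta, and non-zero component $Z_0=\sum_{a+b=n}c_{ab}\,p_1^ap_2^b$. The component $Z_0$ is a polynomial in $p_1,p_2,q_1p_2-q_2p_1$, and up to sign $$\frac{\partial Z_0}{\partial q_i}\Big|_{p_i=0}=\xi_{0i}'(q_i)\,p_j^{\,n},\qquad \frac{\partial Z_0}{\partial p_i}\Big|_{p_i=0}=\big[\xi_{1i}(q_i)\mp q_j\,\xi_{0i}'(q_i)\big]p_j^{\,n-1}\qquad(\{i,j\}=\{1,2\})$$ for polynomials $\xi_{0i},\xi_{1i}$ (for $n=0$ both sides vanish). With $Q_i=\int V_i\,\mathrm dq_i$, every integral $X$ satisfies the linear compatibility equations $$\xi_{0i}'Q_i+\eta_{0i}=0,\qquad(\xi_{1i}Q_i)'+\eta_{1i}=0$$ for some polynomials $\eta_{0i},\eta_{1i}$ in $q_i$. One says that $V_i$ solves them non-trivially if $\xi_{0i}'$ and $\xi_{1i}$ are not both zero, equivalently if $\partial Z_0/\partial q_i|_{p_i=0}$ and $\partial Z_0/\partial p_i|_{p_i=0}$ do not both vanish identically. (Such an $X$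 is never a polynomial in $\tfrac12p_1^2+V_1$ and $\tfrac12p_2^2+V_2$, so $H$ is superintegrable.) Then, for each $i\in\{1,2\}$ such that $V_i$ solves the linear compatibility equations of $X$ non-trivially, $V_i$ is on $J_i$, up to a translation of $q_i$ and an additive constant, of one of the following forms with real parameters: $$\begin{aligned} (\mathrm{I})\;& \beta q_i,\\ (\mathrm{II})\;& \beta_1q_i^2+\frac{\beta_2}{q_i^2},\\ (\mathrm{III})\;& \beta_1\Big(q_i^2+\frac{\beta_2^2}{q_i^2}\Big)+\hbar^2\Big[\frac{2(q_i^2+\beta_2)}{(q_i^2-\beta_2)^2}-\frac1{8q_i^2}\Big],\\ (\mathrm{IV})\;& \frac{3\hbar^2q_i(q_i^3+2\beta)}{(q_i^3-\beta)^2}. \end{aligned}$$ In particular, if both summands solve these equations non-trivially, then both are of these forms. -/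

import Mathlib

open scoped ContDiff Nat

/-- Complex-valued functions of the coordinates `q` and the momenta `p` on the phase space of the
plane; the two degrees of freedom are indexed by `Fin 2`. -/
abbrev PhaseFun : Type := (Fin 2 → ℝ) → (Fin 2 → ℝ) → ℂ

/-- The partial derivative with respect to the coordinate `q_i`. -/
noncomputable def dq (i : Fin 2) (F : PhaseFun) : PhaseFun :=
  fun q p => deriv (fun t : ℝ => F (Function.update q i t) p) (q i)

/-- The partial derivative with respect to the momentum `p_i`. -/
noncomputable def dp (i : Fin 2) (F : PhaseFun) : PhaseFun :=
  fun q p => deriv (fun t : ℝ => F q (Function.update p i t)) (p i)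

/-- The deformed Poisson bracket of two functions whose degree in each momentum is at most `N`
(the omitted terms of the full series then vanish):
`∑_{k ≠ 0} (1 / (k₁! k₂!)) (ħ / √-1) ^ (k₁ + k₂ - 1) (∂_q^k f · ∂_p^k g - ∂_p^k f · ∂_q^k g)`.
For `ħ = 0` it is the ordinary Poisson bracket. For `ħ ≠ 0`, `√-1 ħ` times it is the symbol
(momenta on the right, `p_i` standing for `(ħ / √-1) ∂/∂q_i`) of the commutator of the operators
with symbols `f` and `g`. -/
noncomputable def bracket (N : ℕ) (ħ : ℝ) (f g : PhaseFun) : PhaseFun :=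
  fun q p =>
    ∑ k ∈ (Finset.range (N + 1) ×ˢ Finset.range (N + 1)).erase (0, 0),
      (1 / ((k.1 ! : ℂ) * (k.2 ! : ℂ))) * ((ħ : ℂ) / Complex.I) ^ (k.1 + k.2 - 1) *
        ((dq 0)^[k.1] ((dq 1)^[k.2] f) q p * (dp 0)^[k.1] ((dp 1)^[k.2] g) q p -
          (dp 0)^[k.1] ((dp 1)^[k.2] f) q p * (dq 0)^[k.1] ((dq 1)^[k.2] g) q p)

/-- The Hamiltonian `½ (p₁² + p₂²) + V₁(q₁) + V₂(q₂)`. -/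
noncomputable def hamiltonian (V : Fin 2 → ℝ → ℝ) : PhaseFun :=
  fun q p => ((∑ i, ((p i) ^ 2 / 2 + V i (q i)) : ℝ) : ℂ)

/-- The homogeneous component `∑_{a + b = m} c_{ab}(q) p₁^a p₂^b` of degree `m` in the momenta. -/
noncomputable def component (c : ℕ → ℕ → (Fin 2 → ℝ) → ℂ) (m : ℕ) : PhaseFun :=
  fun q p => ∑ k ∈ Finset.HasAntidiagonal.antidiagonal m,
    c k.1 k.2 q * (p 0 : ℂ) ^ k.1 * (p 1 : ℂ) ^ k.2

/-- The polynomial `∑_{a + b ≤ n} c_{ab}(q) p₁^a p₂^b` of degree at most `n` in the momenta. -/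
noncomputable def momentumPoly (c : ℕ → ℕ → (Fin 2 → ℝ) → ℂ) (n : ℕ) : PhaseFun :=
  fun q p => ∑ m ∈ Finset.range (n + 1), component c m q p

/-- The coordinate domain `J₁ × J₂`. -/
def box (J : Fin 2 → Set ℝ) : Set (Fin 2 → ℝ) := {q | ∀ i, q i ∈ J i}

/-- `X = ∑_{a + b ≤ n} c_{ab}(q) p₁^a p₂^b`, with coefficients smooth on `J₁ × J₂`, is an integral
of motion there: its bracket with the Hamiltonian vanishes identically. -/
def IsMotionIntegral (ħ : ℝ) (V : Fin 2 → ℝ → ℝ) (J : Fin 2 → Set ℝ) (n : ℕ)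
    (c : ℕ → ℕ → (Fin 2 → ℝ) → ℂ) : Prop :=
  (∀ a b, a + b ≤ n → ContDiffOn ℝ ∞ (c a b) (box J)) ∧
  ∀ q ∈ box J, ∀ p, bracket (n + 2) ħ (momentumPoly c n) (hamiltonian V) q p = 0

/-- The linear compatibility equations of an integral of order `n`, for the summand `V_i`, are
`ξ₀' Q + η₀ = 0` and `(ξ₁ Q)' + η₁ = 0` where `Q` is a primitive of `V_i`, `η₀, η₁` are polynomials
and `ξ₀, ξ₁` are the polynomials in `q_i` read off from the leading component
`Z = ∑ α_{ijk} p₁^i p₂^j (q₁ p₂ - q₂ p₁)^k`. Every integral satisfies these equations; they are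
non-trivial for `V_i` when `ξ₀'` and `ξ₁` are not both zero. As
`∂Z/∂q_i = ± ξ₀' p_j ^ n` and `∂Z/∂p_i = ± (ξ₁ ∓ q_j ξ₀') p_j ^ (n - 1)` at `p_i = 0`, where `j` is
the other index, this says that one of these two restrictions is not identically zero. (It forces
the component of degree `n` to be non-zero, and it fails for every polynomial in
`½ p₁² + V₁` and `½ p₂² + V₂`, whose leading component is a polynomial in `p₁²` and `p₂²`.) -/
def LinearCompatNontrivial (J : Fin 2 → Set ℝ) (n : ℕ) (c : ℕ → ℕ → (Fin 2 → ℝ) → ℂ)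
    (i : Fin 2) : Prop :=
  ∃ q ∈ box J, ∃ p : Fin 2 → ℝ, p i = 0 ∧
    (dq i (component c n) q p ≠ 0 ∨ dp i (component c n) q p ≠ 0)

/-- Type I: `β q`. -/
noncomputable def typeI (β : ℝ) (q : ℝ) : ℝ := β * q

/-- Type II: `β₁ q² + β₂ / q²`. -/
noncomputable def typeII (β₁ β₂ : ℝ) (q : ℝ) : ℝ := β₁ * q ^ 2 + β₂ / q ^ 2

/-- Type III: `β₁ (q² + β₂² / q²) + ħ² [2 (q² + β₂) / (q² - β₂)² - 1 / (8 q²)]`. -/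
noncomputable def typeIII (ħ β₁ β₂ : ℝ) (q : ℝ) : ℝ :=
  β₁ * (q ^ 2 + β₂ ^ 2 / q ^ 2) +
    ħ ^ 2 * (2 * (q ^ 2 + β₂) / (q ^ 2 - β₂) ^ 2 - 1 / (8 * q ^ 2))

/-- Type IV: `3 ħ² q (q³ + 2 β) / (q³ - β)²`. -/
noncomputable def typeIV (ħ β : ℝ) (q : ℝ) : ℝ :=
  3 * ħ ^ 2 * q * (q ^ 3 + 2 * β) / (q ^ 3 - β) ^ 2

/-- Up to a translation of the coordinate and an additive constant, `W` is on `J` of one of the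
four types. -/
def HasStandardForm (ħ : ℝ) (J : Set ℝ) (W : ℝ → ℝ) : Prop :=
  ∃ δ e : ℝ,
    (∃ β, ∀ q ∈ J, W q = typeI β (q - δ) + e) ∨
    (∃ β₁ β₂, ∀ q ∈ J, W q = typeII β₁ β₂ (q - δ) + e) ∨
    (∃ β₁ β₂, ∀ q ∈ J, W q = typeIII ħ β₁ β₂ (q - δ) + e) ∨
    (∃ β, ∀ q ∈ J, W q = typeIV ħ β (q - δ) + e)

/-! Write x and y for q_i and q_j, V and W for the two summands, h = ħ/√-1, and let Q and Y be
primitives of V and V². The bracket equation is turned into polynomial statements about Q in the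
single variable x, and Q is then determined from its poles.

Weyl ordering. With momenta on the right the equation contains all powers of h. Conjugation by
exp(-(h/2) ∂_q·∂_p) leaves the leading component unchanged and, as the degree is at most four, keeps
only the classical terms and one correction h²/24 with third derivatives (`transport_weyl`,
`exists_weylForm`).

Elimination. Comparing momentum coefficients and cross-differentiating leaves the coefficient z of
p_i p_j^(n-1), the coefficient ζ of p_i³ p_j^(n-3), and one corrected lower coefficient G.
Non-triviality forces z ≠ 0 (`exists_coeff_ne_zero`). Both z and zQ are polynomials in x, so Q is
rational with a denominator of degree at most three. In orders three and four the expression 6ζY +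
2ζ'Q² - ħ²ζV' - 2ħ²ζ'V + 4GQ is also a polynomial in x. All this is read on lines y = const after
applying a real functional to the complex values.

Poles. If ζ ≠ 0, this equation makes Y rational, and Y' = V² becomes `CompatIdentity` for Q = P/D.
Leading-order balances give simple poles, residue -ħ² wherever ζ ≠ 0, and at most cubic growth at
infinity; since V² has no residue, the regular part of Q at each pole has no quadratic term. At a
zero common to all slices of ζ, where the residue stays free, relations linking x- and y-derivatives
give two further conditions (`CentralZero`).

Classification. After centring D, these conditions are algebraic equations for the cubic polynomial
part and the remainder of P/D. A denominator of degree 0 gives a quadratic V, degree 1 type II,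
degree 2 type III, degree 3 type III or IV (`hasStandardForm_of_poleConditions`). If ζ = 0, or the
order is at most two, z is affine and zQ at most quartic in x, and types I and II follow from the
linear equations (`hasStandardForm_of_affine_mul`). -/

/-! ### The nonlinear compatibility equation cleared of denominators -/

open Polynomial in
/-- The numerator of the derivative of `P / D`. -/
noncomputable def derivNumer {K : Type*} [Field K] (D P : K[X]) : K[X] :=
  derivative P * D - P * derivative D

open Polynomial in
/-- The numerator of the second derivative of `P / D` over `D ^ 3`. -/
noncomputable def derivNumer₂ {K : Type*} [Field K] (D P : K[X]) : K[X] :=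
  derivative (derivNumer D P) * D - 2 * derivNumer D P * derivative D

open Polynomial in
/-- `6 ζ D ^ 3` times the primitive of the square of the derivative of `P / D`, as given by the
nonlinear compatibility equation. -/
noncomputable def compatNumer {K : Type*} [Field K] (w : K) (ζ G M D P : K[X]) : K[X] :=
  4 * D ^ 3 * M - 4 * D ^ 2 * G * P - 2 * derivative ζ * D * P ^ 2 +
    C w * ζ * derivNumer₂ D P + 2 * C w * derivative ζ * D * derivNumer D P

open Polynomial in
/-- The polynomial identity equivalent to the nonlinear compatibility equation for `P / D`. -/
def CompatIdentity {K : Type*} [Field K] (w : K) (ζ G M D P : K[X]) : Prop :=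
  ζ * D * derivative (compatNumer w ζ G M D P) - derivative ζ * D * compatNumer w ζ G M D P -
    3 * ζ * derivative D * compatNumer w ζ G M D P = 6 * ζ ^ 2 * derivNumer D P ^ 2

/-! ### Local analysis at a pole -/

section Local

open Polynomial

variable {K : Type*} [Field K] [CharZero K]

/-- Leading-order balance at a pole of Q of order m = k + 2. Then V² has order 2m + 2, so its
primitive Y has order 2m + 1. Where ζ ≠ 0 the compatibility equation gives Y order at most 2m. Where
ζ vanishes, Y is -Q²/(3x) to leading order and Y' = V² forces 2m + 1 = 3m², impossible for m ≥ 2. -/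
theorem CompatIdentity.false_of_sq_dvd {w α β : K} {G M P e : K[X]} {k : ℕ}
    (h : CompatIdentity w (C α + C β * X) G M (X ^ (k + 2) * e) P)
    (hζ : α ≠ 0 ∨ β ≠ 0) (he : e.eval 0 ≠ 0) (hP : P.eval 0 ≠ 0) : False := by
  set D : K[X] := X ^ (k + 2) * e with hD
  set ζ : K[X] := C α + C β * X with hζd
  have dζ : derivative ζ = C β := by simp [hζd]
  set r : K[X] := derivative P * X * e - P * (((k + 2 : ℕ) : K[X]) * e + X * derivative e) with hr
  have dD : derivative D = X ^ (k + 1) * (((k + 2 : ℕ) : K[X]) * e + X * derivative e) := by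
    rw [hD, derivative_mul, derivative_X_pow]
    simp only [Nat.add_succ_sub_one, map_natCast]
    ring
  have hp1 : derivNumer D P = X ^ (k + 1) * r := by
    rw [derivNumer, dD, hD, hr]; ring
  set t : K[X] := (((k + 1 : ℕ) : K[X]) * r + X * derivative r) * e
      - 2 * r * (((k + 2 : ℕ) : K[X]) * e + X * derivative e) with ht
  have dp1 : derivative (derivNumer D P) = X ^ k * (((k + 1 : ℕ) : K[X]) * r + X * derivative r) := by
    rw [hp1, derivative_mul, derivative_X_pow]
    simp only [Nat.add_succ_sub_one, map_natCast]
    ring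
  have hp2 : derivNumer₂ D P = X ^ (2 * k + 2) * t := by
    rw [derivNumer₂, dp1, hp1, dD, hD, ht]; ring
  set S1 : K[X] := 4 * X ^ (2 * k + 4) * e ^ 3 * M - 4 * X ^ (k + 2) * e ^ 2 * G * P
      - 2 * C β * e * P ^ 2 + C w * ζ * X ^ k * t + 2 * C w * C β * X ^ (k + 1) * e * r with hS1
  have hS : compatNumer w ζ G M D P = X ^ (k + 2) * S1 := by
    rw [compatNumer, dζ, hp2, hp1, hD, hS1]; ring
  have dS : derivative (compatNumer w ζ G M D P) =
      X ^ (k + 1) * (((k + 2 : ℕ) : K[X]) * S1 + X * derivative S1) := by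
    rw [hS, derivative_mul, derivative_X_pow]
    simp only [Nat.add_succ_sub_one, map_natCast]
    ring
  have key := h
  rw [CompatIdentity, dS, hS, hp1, dD, dζ, hD] at key
  have hX : (X : K[X]) ≠ 0 := X_ne_zero
  have key1 : X * (ζ * e * (((k + 2 : ℕ) : K[X]) * S1 + X * derivative S1) - C β * X * e * S1
      - 3 * ζ * (((k + 2 : ℕ) : K[X]) * e + X * derivative e) * S1) = 6 * ζ ^ 2 * r ^ 2 := by
    apply mul_left_cancel₀ (pow_ne_zero (2 * k + 2) hX)
    linear_combination key
  have hr0 : r.eval 0 = - (P.eval 0 * (((k + 2 : ℕ) : K) * e.eval 0)) := by simp [hr]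
  have hk2 : ((k : K) + 2) ≠ 0 := by exact_mod_cast Nat.succ_ne_zero (k + 1)
  have hr0' : r.eval 0 ≠ 0 := by
    rw [hr0]
    push_cast
    exact neg_ne_zero.2 (mul_ne_zero hP (mul_ne_zero hk2 he))
  have hα : α = 0 := by
    have := congrArg (eval 0) key1
    simp [hζd] at this
    rcases this with h | h
    · exact h
    · exact absurd h hr0'
  have hβ : β ≠ 0 := hζ.resolve_left (not_not.2 hα)
  have hζX : ζ = C β * X := by simp [hζd, hα]
  have key2 : e * (((k + 2 : ℕ) : K[X]) * S1 + X * derivative S1) - e * S1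
      - 3 * (((k + 2 : ℕ) : K[X]) * e + X * derivative e) * S1 = 6 * C β * r ^ 2 := by
    apply mul_left_cancel₀ (mul_ne_zero (C_ne_zero.2 hβ) (pow_ne_zero 2 hX))
    rw [hζX] at key1
    linear_combination key1
  have hS10 : S1.eval 0 = - 2 * β * e.eval 0 * P.eval 0 ^ 2 := by
    simp [hS1, hζX]
  have key3 := congrArg (eval 0) key2
  simp only [eval_sub, eval_mul, eval_add, eval_natCast, eval_X, zero_mul, add_zero, eval_ofNat,
    eval_C, eval_pow, hS10, hr0] at key3
  have hc : β * e.eval 0 ^ 2 * P.eval 0 ^ 2 ≠ 0 :=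
    mul_ne_zero (mul_ne_zero hβ (pow_ne_zero 2 he)) (pow_ne_zero 2 hP)
  -- This is 2(2m + 1) = 6m² with m = k + 2; it lives in `ℕ` by characteristic zero.
  have : ((2 * (2 * k + 5) : ℕ) : K) = ((6 * (k + 2) ^ 2 : ℕ) : K) := by
    apply mul_left_cancel₀ hc
    push_cast at key3 ⊢
    linear_combination key3
  have := Nat.cast_injective this
  nlinarith

/-- For Q ≈ c/x with ζ ≠ 0 at the pole, Y is w V'/6 to leading order, and the x⁻⁴ terms of Y' = V²
read -wc = c². -/
theorem CompatIdentity.residue {w α β : K} {G M P e : K[X]}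
    (h : CompatIdentity w (C α + C β * X) G M (X * e) P)
    (hα : α ≠ 0) (he : e.eval 0 ≠ 0) (hP : P.eval 0 ≠ 0) :
    P.eval 0 = - w * e.eval 0 := by
  set ζ : K[X] := C α + C β * X with hζd
  have := congrArg (eval 0) h
  simp [compatNumer, derivNumer₂, derivNumer, hζd] at this
  have hc : α ^ 2 * e.eval 0 ^ 2 * P.eval 0 ≠ 0 :=
    mul_ne_zero (mul_ne_zero (pow_ne_zero 2 hα) (pow_ne_zero 2 he)) hP
  have h6 : (6 : K) ≠ 0 := by norm_num
  apply mul_left_cancel₀ (mul_ne_zero h6 hc)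
  linear_combination -this

/-- At a simple pole of `P / D`, the coefficient of degree two of the regular part vanishes. -/
theorem CompatIdentity.coeff_regularPart {w α β : K} {G M P e : K[X]}
    (h : CompatIdentity w (C α + C β * X) G M (X * e) P)
    (hζ : α ≠ 0 ∨ β ≠ 0) (he : e.eval 0 ≠ 0) (hP : P.eval 0 ≠ 0) :
    ∃ q₀ q₁ q₂ : K, e.coeff 0 * q₀ = P.coeff 0 ∧ e.coeff 0 * q₁ + e.coeff 1 * q₀ = P.coeff 1 ∧
      e.coeff 0 * q₂ + e.coeff 1 * q₁ + e.coeff 2 * q₀ = P.coeff 2 ∧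
      e.coeff 1 * q₂ + e.coeff 2 * q₁ + e.coeff 3 * q₀ = P.coeff 3 := by
  set D : K[X] := X * e with hD
  set ζ : K[X] := C α + C β * X with hζd
  have dζ : derivative ζ = C β := by simp [hζd]
  have hζ0 : ζ ≠ 0 := by
    intro h0
    have h1 := congrArg (coeff · 0) h0
    have h2 := congrArg (coeff · 1) h0
    simp [hζd] at h1 h2
    tauto
  let ι : K[X] →+* PowerSeries K := Polynomial.coeToPowerSeries.ringHom
  have ιinj : Function.Injective ι := Polynomial.coe_injective K
  let d : Derivation K (PowerSeries K) (PowerSeries K) := PowerSeries.derivative K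
  have ιd : ∀ f : K[X], ι (derivative f) = d (ι f) := fun f => (PowerSeries.derivative_coe f).symm
  have dmul : ∀ f g, d (f * g) = f * d g + d f * g := fun f g => by
    rw [Derivation.leibniz, smul_eq_mul, smul_eq_mul, mul_comm g]
  set S := compatNumer w ζ G M D P with hS
  have heι : IsUnit (ι e) := by
    rw [PowerSeries.isUnit_iff_constantCoeff]
    simpa [ι, ← coeff_zero_eq_eval_zero] using he
  obtain ⟨E, hE⟩ := heι
  -- The series y stands for x³Y. When ζ vanishes at the pole it is not a unit, and its factor X has
  -- to be found in S first.
  have hy : ∃ y, 6 * ι ζ * ι e ^ 3 * y = ι S := by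
    by_cases hα : α = 0
    · have hβ : β ≠ 0 := hζ.resolve_left (not_not.2 hα)
      have hX : ζ = C β * X := by simp [hζd, hα]
      refine ⟨(E⁻¹ : (PowerSeries K)ˣ) ^ 3 * ι (C (1 / (6 * β)) * (4 * X ^ 2 * e ^ 3 * M -
        4 * X * e ^ 2 * G * P - 2 * C β * e * P ^ 2 + C w * C β * derivNumer₂ D P +
        2 * C w * C β * e * derivNumer D P)), ?_⟩
      have h1 : ι e ^ 3 * (E⁻¹ : (PowerSeries K)ˣ) ^ 3 = 1 := by
        rw [← hE, ← mul_pow, Units.mul_inv, one_pow]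
      have h2 : (6 : K[X]) * C β * C (1 / (6 * β)) = 1 := by
        rw [show (6 : K[X]) = C 6 from rfl, ← C_mul, ← C_mul, ← C_1]
        congr 1; field_simp
      have h3 : S = X * (4 * X ^ 2 * e ^ 3 * M -
        4 * X * e ^ 2 * G * P - 2 * C β * e * P ^ 2 + C w * C β * derivNumer₂ D P +
        2 * C w * C β * e * derivNumer D P) := by
        rw [hS, compatNumer, dζ, hX, hD]; ring
      have h4 := congrArg ι h2
      rw [h3]
      simp only [map_mul, map_one, hX] at h4 ⊢
      rw [show ι 6 = 6 from map_ofNat ι 6] at h4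
      linear_combination (6 * ι (C β) * ι X * ι (C (1 / (6 * β))) * ι (4 * X ^ 2 * e ^ 3 * M -
        4 * X * e ^ 2 * G * P - 2 * C β * e * P ^ 2 + C w * C β * derivNumer₂ D P +
        2 * C w * C β * e * derivNumer D P)) * h1 + ι X * ι (4 * X ^ 2 * e ^ 3 * M -
        4 * X * e ^ 2 * G * P - 2 * C β * e * P ^ 2 + C w * C β * derivNumer₂ D P +
        2 * C w * C β * e * derivNumer D P) * h4
    · have hu : IsUnit (6 * ι ζ * ι e ^ 3) := by
        rw [PowerSeries.isUnit_iff_constantCoeff]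
        have he' : e.coeff 0 ≠ 0 := by rwa [coeff_zero_eq_eval_zero]
        have h6 : PowerSeries.constantCoeff (6 : PowerSeries K) = 6 := map_ofNat _ 6
        simp [ι, hζd, hα, he', h6]
      obtain ⟨U, hU⟩ := hu
      exact ⟨(U⁻¹ : (PowerSeries K)ˣ) * ι S, by rw [← hU, ← mul_assoc, Units.mul_inv, one_mul]⟩
  obtain ⟨y, hy⟩ := hy
  obtain ⟨q, hq⟩ : ∃ q, ι e * q = ι P :=
    ⟨(E⁻¹ : (PowerSeries K)ˣ) * ι P, by rw [← hE, ← mul_assoc, Units.mul_inv, one_mul]⟩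
  have d6 : d (6 : PowerSeries K) = 0 := by
    rw [← map_ofNat (algebraMap K (PowerSeries K)) 6]; exact d.map_algebraMap _
  have hdX : d (ι X) = 1 := by rw [← ιd]; simp [ι]
  have hdζ : d (ι ζ) = ι (C β) := by rw [← ιd, dζ]
  have hdS : d (ι S) = 6 * (ι (C β) * ι e ^ 3 * y + 3 * ι ζ * ι e ^ 2 * d (ι e) * y
      + ι ζ * ι e ^ 3 * d y) := by
    rw [← hy, show ι e ^ 3 = ι e * (ι e * ι e) by ring]
    simp only [dmul, d6, hdζ]
    ring
  have hdP : d (ι P) = ι e * d q + d (ι e) * q := by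
    rw [← hq, dmul]
  have hdD : d (ι D) = ι e + ι X * d (ι e) := by
    rw [hD, map_mul, dmul, hdX]; ring
  have key := congrArg ι h
  simp only [← hS, dζ, map_sub, map_mul, map_pow, ιd, derivNumer, hdS, hdD, hdP] at key
  rw [← hy, ← hq] at key
  simp only [hD, map_mul, map_ofNat] at key
  -- With Q = q/x and Y = y/x³ this is Y' = V² multiplied by x⁴.
  have key2 : ι X * d y - 3 * y = (ι X * d q - q) ^ 2 := by
    have hne : 6 * ι ζ ^ 2 * ι e ^ 4 ≠ 0 := by
      have h6 : (6 : PowerSeries K) ≠ 0 := by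
        rw [← map_ofNat (PowerSeries.C (R := K)) 6]
        exact (map_ne_zero_iff _ PowerSeries.C_injective).2 (by norm_num)
      refine mul_ne_zero (mul_ne_zero h6 (pow_ne_zero 2 ?_)) (pow_ne_zero 4 ?_)
      · exact (map_ne_zero_iff ι ιinj).2 hζ0
      · rw [← hE]; exact E.ne_zero
    apply mul_left_cancel₀ hne
    linear_combination key
  -- Degree three isolates the residue of V². The left side has none, and the right side is -4 q₀ q₃
  -- because xq' - q has no linear term.
  have key3 := congrArg (PowerSeries.coeff 3) key2
  have hιX : ι X = PowerSeries.X := by simp [ι]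
  have dc : ∀ (f : PowerSeries K) n, PowerSeries.coeff n (d f) =
      PowerSeries.coeff (n + 1) f * (n + 1) := fun f n => PowerSeries.coeff_derivative f n
  have e0 : (PowerSeries.coeff 0) (PowerSeries.X * d q) = 0 := by simp
  have es : ∀ n (f : PowerSeries K), (PowerSeries.coeff (n + 1)) (PowerSeries.X * f) =
    PowerSeries.coeff n f := fun n f => PowerSeries.coeff_succ_X_mul n f
  rw [hιX] at key3
  set F := PowerSeries.X * d q - q with hF
  have F0 : PowerSeries.coeff 0 F = - PowerSeries.coeff 0 q := by rw [hF, map_sub, e0, zero_sub]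
  have F1 : PowerSeries.coeff 1 F = 0 := by
    rw [hF, map_sub, show (1 : ℕ) = 0 + 1 from rfl, es, dc]; push_cast; ring
  have F2 : PowerSeries.coeff 2 F = PowerSeries.coeff 2 q := by
    rw [hF, map_sub, show (2 : ℕ) = 1 + 1 from rfl, es, dc]; push_cast; ring
  have F3 : PowerSeries.coeff 3 F = 2 * PowerSeries.coeff 3 q := by
    rw [hF, map_sub, show (3 : ℕ) = 2 + 1 from rfl, es, dc]; push_cast; ring
  have L3 : PowerSeries.coeff 3 (PowerSeries.X * d y - 3 * y) = 0 := by
    rw [map_sub, ← map_ofNat (PowerSeries.C (R := K)) 3, PowerSeries.coeff_C_mul,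
      show PowerSeries.coeff 3 (PowerSeries.X * d y) = PowerSeries.coeff 2 (d y) from es 2 _, dc]
    push_cast; ring
  rw [L3, pow_two, PowerSeries.coeff_mul] at key3
  have ι0 : ∀ (f : K[X]) n, PowerSeries.coeff n (ι f) = f.coeff n := fun f n =>
    Polynomial.coeff_coe f n
  have hq' : ∀ n, PowerSeries.coeff n (ι e * q) = P.coeff n := fun n => by rw [hq, ι0]
  have q0 := hq' 0
  have q1 := hq' 1
  have q2 := hq' 2
  have q3 := hq' 3
  simp only [PowerSeries.coeff_mul, Finset.Nat.antidiagonal_succ, Finset.Nat.antidiagonal_zero,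
    Finset.sum_cons, Finset.map_singleton, Finset.sum_singleton, Finset.map_cons,
    Function.Embedding.prodMap, Function.Embedding.coeFn_mk, Prod.map, ι0,
    Function.Embedding.refl_apply, Nat.succ_eq_add_one, zero_add, Nat.reduceAdd, F0, F1, F2, F3] at q0 q1 q2 q3 key3
  have hP0 : P.coeff 0 ≠ 0 := by rwa [coeff_zero_eq_eval_zero]
  have hq0 : (PowerSeries.coeff 0) q ≠ 0 := by
    intro h0; rw [h0, mul_zero] at q0; exact hP0 q0.symm
  have hq3 : (PowerSeries.coeff 3) q = 0 := by
    have h4 : (4 : K) ≠ 0 := by norm_num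
    apply mul_left_cancel₀ (mul_ne_zero h4 hq0)
    linear_combination key3
  refine ⟨PowerSeries.coeff 0 q, PowerSeries.coeff 1 q, PowerSeries.coeff 2 q, q0, ?_, ?_, ?_⟩
  · linear_combination q1
  · linear_combination q2
  · rw [hq3] at q3; linear_combination q3

end Local

/-! ### Growth at infinity, base change and translation -/

section Global

open Polynomial

/-- `f` has degree at most `m` and its coefficient of degree `m` is `c`. -/
def HasTopCoeff {R : Type*} [CommRing R] (f : R[X]) (m : ℕ) (c : R) : Prop :=
  f.natDegree ≤ m ∧ f.coeff m = c

namespace HasTopCoeff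

variable {R : Type*} [CommRing R] {f g : R[X]} {m n : ℕ} {a b : R}

theorem mul (hf : HasTopCoeff f m a) (hg : HasTopCoeff g n b) :
    HasTopCoeff (f * g) (m + n) (a * b) :=
  ⟨natDegree_mul_le_of_le hf.1 hg.1, by rw [coeff_mul_add_eq_of_natDegree_le hf.1 hg.1, hf.2, hg.2]⟩

theorem pow (hf : HasTopCoeff f m a) (k : ℕ) : HasTopCoeff (f ^ k) (k * m) (a ^ k) :=
  ⟨natDegree_pow_le_of_le k hf.1, by rw [coeff_pow_of_natDegree_le hf.1, hf.2]⟩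

theorem add (hf : HasTopCoeff f m a) (hg : HasTopCoeff g m b) : HasTopCoeff (f + g) m (a + b) :=
  ⟨natDegree_add_le_of_degree_le hf.1 hg.1, by rw [coeff_add, hf.2, hg.2]⟩

theorem sub (hf : HasTopCoeff f m a) (hg : HasTopCoeff g m b) : HasTopCoeff (f - g) m (a - b) :=
  ⟨natDegree_sub_le_of_le hf.1 hg.1 |>.trans (max_self m).le, by rw [coeff_sub, hf.2, hg.2]⟩

/-- Unlike the plain derivative, the Euler operator preserves the degree bound, so top coefficients
can be tracked without truncated subtraction. -/
theorem euler (hf : HasTopCoeff f m a) : HasTopCoeff (X * derivative f) m (m * a) := by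
  have hc : ∀ k, (X * derivative f).coeff k = k * f.coeff k := by
    intro k
    cases k with
    | zero => simp
    | succ k => rw [coeff_X_mul, coeff_derivative]; push_cast; ring
  refine ⟨natDegree_le_iff_coeff_eq_zero.2 fun k hk => ?_, by rw [hc, hf.2]⟩
  rw [hc, coeff_eq_zero_of_natDegree_lt (hf.1.trans_lt hk), mul_zero]

theorem of_lt (hf : f.natDegree < m) : HasTopCoeff f m 0 :=
  ⟨hf.le, coeff_eq_zero_of_natDegree_lt hf⟩

theorem const (c : R) : HasTopCoeff (C c) 0 c := ⟨by simp, by simp⟩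

theorem X_self : HasTopCoeff (X : R[X]) 1 1 := ⟨natDegree_X_le, coeff_X_one⟩

theorem cast (hf : HasTopCoeff f m a) (h : m = n) : HasTopCoeff f n a := h ▸ hf

theorem lift (hf : HasTopCoeff f m a) (h : m < n) : HasTopCoeff f n 0 := of_lt (hf.1.trans_lt h)

end HasTopCoeff

theorem HasTopCoeff.self {R : Type*} [CommRing R] (f : R[X]) :
    HasTopCoeff f f.natDegree f.leadingCoeff := ⟨le_rfl, rfl⟩

theorem HasTopCoeff.of_le {R : Type*} [CommRing R] {f : R[X]} {m : ℕ} (h : f.natDegree ≤ m) :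
    HasTopCoeff f m (f.coeff m) := ⟨h, rfl⟩

/-- A rational solution of the compatibility equation grows at most like a cubic. -/
theorem CompatIdentity.natDegree_le {w : ℝ} {ζ G M D P : ℝ[X]} (h : CompatIdentity w ζ G M D P)
    (hζ0 : ζ ≠ 0) (hζ : ζ.natDegree ≤ 1) (hG : G.natDegree ≤ 2 + ζ.natDegree)
    (hM : M.natDegree ≤ 5 + ζ.natDegree) (hD : D ≠ 0) : P.natDegree ≤ D.natDegree + 3 := by
  by_contra! hlt
  -- Under the contrary assumption Q grows like x^(d+4).
  obtain ⟨d, hd⟩ := Nat.exists_eq_add_of_le hlt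
  set k := D.natDegree with hk
  have hn : P.natDegree = k + (d + 4) := by omega
  have hP : P ≠ 0 := by rintro rfl; simp at hlt
  have tD : HasTopCoeff D k D.leadingCoeff := HasTopCoeff.self D
  have tP : HasTopCoeff P (k + (d + 4)) P.leadingCoeff := hn ▸ HasTopCoeff.self P
  set A := D.leadingCoeff with hA
  set B := P.leadingCoeff with hB
  have hA0 : A ≠ 0 := leadingCoeff_ne_zero.2 hD
  have hB0 : B ≠ 0 := leadingCoeff_ne_zero.2 hP
  have tp1 : HasTopCoeff (X * derivNumer D P) (2 * k + (d + 4)) ((d + 4 : ℝ) * (A * B)) := by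
    have := ((tP.euler.mul tD).cast (by ring : _ = 2 * k + (d + 4))).sub
      ((tP.mul tD.euler).cast (by ring))
    have e : X * derivNumer D P = X * derivative P * D - P * (X * derivative D) := by
      rw [derivNumer]; ring
    rw [e]
    convert this using 1
    push_cast; ring
  have n1 : (derivNumer D P).natDegree ≤ 2 * k + (d + 4) := by
    by_cases h0 : derivNumer D P = 0
    · simp [h0]
    · have := tp1.1; rw [natDegree_X_mul h0] at this; omega
  have n2 : (derivNumer₂ D P).natDegree ≤ 3 * k + (d + 4) := by
    have t2 := (((HasTopCoeff.of_le n1).euler.mul tD).cast (by ring : _ = 3 * k + (d + 4))).sub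
      ((((HasTopCoeff.const (2 : ℝ)).mul (HasTopCoeff.of_le n1)).mul tD.euler).cast (by ring))
    have e : X * derivNumer₂ D P = X * derivative (derivNumer D P) * D
        - C 2 * derivNumer D P * (X * derivative D) := by
      rw [derivNumer₂, C_ofNat]; ring
    rw [← e] at t2
    by_cases h0 : derivNumer₂ D P = 0
    · simp [h0]
    · have := t2.1; rw [natDegree_X_mul h0] at this; omega
  set S := compatNumer w ζ G M D P with hS
  have key : X * (ζ * D * (X * derivative S) - X * derivative ζ * D * S
      - C 3 * ζ * (X * derivative D) * S) = C 6 * ζ ^ 2 * (X * derivNumer D P) ^ 2 := by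
    have := h
    rw [CompatIdentity, ← hS] at this
    rw [C_ofNat, C_ofNat]
    linear_combination X ^ 2 * this
  have tζ : HasTopCoeff ζ ζ.natDegree ζ.leadingCoeff := HasTopCoeff.self ζ
  have hZ0 : ζ.leadingCoeff ≠ 0 := leadingCoeff_ne_zero.2 hζ0
  have eS : S = C 4 * D ^ 3 * M - C 4 * D ^ 2 * G * P - C 2 * derivative ζ * D * P ^ 2 +
    C w * ζ * derivNumer₂ D P + C 2 * C w * derivative ζ * D * derivNumer D P := by
    rw [hS, compatNumer]; simp only [C_ofNat]
  have tr := ((HasTopCoeff.const (6 : ℝ)).mul (tζ.pow 2)).mul (tp1.pow 2)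
  rcases Nat.le_one_iff_eq_zero_or_eq_one.1 hζ with h0 | h1
  -- Constant ζ: the compatibility equation bounds Y by x^(d+6), while a primitive of V² grows like
  -- x^(2d+7).
  · have dζ : derivative ζ = 0 := by rw [derivative_of_natDegree_zero h0]
    rw [h0] at tζ hG hM tr
    have tS : HasTopCoeff S (3 * k + (d + 4) + 2) (S.coeff (3 * k + (d + 4) + 2)) := by
      apply HasTopCoeff.of_le
      rw [eS, dζ]
      have b1 := ((HasTopCoeff.const (4 : ℝ)).mul (tD.pow 3)).mul (HasTopCoeff.of_le hM)
      have b2 := (((HasTopCoeff.const (4 : ℝ)).mul (tD.pow 2)).mul (HasTopCoeff.of_le hG)).mul tP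
      have b3 := ((HasTopCoeff.const w).mul tζ).mul (HasTopCoeff.of_le n2)
      have := ((b1.lift (n := 3 * k + (d + 4) + 3) (by omega)).sub
        (b2.lift (by omega))).add (b3.lift (by omega))
      have e := b1.1
      simp only [mul_zero, zero_mul, sub_zero, add_zero]
      refine natDegree_add_le_of_degree_le (natDegree_sub_le_of_le (b1.1.trans (by omega))
        (b2.1.trans (by omega)) |>.trans (max_self _).le) (b3.1.trans (by omega))
    have tl := HasTopCoeff.X_self.mul (((((tζ.mul tD).mul tS.euler).cast
      (by ring : _ = 4 * k + (d + 4) + 2)).sub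
      ((HasTopCoeff.mul (HasTopCoeff.mul (f := X * derivative ζ) (m := 0) (a := 0)
        (by simp [dζ, HasTopCoeff]) tD) tS).cast (by ring))).sub
      (((((HasTopCoeff.const (3 : ℝ)).mul tζ).mul tD.euler).mul tS).cast (by ring)))
    rw [key] at tl
    have t0 := (tl.lift (n := 0 + 2 * 0 + 2 * (2 * k + (d + 4))) (by omega)).2
    rw [tr.2] at t0
    have : (d + 4 : ℝ) ≠ 0 := by positivity
    simp [hZ0, hA0, hB0, this] at t0
  -- Affine ζ: Y is -Q²/(3x) to leading order, so the top coefficients of Y' and V² have opposite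
  -- signs.
  · set β := ζ.leadingCoeff with hβ
    have dζ : derivative ζ = C β := by
      have hb : β = ζ.coeff 1 := by rw [hβ, leadingCoeff, h1]
      have e := eq_X_add_C_of_natDegree_le_one hζ
      rw [e]; simp [hb]
    rw [h1] at tζ hG hM tr
    have b1 := ((HasTopCoeff.const (4 : ℝ)).mul (tD.pow 3)).mul (HasTopCoeff.of_le hM)
    have b2 := (((HasTopCoeff.const (4 : ℝ)).mul (tD.pow 2)).mul (HasTopCoeff.of_le hG)).mul tP
    have b3 := (((HasTopCoeff.const (2 : ℝ)).mul (HasTopCoeff.const β)).mul tD).mul (tP.pow 2)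
    have b4 := ((HasTopCoeff.const w).mul tζ).mul (HasTopCoeff.of_le n2)
    have b5 := ((((HasTopCoeff.const (2 : ℝ)).mul (HasTopCoeff.const w)).mul
      (HasTopCoeff.const β)).mul tD).mul (HasTopCoeff.of_le n1)
    have tS := (((((b1.lift (n := 3 * k + 2 * (d + 4)) (by omega)).sub
      (b2.lift (by omega))).sub (b3.cast (by ring))).add (b4.lift (by omega))).add
      (b5.lift (by omega)))
    rw [← dζ, ← eS] at tS
    have tl := HasTopCoeff.X_self.mul (((((tζ.mul tD).mul tS.euler).cast
      (by ring : _ = 4 * k + 2 * (d + 4) + 1)).sub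
      (((HasTopCoeff.X_self.mul (HasTopCoeff.const β)).mul tD).mul tS |>.cast (by ring))).sub
      (((((HasTopCoeff.const (3 : ℝ)).mul tζ).mul tD.euler).mul tS).cast (by ring)))
    rw [← dζ, key] at tl
    have t0 := (tl.cast (by ring : _ = 0 + 2 * 1 + 2 * (2 * k + (d + 4)))).2
    rw [tr.2] at t0
    have hc : 0 < β ^ 2 * A ^ 2 * B ^ 2 := by positivity
    push_cast at t0
    have : β ^ 2 * A ^ 2 * B ^ 2 * (6 * (d + 4) ^ 2 + 2 * (2 * (d + 4) - 1)) = 0 := by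
      linear_combination t0
    have h2 : (0:ℝ) < 6 * (d + 4) ^ 2 + 2 * (2 * (d + 4) - 1) := by
      have : (0:ℝ) ≤ d := by positivity
      nlinarith
    exact absurd this (mul_pos hc h2).ne'

/-- The identity is built from ring operations, derivatives and the constant w only. This covers
both the passage to complex coefficients and translation of a pole to the origin. -/
theorem CompatIdentity.hom {K L : Type*} [Field K] [Field L] (τ : K[X] →+* L[X])
    (hτ : ∀ f, τ (derivative f) = derivative (τ f)) {w : K} {w' : L} (hw : τ (C w) = C w')
    {ζ G M D P : K[X]} (h : CompatIdentity w ζ G M D P) :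
    CompatIdentity w' (τ ζ) (τ G) (τ M) (τ D) (τ P) := by
  have h1 : τ (derivNumer D P) = derivNumer (τ D) (τ P) := by
    simp only [derivNumer, map_sub, map_mul, hτ]
  have h2 : τ (derivNumer₂ D P) = derivNumer₂ (τ D) (τ P) := by
    simp only [derivNumer₂, map_sub, map_mul, hτ, h1, map_ofNat]
  have h3 : τ (compatNumer w ζ G M D P) = compatNumer w' (τ ζ) (τ G) (τ M) (τ D) (τ P) := by
    simp only [compatNumer, map_sub, map_add, map_mul, map_pow, hτ, h1, h2, map_ofNat, hw]
  have := congrArg τ h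
  simp only [map_sub, map_mul, map_pow, hτ, h1, h3, map_ofNat] at this
  exact this

theorem CompatIdentity.map {K L : Type*} [Field K] [Field L] (σ : K →+* L) {w : K}
    {ζ G M D P : K[X]} (h : CompatIdentity w ζ G M D P) :
    CompatIdentity (σ w) (ζ.map σ) (G.map σ) (M.map σ) (D.map σ) (P.map σ) :=
  h.hom (mapRingHom σ) (fun f => (derivative_map f σ).symm) (map_C σ)

theorem CompatIdentity.comp_taylor {K : Type*} [Field K] (r : K) {w : K}
    {ζ G M D P : K[X]} (h : CompatIdentity w ζ G M D P) :
    CompatIdentity w (taylor r ζ) (taylor r G) (taylor r M) (taylor r D) (taylor r P) :=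
  h.hom (taylorAlgHom r : K[X] →+* K[X]) (fun f => by simp [taylor_apply, derivative_comp])
    (by simp)

/-- The poles of a rational solution of the compatibility equation: they are simple, the residue
is determined unless the leading coefficient vanishes there, and the regular part has no
coefficient of degree two. -/
theorem CompatIdentity.pole {K : Type*} [Field K] [CharZero K] {w : K}
    {ζ G M D P : K[X]} (h : CompatIdentity w ζ G M D P) (hζ0 : ζ ≠ 0) (hζ : ζ.natDegree ≤ 1)
    (hD : D ≠ 0) {r : K} (hr : D.eval r = 0) (hP : P.eval r ≠ 0) :
    (derivative D).eval r ≠ 0 ∧ (ζ.eval r ≠ 0 → P.eval r = -w * (derivative D).eval r) ∧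
    ∃ q₀ q₁ q₂ : K, (taylor r D).coeff 1 * q₀ = (taylor r P).coeff 0 ∧
      (taylor r D).coeff 1 * q₁ + (taylor r D).coeff 2 * q₀ = (taylor r P).coeff 1 ∧
      (taylor r D).coeff 1 * q₂ + (taylor r D).coeff 2 * q₁ + (taylor r D).coeff 3 * q₀ =
        (taylor r P).coeff 2 ∧
      (taylor r D).coeff 2 * q₂ + (taylor r D).coeff 3 * q₁ + (taylor r D).coeff 4 * q₀ =
        (taylor r P).coeff 3 := by
  have h1 := h.comp_taylor r
  have hζt : taylor r ζ = C (ζ.eval r) + C ((taylor r ζ).coeff 1) * X := by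
    have := eq_X_add_C_of_natDegree_le_one (p := taylor r ζ) (by rwa [natDegree_taylor])
    rw [taylor_coeff_zero] at this
    rw [add_comm]; exact this
  have hne : ζ.eval r ≠ 0 ∨ (taylor r ζ).coeff 1 ≠ 0 := by
    by_contra! hc
    rw [hc.1, hc.2] at hζt
    apply hζ0
    apply taylor_injective r
    rw [hζt]; simp
  have hDt : taylor r D ≠ 0 := fun h0 => hD (taylor_injective r (by rw [h0, map_zero]))
  obtain ⟨e, he, hnd⟩ := exists_eq_pow_rootMultiplicity_mul_and_not_dvd (taylor r D) hDt 0
  set m := rootMultiplicity 0 (taylor r D) with hm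
  simp only [C_0, sub_zero] at he hnd
  have he0 : e.eval 0 ≠ 0 := by rwa [X_dvd_iff, coeff_zero_eq_eval_zero] at hnd
  have hPt : (taylor r P).eval 0 ≠ 0 := by rwa [← coeff_zero_eq_eval_zero, taylor_coeff_zero]
  rw [hζt] at h1
  have hm1 : m = 1 := by
    rcases Nat.lt_trichotomy m 1 with h' | h' | h'
    · exfalso
      have hm0 : m = 0 := by omega
      rw [hm0, pow_zero, one_mul] at he
      rw [← he, ← coeff_zero_eq_eval_zero, taylor_coeff_zero] at he0
      exact he0 hr
    · exact h'
    · obtain ⟨k, hk⟩ := Nat.exists_eq_add_of_le' (show 2 ≤ m from h')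
      rw [he, hk] at h1
      exact (h1.false_of_sq_dvd hne he0 hPt).elim
  rw [hm1, pow_one] at he
  rw [he] at h1
  have hc : ∀ n, (taylor r D).coeff (n + 1) = e.coeff n := fun n => by rw [he, coeff_X_mul]
  have hd : (derivative D).eval r = e.eval 0 := by
    rw [← taylor_coeff_one, hc 0, coeff_zero_eq_eval_zero]
  refine ⟨hd ▸ he0, fun hα => ?_, ?_⟩
  · rw [hd, ← h1.residue hα he0 hPt, ← coeff_zero_eq_eval_zero, taylor_coeff_zero]
  · rw [hc 0, hc 1, hc 2, hc 3]
    exact h1.coeff_regularPart hne he0 hPt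

end Global

/-! ### Algebraic conditions on the poles, by degree of the denominator -/

section Residues

open Polynomial

/-- At the root `r` of `D` the function `P / D` has at most a simple pole, and the coefficient of
degree two of its regular part vanishes. -/
def ApparentPole {K : Type*} [Field K] (D P : K[X]) (r : K) : Prop :=
  (derivative D).eval r ≠ 0 ∧
    ∃ q₀ q₁ q₂ : K, (derivative D).eval r * q₀ = P.eval r ∧
      2 * (derivative D).eval r * q₁ + (derivative^[2] D).eval r * q₀ =
        2 * (derivative P).eval r ∧
      6 * (derivative D).eval r * q₂ + 3 * (derivative^[2] D).eval r * q₁ +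
        (derivative^[3] D).eval r * q₀ = 3 * (derivative^[2] P).eval r ∧
      12 * (derivative^[2] D).eval r * q₂ + 4 * (derivative^[3] D).eval r * q₁ +
        (derivative^[4] D).eval r * q₀ = 4 * (derivative^[3] P).eval r

theorem factorial_mul_taylor_coeff {K : Type*} [Field K] (f : K[X]) (r : K) (n : ℕ) :
    (n ! : K) * (taylor r f).coeff n = (derivative^[n] f).eval r := by
  rw [taylor_coeff, ← factorial_smul_hasseDeriv]
  simp

theorem CompatIdentity.apparentPole {K : Type*} [Field K] [CharZero K] {w : K}
    {ζ G M D P : K[X]} (h : CompatIdentity w ζ G M D P) (hζ0 : ζ ≠ 0) (hζ : ζ.natDegree ≤ 1)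
    (hD : D ≠ 0) {r : K} (hr : D.eval r = 0) (hP : P.eval r ≠ 0) : ApparentPole D P r := by
  obtain ⟨h1, -, q₀, q₁, q₂, e0, e1, e2, e3⟩ := h.pole hζ0 hζ hD hr hP
  have tD := factorial_mul_taylor_coeff D r
  have tP := factorial_mul_taylor_coeff P r
  refine ⟨h1, q₀, q₁, q₂, ?_, ?_, ?_, ?_⟩
  · rw [← taylor_coeff_one, e0, taylor_coeff_zero]
  · rw [← taylor_coeff_one, ← taylor_coeff_one, ← tD 2]
    simp only [Nat.factorial]; push_cast
    linear_combination 2 * e1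
  · rw [← taylor_coeff_one, ← tD 2, ← tD 3, ← tP 2]
    simp only [Nat.factorial]; push_cast
    linear_combination 6 * e2
  · rw [← tD 2, ← tD 3, ← tD 4, ← tP 3]
    simp only [Nat.factorial]; push_cast
    linear_combination 24 * e3

/-- A polynomial with simple roots over an algebraically closed field has as many distinct roots as
its degree. -/
theorem eq_zero_of_forall_root {K : Type*} [Field K] [IsAlgClosed K] {D F : K[X]} (hD : D ≠ 0)
    (hs : ∀ r, D.eval r = 0 → (derivative D).eval r ≠ 0) (hF : F.natDegree < D.natDegree)
    (h : ∀ r, D.eval r = 0 → F.eval r = 0) : F = 0 := by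
  classical
  have hnd : D.roots.Nodup := by
    rw [Multiset.nodup_iff_count_le_one]
    intro a
    by_contra! hlt
    rw [count_roots] at hlt
    have := (one_lt_rootMultiplicity_iff_isRoot hD).1 hlt
    exact hs a this.1 this.2
  refine eq_zero_of_natDegree_lt_card_of_eval_eq_zero' F D.roots.toFinset (fun a ha => ?_) ?_
  · rw [Multiset.mem_toFinset, mem_roots hD] at ha
    exact h a ha
  · rwa [Multiset.toFinset_card_of_nodup hnd, splits_iff_card_roots.1 (IsAlgClosed.splits D)]

/-- The polynomial of degree at most six with the given coefficients. -/
noncomputable def sextic {K : Type*} [Field K] (a₀ a₁ a₂ a₃ a₄ a₅ a₆ : K) : K[X] :=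
  C a₀ + C a₁ * X + C a₂ * X ^ 2 + C a₃ * X ^ 3 + C a₄ * X ^ 4 + C a₅ * X ^ 5 + C a₆ * X ^ 6

theorem derivative_sextic {K : Type*} [Field K] (a₀ a₁ a₂ a₃ a₄ a₅ a₆ : K) :
    derivative (sextic a₀ a₁ a₂ a₃ a₄ a₅ a₆) =
      sextic a₁ (2 * a₂) (3 * a₃) (4 * a₄) (5 * a₅) (6 * a₆) 0 := by
  simp only [sextic, derivative_add, derivative_C, derivative_C_mul_X, derivative_C_mul_X_pow]
  norm_num [mul_comm]

theorem eval_sextic {K : Type*} [Field K] (a₀ a₁ a₂ a₃ a₄ a₅ a₆ x : K) :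
    (sextic a₀ a₁ a₂ a₃ a₄ a₅ a₆).eval x =
      a₀ + a₁ * x + a₂ * x ^ 2 + a₃ * x ^ 3 + a₄ * x ^ 4 + a₅ * x ^ 5 + a₆ * x ^ 6 := by
  simp [sextic]

theorem iterate_derivative_sextic {K : Type*} [Field K] (a₀ a₁ a₂ a₃ a₄ a₅ a₆ : K) :
    derivative^[2] (sextic a₀ a₁ a₂ a₃ a₄ a₅ a₆) =
        sextic (2 * a₂) (6 * a₃) (12 * a₄) (20 * a₅) (30 * a₆) 0 0 ∧
      derivative^[3] (sextic a₀ a₁ a₂ a₃ a₄ a₅ a₆) =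
        sextic (6 * a₃) (24 * a₄) (60 * a₅) (120 * a₆) 0 0 0 ∧
      derivative^[4] (sextic a₀ a₁ a₂ a₃ a₄ a₅ a₆) =
        sextic (24 * a₄) (120 * a₅) (360 * a₆) 0 0 0 0 ∧
      derivative^[5] (sextic a₀ a₁ a₂ a₃ a₄ a₅ a₆) =
        sextic (120 * a₅) (720 * a₆) 0 0 0 0 0 := by
  have i2 : ∀ f : K[X], derivative^[2] f = derivative (derivative f) := fun _ => rfl
  have i3 : ∀ f : K[X], derivative^[3] f = derivative (derivative (derivative f)) := fun _ => rfl
  have i4 : ∀ f : K[X], derivative^[4] f =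
    derivative (derivative (derivative (derivative f))) := fun _ => rfl
  have i5 : ∀ f : K[X], derivative^[5] f =
    derivative (derivative (derivative (derivative (derivative f)))) := fun _ => rfl
  rw [i2, i3, i4, i5]
  simp only [derivative_sextic]
  refine ⟨?_, ?_, ?_, ?_⟩ <;> congr 1 <;> ring

/-- The quotient and remainder form of a numerator over `X ^ 2 - b`. -/
theorem sextic_eq_two {K : Type*} [Field K] (b c₀ c₁ c₂ c₃ r₀ r₁ : K) :
    (C c₀ + C c₁ * X + C c₂ * X ^ 2 + C c₃ * X ^ 3) * (X ^ 2 - C b) + (C r₀ + C r₁ * X) =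
      sextic (r₀ - b * c₀) (r₁ - b * c₁) (c₀ - b * c₂) (c₁ - b * c₃) c₂ c₃ 0 := by
  simp only [sextic, C_sub, C_mul, C_0]; ring

theorem sextic_eq_three {K : Type*} [Field K] (p r c₀ c₁ c₂ c₃ r₀ r₁ r₂ : K) :
    (C c₀ + C c₁ * X + C c₂ * X ^ 2 + C c₃ * X ^ 3) * (X ^ 3 + C p * X + C r) +
        (C r₀ + C r₁ * X + C r₂ * X ^ 2) =
      sextic (r₀ + r * c₀) (r₁ + r * c₁ + p * c₀) (r₂ + r * c₂ + p * c₁) (c₀ + p * c₂ + r * c₃)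
        (c₁ + p * c₃) c₂ c₃ := by
  simp only [sextic, C_add, C_mul]; ring

variable {w b p r c₀ c₁ c₂ c₃ r₀ r₁ r₂ : ℂ}

/-- The quadratic Taylor coefficient at ρ of the polynomial part is c₂ + 3c₃ρ, and the pole at -ρ
contributes the rest; note that r₁ρ - r₀ is minus the numerator's value at -ρ. -/
theorem ApparentPole.two {ρ : ℂ} (hρ : ρ ^ 2 = b)
    (h : ApparentPole (X ^ 2 - C b)
      (sextic (r₀ - b * c₀) (r₁ - b * c₁) (c₀ - b * c₂) (c₁ - b * c₃) c₂ c₃ 0) ρ) :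
    ρ ≠ 0 ∧ 16 * b ^ 2 * (c₂ + 3 * c₃ * ρ) + r₁ * ρ - r₀ = 0 := by
  have eD : (X ^ 2 - C b : ℂ[X]) = sextic (-b) 0 1 0 0 0 0 := by
    simp only [sextic, C_neg, C_0, C_1]; ring
  rw [eD] at h
  obtain ⟨h0, q₀, q₁, q₂, e0, e1, e2, e3⟩ := h
  simp only [derivative_sextic, (iterate_derivative_sextic _ _ _ _ _ _ _).1,
    (iterate_derivative_sextic _ _ _ _ _ _ _).2.1, (iterate_derivative_sextic _ _ _ _ _ _ _).2.2.1,
    eval_sextic] at h0 e0 e1 e2 e3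
  have h0 : ρ ≠ 0 := by rintro rfl; simp at h0
  refine ⟨h0, ?_⟩
  subst hρ
  -- The weights eliminate the Laurent coefficients q₀, q₁, q₂.
  linear_combination e0 - ρ * e1 + (2 / 3) * ρ ^ 2 * e2 - (1 / 3) * ρ ^ 3 * e3

/-- As for two poles: the quadratic coefficient of the polynomial part balances that of the other
two poles, here multiplied by the fourth power of D'(ρ) = 3ρ² + p. -/
theorem ApparentPole.three {ρ : ℂ} (hρ : ρ ^ 3 + p * ρ + r = 0)
    (h : ApparentPole (X ^ 3 + C p * X + C r)
      (sextic (r₀ + r * c₀) (r₁ + r * c₁ + p * c₀) (r₂ + r * c₂ + p * c₁) (c₀ + p * c₂ + r * c₃)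
        (c₁ + p * c₃) c₂ c₃) ρ) :
    3 * ρ ^ 2 + p ≠ 0 ∧ (3 * ρ ^ 2 + p) ^ 4 * (c₂ + 3 * c₃ * ρ) =
      3 * ρ * (3 * ρ ^ 2 + p) ^ 2 * r₂
        + ((3 * ρ ^ 2 + p) ^ 2 - 9 * ρ ^ 2 * (3 * ρ ^ 2 + p)) * (r₁ + 2 * r₂ * ρ)
        + (27 * ρ ^ 3 - 6 * ρ * (3 * ρ ^ 2 + p)) * (r₀ + r₁ * ρ + r₂ * ρ ^ 2) := by
  have eD : (X ^ 3 + C p * X + C r : ℂ[X]) = sextic r p 0 1 0 0 0 := by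
    simp only [sextic, C_0, C_1]; ring
  rw [eD] at h
  obtain ⟨h0, q₀, q₁, q₂, e0, e1, e2, e3⟩ := h
  simp only [derivative_sextic, (iterate_derivative_sextic _ _ _ _ _ _ _).1,
    (iterate_derivative_sextic _ _ _ _ _ _ _).2.1, (iterate_derivative_sextic _ _ _ _ _ _ _).2.2.1,
    eval_sextic] at h0 e0 e1 e2 e3
  have h0 : 3 * ρ ^ 2 + p ≠ 0 := fun h => h0 (by linear_combination h)
  obtain rfl : r = -(ρ ^ 3 + p * ρ) := by linear_combination hρ
  refine ⟨h0, ?_⟩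
  obtain ⟨d, hd⟩ : ∃ d, d = 3 * ρ ^ 2 + p := ⟨_, rfl⟩
  obtain rfl : p = d - 3 * ρ ^ 2 := by rw [hd]; ring
  rw [← hd]
  linear_combination (27 * ρ ^ 3 - 6 * ρ * d) * e0 + (d ^ 2 - 9 * ρ ^ 2 * d) / 2 * e1
    + (3 * ρ * d ^ 2) / 6 * e2 - d ^ 3 / 24 * e3

/-- At the zero `r` of the affine function `ζ`, the second derivative of `u` and the fifth one of
`v` vanish. -/
def CentralZero {K : Type*} [Field K] (ζ u v : K[X]) (r : K) : Prop :=
  ζ.eval r = 0 ∧ (derivative^[2] u).eval r = 0 ∧ (derivative^[5] v).eval r = 0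

/-- The conditions on the poles of the rational function `P / D`. -/
def PoleConditions (w : ℂ) (ζ g D P : ℂ[X]) : Prop :=
  ∀ ρ, D.eval ρ = 0 → P.eval ρ ≠ 0 ∧ ApparentPole D P ρ ∧
    (P.eval ρ = -w * (derivative D).eval ρ ∨ CentralZero ζ (g * D) (g * P) ρ)

/-- The second-derivative condition gives g₀ = -3ρg₁, hence g₁ ≠ 0; the fifth-derivative condition
divided by 120 g₁ is the claim. -/
theorem CentralZero.two {ζ : ℂ[X]} {g₀ g₁ ρ : ℂ} (hg : C g₀ + C g₁ * X ≠ 0)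
    (h : CentralZero ζ ((C g₀ + C g₁ * X) * (X ^ 2 - C b)) ((C g₀ + C g₁ * X) *
      (sextic (r₀ - b * c₀) (r₁ - b * c₁) (c₀ - b * c₂) (c₁ - b * c₃) c₂ c₃ 0)) ρ) :
    c₂ + 3 * ρ * c₃ = 0 := by
  obtain ⟨-, hu, hv⟩ := h
  have eu : (C g₀ + C g₁ * X) * (X ^ 2 - C b) = sextic (-b * g₀) (-b * g₁) g₀ g₁ 0 0 0 := by
    simp only [sextic, C_mul, C_neg, C_0]; ring
  have ev : (C g₀ + C g₁ * X) *
      (sextic (r₀ - b * c₀) (r₁ - b * c₁) (c₀ - b * c₂) (c₁ - b * c₃) c₂ c₃ 0) =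
      sextic (g₀ * (r₀ - b * c₀)) (g₀ * (r₁ - b * c₁) + g₁ * (r₀ - b * c₀))
        (g₀ * (c₀ - b * c₂) + g₁ * (r₁ - b * c₁)) (g₀ * (c₁ - b * c₃) + g₁ * (c₀ - b * c₂))
        (g₀ * c₂ + g₁ * (c₁ - b * c₃)) (g₀ * c₃ + g₁ * c₂) (g₁ * c₃) := by
    simp only [sextic, C_mul, C_sub, C_add, C_0]; ring
  rw [eu, (iterate_derivative_sextic ..).1, eval_sextic] at hu
  rw [ev, (iterate_derivative_sextic ..).2.2.2, eval_sextic] at hv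
  have hg0 : g₀ = -3 * ρ * g₁ := by linear_combination hu / 2
  have hg1 : g₁ ≠ 0 := by
    rintro rfl
    apply hg; rw [hg0]; simp
  apply mul_left_cancel₀ hg1
  rw [hg0] at hv
  linear_combination hv / 120

/-- Neither pole can be central, so both residues are -w and the two apparent-pole conditions
determine c₂ and c₃. -/
theorem PoleConditions.two {ζ g : ℂ[X]} (hg : g ≠ 0) (hg1 : g.natDegree ≤ 1)
    (h : PoleConditions w ζ g (X ^ 2 - C b)
      (sextic (r₀ - b * c₀) (r₁ - b * c₁) (c₀ - b * c₂) (c₁ - b * c₃) c₂ c₃ 0)) :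
    b ≠ 0 ∧ c₂ = 0 ∧ r₀ = 0 ∧ r₁ = -2 * w ∧ 24 * b ^ 2 * c₃ = w := by
  have root : ∀ {ρ : ℂ}, ρ ^ 2 = b → (X ^ 2 - C b : ℂ[X]).eval ρ = 0 := fun hρ => by simp [hρ]
  obtain ⟨σ, hσ⟩ : ∃ σ : ℂ, σ ^ 2 = b := IsAlgClosed.exists_pow_nat_eq b (by norm_num)
  have hσ' : (-σ) ^ 2 = b := by rw [neg_sq, hσ]
  obtain ⟨n1, a1, m1⟩ := h σ (root hσ)
  obtain ⟨n2, a2, m2⟩ := h (-σ) (root hσ')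
  obtain ⟨hσ0, k1⟩ := a1.two hσ
  obtain ⟨-, k2⟩ := a2.two hσ'
  have v : ∀ {ρ : ℂ}, ρ ^ 2 = b →
      (sextic (r₀ - b * c₀) (r₁ - b * c₁) (c₀ - b * c₂) (c₁ - b * c₃) c₂ c₃ 0).eval ρ =
        r₁ * ρ + r₀ := fun {ρ} hρ => by
    rw [eval_sextic, ← hρ]; ring
  rw [v hσ] at n1 m1
  rw [v hσ'] at n2 m2
  have hb : b ≠ 0 := by rw [← hσ]; exact pow_ne_zero 2 hσ0
  obtain ⟨g₀, g₁, hgg⟩ : ∃ g₀ g₁, g = C g₀ + C g₁ * X :=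
    ⟨g.coeff 0, g.coeff 1, by rw [add_comm]; exact eq_X_add_C_of_natDegree_le_one hg1⟩
  -- At a central pole c₂ + 3c₃ρ = 0, so the apparent-pole condition makes the numerator vanish at
  -- -ρ, which is also a pole.
  have noncentral : ∀ ρ : ℂ, ρ ^ 2 = b → ρ ≠ 0 → r₁ * (-ρ) + r₀ ≠ 0 →
      16 * b ^ 2 * (c₂ + 3 * c₃ * ρ) + r₁ * ρ - r₀ = 0 →
      ¬ CentralZero ζ (g * (X ^ 2 - C b)) (g * (sextic (r₀ - b * c₀) (r₁ - b * c₁) (c₀ - b * c₂)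
        (c₁ - b * c₃) c₂ c₃ 0)) ρ := by
    intro ρ hρ hρ0 hne hk hc
    rw [hgg] at hc hg
    apply hne
    linear_combination -hk + 16 * b ^ 2 * hc.two hg
  have s1 := m1.resolve_right (noncentral σ hσ hσ0 n2 k1)
  have s2 := m2.resolve_right (noncentral (-σ) hσ' (neg_ne_zero.2 hσ0) (by rwa [neg_neg]) k2)
  simp at s1 s2
  have hr0 : r₀ = 0 := by linear_combination (s1 + s2) / 2
  have hr1 : r₁ = -2 * w := by
    apply mul_right_cancel₀ hσ0
    linear_combination s1 - hr0
  have hc2 : c₂ = 0 := by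
    apply mul_left_cancel₀ (mul_ne_zero (by norm_num : (32 : ℂ) ≠ 0) (pow_ne_zero 2 hb))
    linear_combination k1 + k2 + 2 * hr0
  refine ⟨hb, hc2, hr0, hr1, ?_⟩
  apply mul_right_cancel₀ hσ0
  linear_combination (k1 - k2) / 4 - σ / 2 * hr1

theorem coeff_eq_zero_of_roots {D : ℂ[X]} (hD : D ≠ 0)
    (hs : ∀ r, D.eval r = 0 → (derivative D).eval r ≠ 0) (h3 : 2 < D.natDegree) {x y z : ℂ}
    (h : ∀ ρ, D.eval ρ = 0 → x + y * ρ + z * ρ ^ 2 = 0) : x = 0 ∧ y = 0 ∧ z = 0 := by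
  have := eq_zero_of_forall_root (F := C x + C y * X + C z * X ^ 2) hD hs
    (lt_of_le_of_lt (by compute_degree) h3) (fun ρ hρ => by simpa using h ρ hρ)
  have h0 := congrArg (coeff · 0) this
  have h1 := congrArg (coeff · 1) this
  have h2 := congrArg (coeff · 2) this
  simp [coeff_X, coeff_C] at h0 h1 h2
  exact ⟨h0, h1, h2⟩

/-- Either one pole is central, and then the poles are 0 and ±σ with a free residue at 0, or all
residues are -w and the polar part is -w D'/D. -/
theorem PoleConditions.three {ζ : ℂ[X]} {g₀ : ℂ} (hg : g₀ ≠ 0) (hζ : ζ ≠ 0)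
    (hζ1 : ζ.natDegree ≤ 1)
    (h : PoleConditions w ζ (C g₀) (X ^ 3 + C p * X + C r)
      (sextic (r₀ + r * c₀) (r₁ + r * c₁ + p * c₀) (r₂ + r * c₂ + p * c₁) (c₀ + p * c₂ + r * c₃)
        (c₁ + p * c₃) c₂ c₃)) :
    c₂ = 0 ∧ r₁ = 0 ∧ ((p = 0 ∧ c₃ = 0 ∧ r₀ = 0 ∧ r₂ = -3 * w) ∨
      (r = 0 ∧ p ≠ 0 ∧ r₀ = p * (2 * w + r₂) ∧ 3 * p ^ 2 * c₃ = w / 8 - (2 * w + r₂))) := by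
  set D : ℂ[X] := X ^ 3 + C p * X + C r with hD
  have hDn : D.natDegree = 3 := by rw [hD]; compute_degree!
  have hD0 : D ≠ 0 := by rintro h0; rw [h0] at hDn; simp at hDn
  have ev : ∀ ρ, D.eval ρ = ρ ^ 3 + p * ρ + r := fun ρ => by simp [hD]
  have dv : ∀ ρ, (derivative D).eval ρ = 3 * ρ ^ 2 + p := fun ρ => by
    simp [hD]; norm_num
  have hs : ∀ ρ, D.eval ρ = 0 → (derivative D).eval ρ ≠ 0 := fun ρ hρ => (h ρ hρ).2.1.1
  have key := fun ρ (hρ : D.eval ρ = 0) => ((h ρ hρ).2.1).three (by rw [← ev, hρ])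
  have pv : ∀ ρ, D.eval ρ = 0 → (sextic (r₀ + r * c₀) (r₁ + r * c₁ + p * c₀)
      (r₂ + r * c₂ + p * c₁) (c₀ + p * c₂ + r * c₃) (c₁ + p * c₃) c₂ c₃).eval ρ =
      r₀ + r₁ * ρ + r₂ * ρ ^ 2 := fun ρ hρ => by
    rw [ev] at hρ
    rw [eval_sextic]
    linear_combination (c₀ + c₁ * ρ + c₂ * ρ ^ 2 + c₃ * ρ ^ 3) * hρ
  by_cases hc : ∃ ρ, D.eval ρ = 0 ∧ CentralZero ζ (C g₀ * D) (C g₀ * (sextic (r₀ + r * c₀)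
      (r₁ + r * c₁ + p * c₀) (r₂ + r * c₂ + p * c₁) (c₀ + p * c₂ + r * c₃)
        (c₁ + p * c₃) c₂ c₃)) ρ
  -- Here u'' is 6 g₀ x, so the central pole is 0 and r = 0. The affine ζ has no second zero, hence
  -- the poles ±σ have residue -w.
  · obtain ⟨ρ, hρ, hζρ, hu, -⟩ := hc
    have eD : C g₀ * D = sextic (g₀ * r) (g₀ * p) 0 g₀ 0 0 0 := by
      simp only [hD, sextic, C_0, C_mul]; ring
    rw [eD, (iterate_derivative_sextic _ _ _ _ _ _ _).1, eval_sextic] at hu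
    have hρ0 : ρ = 0 := by
      apply mul_left_cancel₀ (mul_ne_zero (by norm_num : (6 : ℂ) ≠ 0) hg)
      linear_combination hu
    subst hρ0
    have hr : r = 0 := by rw [ev] at hρ; linear_combination hρ
    subst hr
    have hp : p ≠ 0 := by have := hs 0 hρ; rw [dv] at this; simpa using this
    obtain ⟨σ, hσ⟩ : ∃ σ : ℂ, σ ^ 2 = -p := IsAlgClosed.exists_pow_nat_eq _ (by norm_num)
    have hσ0 : σ ≠ 0 := by rintro rfl; simp at hσ; exact hp hσ
    have res : ∀ τ : ℂ, τ ^ 2 = -p → τ ≠ 0 → D.eval τ = 0 ∧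
        r₀ + r₁ * τ - r₂ * p = 2 * w * p := fun τ hτ hτ0 => by
      have hr : D.eval τ = 0 := by rw [ev]; linear_combination τ * hτ
      refine ⟨hr, ?_⟩
      rcases (h τ hr).2.2 with h1 | h1
      · rw [pv τ hr, dv] at h1
        linear_combination h1 - (r₂ + 3 * w) * hτ
      · exfalso
        apply hζ
        obtain ⟨z₀, z₁, hz⟩ : ∃ z₀ z₁, ζ = C z₀ + C z₁ * X :=
          ⟨ζ.coeff 0, ζ.coeff 1, by rw [add_comm]; exact eq_X_add_C_of_natDegree_le_one hζ1⟩
        have h2 := h1.1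
        rw [hz] at hζρ h2
        simp at hζρ h2
        rw [hζρ, zero_add] at h2
        rw [hz, hζρ, (mul_eq_zero.1 h2).resolve_right hτ0]; simp
    obtain ⟨s0, s1⟩ := res σ hσ hσ0
    obtain ⟨-, s2⟩ := res (-σ) (by rw [neg_sq, hσ]) (neg_ne_zero.2 hσ0)
    have hr1 : r₁ = 0 := by
      apply mul_right_cancel₀ hσ0
      linear_combination (s1 - s2) / 2
    have hr0 : r₀ = p * (2 * w + r₂) := by linear_combination (s1 + s2) / 2
    have hc2 : c₂ = 0 := by
      apply mul_left_cancel₀ (pow_ne_zero 4 hp)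
      linear_combination (key 0 hρ).2 + p ^ 2 * hr1
    refine ⟨hc2, hr1, Or.inr ⟨rfl, hp, hr0, ?_⟩⟩
    have k := (key σ s0).2
    have e : 3 * σ ^ 2 + p = -2 * p := by linear_combination 3 * hσ
    rw [e, hr0, hr1, hc2] at k
    apply mul_left_cancel₀ (mul_ne_zero (mul_ne_zero (by norm_num : (16 : ℂ) ≠ 0)
      (pow_ne_zero 2 hp)) hσ0)
    linear_combination k + (36 * p * σ * r₂ + 27 * σ * (p * (2 * w + r₂)) + 27 * σ * r₂ * σ ^ 2 - 27 * σ * r₂ * p + 12 * p * σ * r₂) * hσ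
  · push Not at hc
    have hres : ∀ ρ, D.eval ρ = 0 → (r₀ + w * p) + r₁ * ρ + (r₂ + 3 * w) * ρ ^ 2 = 0 :=
      fun ρ hρ => by
        have := (h ρ hρ).2.2.resolve_right (hc ρ hρ)
        rw [pv ρ hρ, dv] at this
        linear_combination this
    -- The remainder and -w D' agree at three distinct points and have degree at most two.
    obtain ⟨h0, h1, h2⟩ := coeff_eq_zero_of_roots hD0 hs (by omega) hres
    have hr0 : r₀ = -w * p := by linear_combination h0
    have hr2 : r₂ = -3 * w := by linear_combination h2
    -- The apparent-pole condition, divided by D'(ρ) and reduced modulo D to degree two in ρ, so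
    -- that each coefficient must vanish.
    have hF : ∀ ρ, D.eval ρ = 0 → ((27 * r ^ 2 + p ^ 3) * c₂ - 27 * p ^ 2 * r * c₃) +
        (27 * p * r * c₂ + 3 * c₃ * (27 * r ^ 2 + p ^ 3 - 9 * p ^ 3) + 9 * w * p) * ρ +
        (9 * p ^ 2 * c₂ + 81 * p * r * c₃) * ρ ^ 2 = 0 := fun ρ hρ => by
      obtain ⟨k1, k2⟩ := key ρ hρ
      rw [ev] at hρ
      rw [hr0, h1, hr2] at k2
      have k3 : (3 * ρ ^ 2 + p) ^ 3 * (c₂ + 3 * c₃ * ρ) + 9 * w * ρ * p = 0 := by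
        apply mul_left_cancel₀ k1
        linear_combination k2
      linear_combination k3 - (c₂ + 3 * c₃ * ρ) * (9 * ρ * (3 * ρ ^ 2 + p) - 9 * p * ρ - 27 * r) * hρ
        - 27 * p ^ 2 * c₃ * hρ
    obtain ⟨f0, f1, f2⟩ := coeff_eq_zero_of_roots hD0 hs (by omega) hF
    have hw : w ≠ 0 := by
      rintro rfl
      obtain ⟨ρ, hρ⟩ := IsAlgClosed.exists_root D (by
        rw [degree_eq_natDegree hD0, hDn]; norm_num)
      have := (h ρ hρ).1
      rw [pv ρ hρ, hr0, h1, hr2] at this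
      simp at this
    by_cases hp : p = 0
    · subst hp
      have hr : r ≠ 0 := by
        rintro rfl
        have := hs 0 (by rw [ev]; simp)
        rw [dv] at this; simp at this
      have hr2' : (27 : ℂ) * r ^ 2 ≠ 0 := mul_ne_zero (by norm_num) (pow_ne_zero 2 hr)
      refine ⟨?_, h1, Or.inl ⟨rfl, ?_, by rw [hr0, mul_zero], hr2⟩⟩
      · apply mul_left_cancel₀ hr2'; linear_combination f0
      · apply mul_left_cancel₀ hr2'; linear_combination f1 / 3
    · have e2 : p * c₂ = -9 * r * c₃ := by
        apply mul_left_cancel₀ (mul_ne_zero (by norm_num : (9 : ℂ) ≠ 0) hp)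
        linear_combination f2
      have hdisc : 27 * r ^ 2 + 4 * p ^ 3 ≠ 0 := by
        intro hd
        -- With vanishing discriminant this point would be a double root of D.
        have := hs (-3 * r / (2 * p)) (by rw [ev]; field_simp; linear_combination (-r) * hd)
        rw [dv] at this
        apply this
        field_simp
        linear_combination hd
      have e0 : r * c₃ = 0 := by
        apply mul_left_cancel₀ (mul_ne_zero (by norm_num : (9 : ℂ) ≠ 0) hdisc)
        linear_combination -p * f0 + (27 * r ^ 2 + p ^ 3) * e2
      have hc2 : c₂ = 0 := by
        apply mul_left_cancel₀ hp
        linear_combination e2 - 9 * e0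
      have hc3 : c₃ ≠ 0 := by
        rintro rfl
        rw [hc2] at f1
        simp [hw, hp] at f1
      have hr : r = 0 := (mul_eq_zero.1 e0).resolve_right hc3
      refine ⟨hc2, h1, Or.inr ⟨hr, hp, by rw [hr0, hr2]; ring, ?_⟩⟩
      apply mul_left_cancel₀ hp
      rw [hr2]
      rw [hr, hc2] at f1
      linear_combination -f1 / 8

end Residues

/-! ### From the pole conditions to the standard forms -/

section Forms

open Polynomial

theorem hasStandardForm_of_quadratic {ħ : ℝ} {J : Set ℝ} {V : ℝ → ℝ} {a b c : ℝ}
    (h : ∀ x ∈ J, V x = a * x ^ 2 + b * x + c) : HasStandardForm ħ J V := by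
  by_cases ha : a = 0
  · refine ⟨0, c, Or.inl ⟨b, fun q hq => ?_⟩⟩
    rw [h q hq, ha, typeI]; ring
  · refine ⟨-b / (2 * a), c - b ^ 2 / (4 * a), Or.inr (Or.inl ⟨a, 0, fun q hq => ?_⟩)⟩
    rw [h q hq, typeII, zero_div, add_zero]; field_simp; ring

theorem iterate_derivative_taylor {K : Type*} [Field K] (δ : K) (f : K[X]) (n : ℕ) :
    derivative^[n] (taylor δ f) = taylor δ (derivative^[n] f) := by
  induction n generalizing f with
  | zero => rfl
  | succ n ih =>
    rw [Function.iterate_succ_apply, Function.iterate_succ_apply, ← ih]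
    congr 1
    simp [taylor_apply, derivative_comp]

theorem PoleConditions.comp_taylor {w : ℂ} {ζ g D P : ℂ[X]} (h : PoleConditions w ζ g D P)
    (δ : ℂ) : PoleConditions w (taylor δ ζ) (taylor δ g) (taylor δ D) (taylor δ P) := by
  intro ρ hρ
  rw [taylor_eval] at hρ
  have i1 : ∀ f : ℂ[X], derivative (taylor δ f) = taylor δ (derivative f) :=
    fun f => iterate_derivative_taylor δ f 1
  obtain ⟨h1, h2, h3⟩ := h _ hρ
  refine ⟨by rwa [taylor_eval], ?_, ?_⟩
  · simpa only [ApparentPole, i1, iterate_derivative_taylor, taylor_eval] using h2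
  · simpa only [CentralZero, ← taylor_mul, i1, iterate_derivative_taylor, taylor_eval] using h3

theorem map_sextic {K L : Type*} [Field K] [Field L] (σ : K →+* L) (a₀ a₁ a₂ a₃ a₄ a₅ a₆ : K) :
    (sextic a₀ a₁ a₂ a₃ a₄ a₅ a₆).map σ =
      sextic (σ a₀) (σ a₁) (σ a₂) (σ a₃) (σ a₄) (σ a₅) (σ a₆) := by
  simp [sextic]

/-- Division with remainder by a monic polynomial when the quotient is at most cubic. -/
theorem exists_cubic_mul_add {K : Type*} [Field K] {D P : K[X]} (hD : D.Monic)
    (hP : P.natDegree ≤ D.natDegree + 3) : ∃ (c₀ c₁ c₂ c₃ : K) (R : K[X]),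
      R.degree < D.degree ∧
      P = (C c₀ + C c₁ * X + C c₂ * X ^ 2 + C c₃ * X ^ 3) * D + R := by
  have h := (P /ₘ D).as_sum_range' 4 (by rw [natDegree_divByMonic P hD]; omega)
  simp only [Finset.sum_range_succ, Finset.sum_range_zero, ← C_mul_X_pow_eq_monomial] at h
  refine ⟨(P /ₘ D).coeff 0, (P /ₘ D).coeff 1, (P /ₘ D).coeff 2, (P /ₘ D).coeff 3, P %ₘ D,
    degree_modByMonic_lt P hD, ?_⟩
  conv_lhs => rw [← modByMonic_add_div P D, h]
  ring

variable {ħ : ℝ} {J : Set ℝ} {V : ℝ → ℝ} {D P : ℝ[X]} {ζ g : ℂ[X]}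

theorem hasStandardForm_of_natDegree_zero (hD : D.Monic) (hD0 : D.natDegree = 0)
    (hP : P.natDegree ≤ D.natDegree + 3)
    (hV : ∀ x ∈ J, D.eval x ^ 2 * V x = (derivNumer D P).eval x) : HasStandardForm ħ J V := by
  rw [hD0] at hP
  have hD1 : D = 1 := hD.natDegree_eq_zero.1 hD0
  have hP' := P.as_sum_range' 4 (by omega)
  simp only [Finset.sum_range_succ, Finset.sum_range_zero, ← C_mul_X_pow_eq_monomial] at hP'
  refine hasStandardForm_of_quadratic (a := 3 * P.coeff 3) (b := 2 * P.coeff 2) (c := P.coeff 1)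
    fun x hx => ?_
  have := hV x hx
  rw [hD1, derivNumer, hP'] at this
  simp at this
  rw [this]; norm_num; ring

/-- The values of the derivative of `P / D`, where `D` and `P` are centred at `δ`. -/
def IsDerivQuotient (J : Set ℝ) (V : ℝ → ℝ) (δ : ℝ) (D P : ℝ[X]) : Prop :=
  ∀ x ∈ J, D.eval (x - δ) ≠ 0 ∧ D.eval (x - δ) ^ 2 * V x = (derivNumer D P).eval (x - δ)

theorem IsDerivQuotient.comp_taylor (h : IsDerivQuotient J V 0 D P) (δ : ℝ) :
    IsDerivQuotient J V δ (taylor δ D) (taylor δ P) := by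
  intro x hx
  have h1 := h x hx
  have e : derivNumer (taylor δ D) (taylor δ P) = taylor δ (derivNumer D P) := by
    have i1 : ∀ f : ℝ[X], derivative (taylor δ f) = taylor δ (derivative f) :=
      fun f => iterate_derivative_taylor δ f 1
    rw [derivNumer, derivNumer, i1, i1, map_sub, taylor_mul, taylor_mul]
  rw [sub_zero] at h1
  rwa [e, taylor_eval, taylor_eval, sub_add_cancel]

/-- Here Q = a₀/t + a₁ + a₂t + a₃t² + a₄t³, and the apparent-pole condition is a₃ = 0. -/
theorem hasStandardForm_of_eq_X {δ : ℝ} (hD : D = X) (hP : P.natDegree ≤ D.natDegree + 3)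
    (h : PoleConditions (ħ ^ 2 : ℝ) ζ g (D.map Complex.ofRealHom) (P.map Complex.ofRealHom))
    (hV : IsDerivQuotient J V δ D P) : HasStandardForm ħ J V := by
  subst hD
  rw [natDegree_X] at hP
  obtain ⟨a₀, a₁, a₂, a₃, a₄, rfl⟩ : ∃ a₀ a₁ a₂ a₃ a₄, P = sextic a₀ a₁ a₂ a₃ a₄ 0 0 := by
    have hP' := P.as_sum_range' 5 (by omega)
    simp only [Finset.sum_range_succ, Finset.sum_range_zero, ← C_mul_X_pow_eq_monomial] at hP'
    exact ⟨P.coeff 0, P.coeff 1, P.coeff 2, P.coeff 3, P.coeff 4, by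
      conv_lhs => rw [hP']
      simp [sextic]⟩
  obtain ⟨-, ⟨-, q₀, q₁, q₂, -, -, -, h3⟩, -⟩ := h 0 (by simp)
  have eX : (X : ℝ[X]).map Complex.ofRealHom = sextic 0 1 0 0 0 0 0 := by simp [sextic]
  rw [eX, map_sextic] at h3
  simp only [(iterate_derivative_sextic _ _ _ _ _ _ _).1,
    (iterate_derivative_sextic _ _ _ _ _ _ _).2.1, (iterate_derivative_sextic _ _ _ _ _ _ _).2.2.1,
    eval_sextic] at h3
  have ha : a₃ = 0 := by simpa using h3
  refine ⟨δ, a₂, Or.inr (Or.inl ⟨3 * a₄, -a₀, fun x hx => ?_⟩)⟩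
  obtain ⟨hx0, hx1⟩ := hV x hx
  rw [derivNumer, derivative_sextic] at hx1
  simp [eval_sextic, ha] at hx0 hx1
  rw [typeII]
  field_simp
  linear_combination hx1

/-- This is type III with no pole at the centre: the relation 24b²c₃ = ħ² says that β₁β₂² = ħ²/8, so
the two terms in 1/t² cancel. -/
theorem hasStandardForm_of_eq_quadratic {δ b : ℝ} (hD : D = X ^ 2 - C b)
    (hP : P.natDegree ≤ D.natDegree + 3) (hg0 : g ≠ 0) (hg : g.natDegree ≤ 1)
    (h : PoleConditions (ħ ^ 2 : ℝ) ζ g (D.map Complex.ofRealHom) (P.map Complex.ofRealHom))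
    (hV : IsDerivQuotient J V δ D P) : HasStandardForm ħ J V := by
  have hDm : D.Monic := by rw [hD]; exact monic_X_pow_sub_C b (by norm_num)
  have hDd : D.degree = 2 := by rw [hD]; exact degree_X_pow_sub_C (by norm_num) b
  obtain ⟨c₀, c₁, c₂, c₃, R, hR, hPe⟩ := exists_cubic_mul_add hDm hP
  obtain ⟨r₁, r₀, hRe⟩ : ∃ r₁ r₀, R = C r₁ * X + C r₀ := by
    refine ⟨_, _, eq_X_add_C_of_degree_le_one ?_⟩
    rw [hDd] at hR
    exact Order.le_of_lt_succ hR
  have hPs : P = sextic (r₀ - b * c₀) (r₁ - b * c₁) (c₀ - b * c₂) (c₁ - b * c₃) c₂ c₃ 0 := by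
    rw [← sextic_eq_two, hPe, hRe, hD]; ring
  rw [hPs, map_sextic, hD] at h
  simp only [Polynomial.map_sub, Polynomial.map_pow, map_X, map_C, map_sub, map_mul,
    map_zero] at h
  obtain ⟨hb, h2, h0, h1, h3⟩ := h.two hg0 hg
  simp only [Complex.ofRealHom_eq_coe] at hb h2 h0 h1 h3
  norm_cast at hb h2 h0 h1 h3
  refine ⟨δ, c₁, Or.inr (Or.inr (Or.inl ⟨3 * c₃, b, fun x hx => ?_⟩))⟩
  obtain ⟨hx0, hx1⟩ := hV x hx
  rw [derivNumer, hPs, derivative_sextic, hD] at hx1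
  rw [hD] at hx0
  generalize x - δ = t at *
  simp [eval_sextic, h2, h0, h1] at hx0 hx1
  rw [typeIII]
  -- The centre may lie in J. There the cancelling quotients by t² are both read as zero, which
  -- still gives the right value.
  by_cases ht0 : t = 0
  · rw [ht0] at hx1 ⊢
    simp at hx1 ⊢
    have hx2 : b * V x = 2 * ħ ^ 2 + b * c₁ := by
      apply mul_left_cancel₀ hb
      linear_combination hx1
    field_simp
    linear_combination hx2
  · field_simp
    linear_combination 8 * t ^ 2 * hx1 - (t ^ 2 - b) ^ 2 * h3

/-- The alternative p = 0 is type IV with β = -r; the alternative r = 0 is type III with β₂ = -p,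
and the residue at the centre accounts for the 1/t² term. -/
theorem hasStandardForm_of_eq_cubic {δ p r : ℝ} (hD : D = X ^ 3 + C p * X + C r)
    (hP : P.natDegree ≤ D.natDegree + 3) (hg0 : g ≠ 0) (hg : g.natDegree = 0) (hζ0 : ζ ≠ 0)
    (hζ : ζ.natDegree ≤ 1)
    (h : PoleConditions (ħ ^ 2 : ℝ) ζ g (D.map Complex.ofRealHom) (P.map Complex.ofRealHom))
    (hV : IsDerivQuotient J V δ D P) : HasStandardForm ħ J V := by
  have hDn : D.natDegree = 3 := by rw [hD]; compute_degree!
  have hDm : D.Monic := by rw [hD]; monicity!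
  have hDd : D.degree = 3 := by rw [degree_eq_natDegree hDm.ne_zero, hDn]; rfl
  obtain ⟨c₀, c₁, c₂, c₃, R, hR, hPe⟩ := exists_cubic_mul_add hDm hP
  obtain ⟨r₀, r₁, r₂, hRe⟩ : ∃ r₀ r₁ r₂, R = C r₀ + C r₁ * X + C r₂ * X ^ 2 := by
    have := R.as_sum_range' 3 (by
      rw [hDd] at hR
      by_cases hR0 : R = 0
      · simp [hR0]
      · rw [degree_eq_natDegree hR0] at hR; exact_mod_cast hR)
    simp only [Finset.sum_range_succ, Finset.sum_range_zero, ← C_mul_X_pow_eq_monomial] at this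
    exact ⟨R.coeff 0, R.coeff 1, R.coeff 2, by
      conv_lhs => rw [this]
      simp⟩
  have hPs : P = sextic (r₀ + r * c₀) (r₁ + r * c₁ + p * c₀) (r₂ + r * c₂ + p * c₁)
      (c₀ + p * c₂ + r * c₃) (c₁ + p * c₃) c₂ c₃ := by
    rw [← sextic_eq_three, hPe, hRe, hD]
  rw [hPs, map_sextic, hD, eq_C_of_natDegree_eq_zero hg] at h
  simp only [Polynomial.map_add, Polynomial.map_pow, map_X, map_C, map_add, map_mul,
    Polynomial.map_mul] at h
  have hg1 : g.coeff 0 ≠ 0 := by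
    intro h0
    rw [eq_C_of_natDegree_eq_zero hg, h0, C_0] at hg0
    exact hg0 rfl
  obtain ⟨h2, h1, hh⟩ := h.three hg1 hζ0 hζ
  simp only [Complex.ofRealHom_eq_coe] at h2 h1 hh
  norm_cast at h2 h1
  rcases hh with ⟨hp, h3, h0, hr⟩ | ⟨hr, hp, h0, h3⟩
  · norm_cast at hp h3 h0 hr
    refine ⟨δ, c₁, Or.inr (Or.inr (Or.inr ⟨-r, fun x hx => ?_⟩))⟩
    obtain ⟨hx0, hx1⟩ := hV x hx
    rw [derivNumer, hPs, derivative_sextic, hD] at hx1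
    rw [hD] at hx0
    generalize x - δ = t at *
    simp [eval_sextic, h2, h0, h1, hp, h3, hr] at hx0 hx1
    have hx2 : t ^ 3 - -r ≠ 0 := by rwa [sub_neg_eq_add]
    rw [typeIV]
    field_simp
    linear_combination hx1
  · norm_cast at hp h0 hr
    have h3' : 3 * p ^ 2 * c₃ = ħ ^ 2 / 8 - (2 * ħ ^ 2 + r₂) := by exact_mod_cast h3
    refine ⟨δ, c₁, Or.inr (Or.inr (Or.inl ⟨3 * c₃, -p, fun x hx => ?_⟩))⟩
    obtain ⟨hx0, hx1⟩ := hV x hx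
    rw [derivNumer, hPs, derivative_sextic, hD] at hx1
    rw [hD] at hx0
    generalize x - δ = t at *
    simp [eval_sextic, h2, h0, h1, hr] at hx0 hx1
    have ht0 : t ≠ 0 := by rintro rfl; simp at hx0
    have hx2 : t ^ 2 - -p ≠ 0 := fun h => hx0 (by linear_combination t * h)
    rw [typeIII]
    field_simp
    linear_combination 8 * hx1 - 8 * (t ^ 2 + p) ^ 2 * h3'

/-- Translating by the mean of the roots of D removes its subleading coefficient; this is the
translation allowed in `HasStandardForm`. -/
theorem hasStandardForm_of_poleConditions (hD : D.Monic) (hD3 : D.natDegree ≤ 3)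
    (hP : P.natDegree ≤ D.natDegree + 3) (hg0 : g ≠ 0) (hg : D.natDegree + g.natDegree ≤ 3)
    (hζ0 : ζ ≠ 0) (hζ : ζ.natDegree ≤ 1)
    (h : PoleConditions (ħ ^ 2 : ℝ) ζ g (D.map Complex.ofRealHom) (P.map Complex.ofRealHom))
    (hV : IsDerivQuotient J V 0 D P) : HasStandardForm ħ J V := by
  have hDs := D.as_sum_range' 4 (by omega)
  simp only [Finset.sum_range_succ, Finset.sum_range_zero, ← C_mul_X_pow_eq_monomial] at hDs
  have shift : ∀ δ : ℝ, PoleConditions (ħ ^ 2 : ℝ) (taylor (δ : ℂ) ζ) (taylor (δ : ℂ) g)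
      ((taylor δ D).map Complex.ofRealHom) ((taylor δ P).map Complex.ofRealHom) := fun δ => by
    rw [map_taylor, map_taylor]
    exact h.comp_taylor _
  have nd : ∀ δ : ℝ, (taylor δ P).natDegree ≤ (taylor δ D).natDegree + 3 := fun δ => by
    rwa [natDegree_taylor, natDegree_taylor]
  have g0 : ∀ δ : ℂ, taylor δ g ≠ 0 := fun δ h0 => hg0 ((taylor_eq_zero δ g).1 h0)
  have z0 : ∀ δ : ℂ, taylor δ ζ ≠ 0 := fun δ h0 => hζ0 ((taylor_eq_zero δ ζ).1 h0)
  have hlc : D.coeff D.natDegree = 1 := hD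
  have h4 : D.natDegree = 0 ∨ D.natDegree = 1 ∨ D.natDegree = 2 ∨ D.natDegree = 3 := by omega
  rcases h4 with h4 | h4 | h4 | h4
  · refine hasStandardForm_of_natDegree_zero hD h4 hP fun x hx => ?_
    have := (hV x hx).2
    rwa [sub_zero] at this
  · have h3 : D.coeff 3 = 0 := coeff_eq_zero_of_natDegree_lt (by omega)
    have h2 : D.coeff 2 = 0 := coeff_eq_zero_of_natDegree_lt (by omega)
    rw [h4] at hlc
    refine hasStandardForm_of_eq_X (δ := -D.coeff 0) ?_ (nd _) (shift _) (hV.comp_taylor _)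
    conv_lhs => rw [hDs, h3, h2, hlc]
    simp [taylor_apply]
  · have h3 : D.coeff 3 = 0 := coeff_eq_zero_of_natDegree_lt (by omega)
    rw [h4] at hlc
    obtain ⟨δ, hδ⟩ : ∃ δ, δ = - D.coeff 1 / 2 := ⟨_, rfl⟩
    have hc1 : D.coeff 1 = -(δ + δ) := by rw [hδ]; ring
    refine hasStandardForm_of_eq_quadratic (δ := δ) (b := δ ^ 2 - D.coeff 0) ?_ (nd _) (g0 _)
      (by rw [natDegree_taylor]; omega) (shift _) (hV.comp_taylor _)
    conv_lhs => rw [hDs, h3, hlc, hc1]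
    simp [taylor_apply]
    ring
  · rw [h4] at hlc
    obtain ⟨δ, hδ⟩ : ∃ δ, δ = - D.coeff 2 / 3 := ⟨_, rfl⟩
    have hc2 : D.coeff 2 = -(δ + δ + δ) := by rw [hδ]; ring
    refine hasStandardForm_of_eq_cubic (δ := δ)
      (p := -(δ * δ + δ * δ + δ * δ) + D.coeff 1)
      (r := -(δ * δ * δ + δ * δ * δ) + D.coeff 1 * δ + D.coeff 0) ?_ (nd _) (g0 _)
      (by rw [natDegree_taylor]; omega) (z0 _) (by rwa [natDegree_taylor]) (shift _)
      (hV.comp_taylor _)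
    conv_lhs => rw [hDs, hlc, hc2]
    simp [taylor_apply]
    ring

end Forms

/-! ### Rationality of the primitive and reduction to polynomial identities -/

section Rational

open Polynomial

theorem eq_of_eval_eq_on {J : Set ℝ} (hJ : IsOpen J) (hne : J.Nonempty) {f g : ℝ[X]}
    (h : ∀ x ∈ J, f.eval x = g.eval x) : f = g := by
  obtain ⟨x, hx⟩ := hne
  refine eq_of_infinite_eval_eq f g (Set.Infinite.mono (s := J) (fun y hy => h y hy) ?_)
  exact infinite_of_mem_nhds x (hJ.mem_nhds hx)

theorem eq_zero_of_polynomial_mul_eq_zero {J : Set ℝ} (hJ : IsOpen J) {F : ℝ → ℝ}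
    (hF : ContinuousOn F J) {g : ℝ[X]} (hg : g ≠ 0) (h : ∀ x ∈ J, g.eval x * F x = 0) :
    ∀ x ∈ J, F x = 0 := by
  intro x hx
  by_contra hne
  have hU : ∀ᶠ y in nhds x, F y ≠ 0 ∧ y ∈ J :=
    ((hF.continuousAt (hJ.mem_nhds hx)).eventually_ne hne).and (hJ.mem_nhds hx)
  obtain ⟨U, hU1, hUo, hUx⟩ := eventually_nhds_iff.1 hU
  exact hg (eq_of_eval_eq_on hUo ⟨x, hUx⟩ fun y hy => by
    rw [eval_zero]
    exact (mul_eq_zero.1 (h y (hU1 y hy).2)).resolve_right (hU1 y hy).1)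

/-- A function which becomes polynomial after multiplication by a polynomial is a quotient of
coprime polynomials. -/
theorem exists_coprime_quotient {J : Set ℝ} (hJ : IsOpen J) {Q : ℝ → ℝ} (hQ : ContinuousOn Q J)
    {u p : ℝ[X]} (hu : u ≠ 0) (h : ∀ x ∈ J, u.eval x * Q x = p.eval x) :
    ∃ g D P : ℝ[X], g ≠ 0 ∧ D.Monic ∧ IsCoprime D P ∧ u = g * D ∧ p = g * P ∧
      ∀ x ∈ J, D.eval x * Q x = P.eval x := by
  set g₀ := EuclideanDomain.gcd u p with hg₀
  have hg0 : g₀ ≠ 0 := fun h0 => hu (EuclideanDomain.gcd_eq_zero_iff.1 h0).1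
  obtain ⟨D₀, hD₀⟩ := EuclideanDomain.gcd_dvd_left u p
  obtain ⟨P₀, hP₀⟩ := EuclideanDomain.gcd_dvd_right u p
  rw [← hg₀] at hD₀ hP₀
  have hcop : IsCoprime D₀ P₀ := by
    refine ⟨EuclideanDomain.gcdA u p, EuclideanDomain.gcdB u p, mul_left_cancel₀ hg0 ?_⟩
    have h1 := EuclideanDomain.gcd_eq_gcd_ab u p
    rw [← hg₀] at h1
    linear_combination -h1 - EuclideanDomain.gcdA u p * hD₀ - EuclideanDomain.gcdB u p * hP₀
  have hD0 : D₀ ≠ 0 := by rintro rfl; exact hu (by rw [hD₀, mul_zero])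
  set a := D₀.leadingCoeff with ha
  have ha0 : a ≠ 0 := leadingCoeff_ne_zero.2 hD0
  have haa : C a * C a⁻¹ = (1 : ℝ[X]) := by rw [← C_mul, mul_inv_cancel₀ ha0, C_1]
  have hua : IsUnit (C a⁻¹ : ℝ[X]) := isUnit_C.2 (inv_ne_zero ha0).isUnit
  refine ⟨g₀ * C a, D₀ * C a⁻¹, P₀ * C a⁻¹, mul_ne_zero hg0 (C_ne_zero.2 ha0),
    monic_mul_leadingCoeff_inv hD0, ?_, ?_, ?_, ?_⟩
  · exact (isCoprime_mul_unit_right hua D₀ P₀).2 hcop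
  · rw [mul_mul_mul_comm, haa, mul_one]; exact hD₀
  · rw [mul_mul_mul_comm, haa, mul_one]; exact hP₀
  · intro x hx
    have h1 : ∀ x ∈ J, D₀.eval x * Q x - P₀.eval x = 0 := by
      refine eq_zero_of_polynomial_mul_eq_zero hJ ?_ hg0 fun x hx => ?_
      · exact (D₀.continuous.continuousOn.mul hQ).sub P₀.continuous.continuousOn
      · have := h x hx
        rw [hD₀, hP₀, eval_mul, eval_mul] at this
        linear_combination this
    rw [eval_mul, eval_mul, eval_C]
    linear_combination a⁻¹ * h1 x hx

/-- The nonlinear compatibility equation, with polynomial coefficients, for a potential `V` with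
primitive `Q`, derivative `V'`, and a primitive `Y` of `V ^ 2`. -/
def NonlinearCompat (ħ : ℝ) (J : Set ℝ) (Q V V' Y : ℝ → ℝ) (ζ G M : ℝ[X]) : Prop :=
  ∀ x ∈ J, 6 * ζ.eval x * Y x + 2 * (derivative ζ).eval x * Q x ^ 2 - ħ ^ 2 * ζ.eval x * V' x -
    2 * ħ ^ 2 * (derivative ζ).eval x * V x + 4 * G.eval x * Q x = 4 * M.eval x

variable {ħ : ℝ} {J : Set ℝ} {Q V V' Y : ℝ → ℝ} {D P : ℝ[X]}

theorem deriv_quotient (hJ : IsOpen J) (hQ : ∀ x ∈ J, HasDerivAt Q (V x) x)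
    (h : ∀ x ∈ J, D.eval x * Q x = P.eval x) :
    ∀ x ∈ J, D.eval x ^ 2 * V x = (derivNumer D P).eval x := by
  intro x hx
  have h1 := (D.hasDerivAt x).mul (hQ x hx)
  have h2 := h1.unique ((P.hasDerivAt x).congr_of_eventuallyEq
    (Filter.eventuallyEq_of_mem (hJ.mem_nhds hx) h))
  have := h x hx
  rw [derivNumer, eval_sub, eval_mul, eval_mul, ← h2, ← this]
  ring

theorem deriv_quotient₂ (hJ : IsOpen J) (hQ : ∀ x ∈ J, HasDerivAt Q (V x) x)
    (hV : ∀ x ∈ J, HasDerivAt V (V' x) x) (h : ∀ x ∈ J, D.eval x * Q x = P.eval x) :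
    ∀ x ∈ J, D.eval x ^ 3 * V' x = (derivNumer₂ D P).eval x := by
  intro x hx
  have h0 := deriv_quotient hJ hQ h
  have h1 := ((D.hasDerivAt x).fun_pow 2).mul (hV x hx)
  have h2 := h1.unique (((derivNumer D P).hasDerivAt x).congr_of_eventuallyEq
    (Filter.eventuallyEq_of_mem (hJ.mem_nhds hx) h0))
  have := h0 x hx
  rw [derivNumer₂, eval_sub, eval_mul, eval_mul, eval_mul, ← h2, ← this]
  simp
  ring

/-- The equation times D³ reads 6ζD³Y = S; differentiating with Y' = V² removes Y. Agreement on an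
open set is an identity of polynomials, so it can be used at complex poles and at poles outside J.
-/
theorem NonlinearCompat.compatIdentity (hJ : IsOpen J) (hne : J.Nonempty)
    (hQ : ∀ x ∈ J, HasDerivAt Q (V x) x)
    (hV : ∀ x ∈ J, HasDerivAt V (V' x) x) (hY : ∀ x ∈ J, HasDerivAt Y (V x ^ 2) x)
    (h : ∀ x ∈ J, D.eval x * Q x = P.eval x) {ζ G M : ℝ[X]}
    (hN : NonlinearCompat ħ J Q V V' Y ζ G M) : CompatIdentity (ħ ^ 2) ζ G M D P := by
  have d1 := deriv_quotient hJ hQ h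
  have d2 := deriv_quotient₂ hJ hQ hV h
  set S := compatNumer (ħ ^ 2) ζ G M D P with hS
  have h0 : ∀ x ∈ J, (6 * ζ * D ^ 3).eval x * Y x = S.eval x := by
    intro x hx
    have e0 := h x hx
    have e1 := d1 x hx
    have e2 := d2 x hx
    have e3 := hN x hx
    simp only [hS, compatNumer, eval_add, eval_sub, eval_mul, eval_pow, eval_C, eval_ofNat, ← e0,
      ← e1, ← e2]
    linear_combination D.eval x ^ 3 * e3
  refine eq_of_eval_eq_on hJ hne fun x hx => ?_
  have h1 := ((6 * ζ * D ^ 3).hasDerivAt x).mul (hY x hx)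
  have h2 := h1.unique ((S.hasDerivAt x).congr_of_eventuallyEq
    (Filter.eventuallyEq_of_mem (hJ.mem_nhds hx) h0))
  have e0 := h0 x hx
  have e1 := d1 x hx
  rw [← hS]
  simp only [eval_sub, eval_mul, eval_pow, eval_ofNat, ← h2, ← e0, ← e1, derivative_mul,
    derivative_pow, derivative_ofNat, eval_add, eval_zero, eval_C]
  norm_num
  ring

/-- At a zero of ζ the residue is not fixed by the given equation. `hres` supplies either another
equation with non-vanishing leading coefficient there, which fixes it, or the two central conditions
on u and p. -/
theorem hasStandardForm_of_compat (hJ : IsOpen J) (hne : J.Nonempty)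
    (hQ : ∀ x ∈ J, HasDerivAt Q (V x) x) (hV : ∀ x ∈ J, HasDerivAt V (V' x) x)
    (hY : ∀ x ∈ J, HasDerivAt Y (V x ^ 2) x) {u p : ℝ[X]} (hu : u ≠ 0) (hu3 : u.natDegree ≤ 3)
    (hup : ∀ x ∈ J, u.eval x * Q x = p.eval x) {ζ G M : ℝ[X]} (hζ0 : ζ ≠ 0)
    (hζ : ζ.natDegree ≤ 1) (hG : G.natDegree ≤ 2 + ζ.natDegree) (hM : M.natDegree ≤ 5 + ζ.natDegree)
    (hN : NonlinearCompat ħ J Q V V' Y ζ G M)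
    (hres : ∀ x₀ : ℝ, ζ.eval x₀ = 0 →
      (∃ ζ₁ G₁ M₁ : ℝ[X], ζ₁.natDegree ≤ 1 ∧ ζ₁.eval x₀ ≠ 0 ∧
        NonlinearCompat ħ J Q V V' Y ζ₁ G₁ M₁) ∨
      (derivative^[2] u).eval x₀ = 0 ∧ (derivative^[5] p).eval x₀ = 0) :
    HasStandardForm ħ J V := by
  have hQc : ContinuousOn Q J := fun x hx => (hQ x hx).continuousAt.continuousWithinAt
  obtain ⟨g, D, P, hg0, hD, hcop, rfl, rfl, hDP⟩ := exists_coprime_quotient hJ hQc hu hup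
  have hI : ∀ {ζ G M : ℝ[X]}, NonlinearCompat ħ J Q V V' Y ζ G M →
      CompatIdentity (ħ ^ 2) ζ G M D P := fun h => h.compatIdentity hJ hne hQ hV hY hDP
  have hdeg : g.natDegree + D.natDegree ≤ 3 := by
    rwa [natDegree_mul hg0 hD.ne_zero] at hu3
  have hP := (hI hN).natDegree_le hζ0 hζ hG hM hD.ne_zero
  set c := Complex.ofRealHom with hc
  have hcinj : Function.Injective c := c.injective
  have m0 : ∀ {f : ℝ[X]}, f ≠ 0 → f.map c ≠ 0 := fun hf => (Polynomial.map_ne_zero_iff hcinj).2 hf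
  have ev : ∀ (f : ℝ[X]) (x : ℝ), (f.map c).eval (x : ℂ) = ((f.eval x : ℝ) : ℂ) := fun f x => by
    rw [show (x : ℂ) = c x from rfl, eval_map_apply]; rfl
  refine hasStandardForm_of_poleConditions (ζ := ζ.map c) (g := g.map c) hD (by omega) hP (m0 hg0)
    (by rw [natDegree_map]; omega) (m0 hζ0) (by rwa [natDegree_map]) ?_ ?_
  · intro ρ hρ
    have hPρ : (P.map c).eval ρ ≠ 0 := by
      intro h0
      obtain ⟨a, b, hab⟩ := hcop.map (mapRingHom c)
      have := congrArg (eval ρ) hab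
      rw [coe_mapRingHom, eval_add, eval_mul, eval_mul, hρ, h0, mul_zero, mul_zero, add_zero,
        eval_one] at this
      exact zero_ne_one this
    have hIc := fun {ζ G M : ℝ[X]} (h : NonlinearCompat ħ J Q V V' Y ζ G M) => (hI h).map c
    refine ⟨hPρ, (hIc hN).apparentPole (m0 hζ0) (by rwa [natDegree_map]) (m0 hD.ne_zero) hρ hPρ, ?_⟩
    have res : ∀ {ζ G M : ℝ[X]}, ζ.natDegree ≤ 1 → NonlinearCompat ħ J Q V V' Y ζ G M →
        (ζ.map c).eval ρ ≠ 0 → (P.map c).eval ρ =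
          -((ħ ^ 2 : ℝ) : ℂ) * (derivative (D.map c)).eval ρ := by
      intro ζ G M h1 h2 h3
      have h0 : ζ ≠ 0 := by rintro rfl; simp at h3
      exact ((hIc h2).pole (m0 h0) (by rwa [natDegree_map]) (m0 hD.ne_zero) hρ hPρ).2.1 h3
    by_cases hζρ : (ζ.map c).eval ρ = 0
    -- The zero of a real affine polynomial is real, which is why `hres` concerns real points only.
    · obtain ⟨x₀, rfl⟩ : ∃ x₀ : ℝ, ρ = x₀ := by
        have e := eq_X_add_C_of_natDegree_le_one hζ
        rw [e] at hζρ
        simp at hζρ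
        have h1 : ζ.coeff 1 ≠ 0 := by
          intro h1
          rw [h1] at hζρ
          simp [hc] at hζρ
          apply hζ0; rw [e, h1, hζρ]; simp
        refine ⟨-ζ.coeff 0 / ζ.coeff 1, ?_⟩
        have h1' : ((ζ.coeff 1 : ℝ) : ℂ) ≠ 0 := by exact_mod_cast h1
        push_cast
        field_simp
        simp only [hc, Complex.ofRealHom_eq_coe] at hζρ
        linear_combination hζρ
      have hx : ζ.eval x₀ = 0 := by rw [ev] at hζρ; exact_mod_cast hζρ
      rcases hres x₀ hx with ⟨ζ₁, G₁, M₁, h1, h2, h3⟩ | ⟨h1, h2⟩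
      · refine Or.inl (res h1 h3 ?_)
        rw [ev]; exact_mod_cast h2
      · refine Or.inr ⟨hζρ, ?_, ?_⟩
        · rw [← Polynomial.map_mul, iterate_derivative_map, ev, h1, Complex.ofReal_zero]
        · rw [← Polynomial.map_mul, iterate_derivative_map, ev, h2, Complex.ofReal_zero]
    · exact Or.inl (res hζ hN hζρ)
  · intro x hx
    rw [sub_zero]
    refine ⟨fun h0 => ?_, deriv_quotient hJ hQ hDP x hx⟩
    have h1 := hDP x hx
    rw [h0, zero_mul] at h1
    obtain ⟨a, b, hab⟩ := hcop
    have := congrArg (eval x) hab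
    simp [h0, ← h1] at this

/-- Only linear equations are used: Q is a cubic polynomial, or a quartic over an affine polynomial.
At a genuine pole x₀ the hypothesis `hpole` removes the quadratic term of Q, leaving type II. -/
theorem hasStandardForm_of_affine_mul (hJ : IsOpen J) (hne : J.Nonempty)
    (hQ : ∀ x ∈ J, HasDerivAt Q (V x) x) {u p : ℝ[X]} (hu : u ≠ 0) (hu1 : u.natDegree ≤ 1)
    (hp : p.natDegree ≤ 4) (hup : ∀ x ∈ J, u.eval x * Q x = p.eval x)
    (hconst : u.natDegree = 0 → p.natDegree ≤ 3)
    (hpole : ∀ x₀ : ℝ, (∀ g m : ℝ[X], (∀ x ∈ J, g.eval x * Q x = m.eval x) → g.eval x₀ = 0) →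
      (derivative^[3] p).eval x₀ = 0) :
    HasStandardForm ħ J V := by
  have hV := deriv_quotient hJ hQ hup
  rcases Nat.le_one_iff_eq_zero_or_eq_one.1 hu1 with h0 | h1
  · have hp3 := hconst h0
    have hp' := p.as_sum_range' 4 (by omega)
    simp only [Finset.sum_range_succ, Finset.sum_range_zero, ← C_mul_X_pow_eq_monomial] at hp'
    obtain ⟨c, rfl⟩ : ∃ c, u = C c := ⟨_, eq_C_of_natDegree_eq_zero h0⟩
    have hc : c ≠ 0 := by rintro rfl; simp at hu
    refine hasStandardForm_of_quadratic (a := 3 * p.coeff 3 / c) (b := 2 * p.coeff 2 / c)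
      (c := p.coeff 1 / c) fun x hx => ?_
    have := hV x hx
    rw [derivNumer, hp'] at this
    simp at this
    field_simp
    apply mul_left_cancel₀ hc
    linear_combination this
  · obtain ⟨c, x₀, hc, rfl⟩ : ∃ c x₀, c ≠ 0 ∧ u = C c * (X - C x₀) := by
      have e := eq_X_add_C_of_natDegree_le_one hu1
      have h2 : u.coeff 1 ≠ 0 := by
        rw [← h1]; exact leadingCoeff_ne_zero.2 hu
      refine ⟨u.coeff 1, -u.coeff 0 / u.coeff 1, h2, ?_⟩
      conv_lhs => rw [e]
      rw [mul_sub, ← C_mul, mul_div_cancel₀ _ h2, C_neg, sub_neg_eq_add]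
    obtain ⟨b₀, b₁, b₂, b₃, b₄, hpt⟩ : ∃ b₀ b₁ b₂ b₃ b₄,
        taylor x₀ p = sextic b₀ b₁ b₂ b₃ b₄ 0 0 := by
      have ht := (taylor x₀ p).as_sum_range' 5 (by rw [natDegree_taylor]; omega)
      simp only [Finset.sum_range_succ, Finset.sum_range_zero, ← C_mul_X_pow_eq_monomial] at ht
      refine ⟨(taylor x₀ p).coeff 0, (taylor x₀ p).coeff 1, (taylor x₀ p).coeff 2,
        (taylor x₀ p).coeff 3, (taylor x₀ p).coeff 4, ?_⟩
      conv_lhs => rw [ht]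
      simp [sextic]
    have pe : ∀ x, p.eval x = (sextic b₀ b₁ b₂ b₃ b₄ 0 0).eval (x - x₀) := fun x => by
      rw [← hpt, taylor_eval, sub_add_cancel]
    have pe' : ∀ x, (derivative p).eval x =
        (derivative (sextic b₀ b₁ b₂ b₃ b₄ 0 0)).eval (x - x₀) := fun x => by
      have := iterate_derivative_taylor x₀ p 1
      simp only [Function.iterate_one] at this
      rw [← hpt, this, taylor_eval, sub_add_cancel]
    have hV' : ∀ x ∈ J, c * (x - x₀) ^ 2 * V x = (b₁ + 2 * b₂ * (x - x₀) + 3 * b₃ * (x - x₀) ^ 2 +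
        4 * b₄ * (x - x₀) ^ 3) * (x - x₀) - (b₀ + b₁ * (x - x₀) + b₂ * (x - x₀) ^ 2 +
        b₃ * (x - x₀) ^ 3 + b₄ * (x - x₀) ^ 4) := fun x hx => by
      have := hV x hx
      simp only [derivNumer, eval_sub, eval_mul, pe, pe', derivative_sextic,
        eval_sextic] at this
      simp at this
      apply mul_left_cancel₀ hc
      linear_combination this
    by_cases hb : b₀ = 0
    · have hQ1 : ∀ x ∈ J, c * Q x = (C b₁ + C b₂ * (X - C x₀) + C b₃ * (X - C x₀) ^ 2 +
          C b₄ * (X - C x₀) ^ 3 : ℝ[X]).eval x := by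
        have := eq_zero_of_polynomial_mul_eq_zero hJ (F := fun x => c * Q x -
          (C b₁ + C b₂ * (X - C x₀) + C b₃ * (X - C x₀) ^ 2 +
          C b₄ * (X - C x₀) ^ 3 : ℝ[X]).eval x) ((continuousOn_const.mul fun x hx =>
            (hQ x hx).continuousAt.continuousWithinAt).sub (Polynomial.continuous _).continuousOn)
          (X_sub_C_ne_zero x₀) (fun x hx => by
            have := hup x hx
            rw [pe, eval_sextic, hb] at this
            simp only [eval_mul, eval_add, eval_pow, eval_sub, eval_X, eval_C] at this ⊢
            linear_combination this)
        exact fun x hx => sub_eq_zero.1 (this x hx)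
      have hV1 := deriv_quotient hJ hQ (D := C c) (P := C b₁ + C b₂ * (X - C x₀) +
        C b₃ * (X - C x₀) ^ 2 + C b₄ * (X - C x₀) ^ 3) (fun x hx => by rw [eval_C]; exact hQ1 x hx)
      refine hasStandardForm_of_quadratic (a := 3 * b₄ / c) (b := (2 * b₃ - 6 * b₄ * x₀) / c)
        (c := (b₂ - 2 * b₃ * x₀ + 3 * b₄ * x₀ ^ 2) / c) fun x hx => ?_
      have := hV1 x hx
      simp [derivNumer, derivative_X_sub_C_pow] at this
      field_simp
      apply mul_left_cancel₀ hc
      linear_combination this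
    -- Since b₀ ≠ 0, Q has a pole at x₀, so every polynomial multiplier making Q polynomial vanishes
    -- there.
    · have h3 := hpole x₀ (fun g m hg => by
        have : g * p = m * (C c * (X - C x₀)) := eq_of_eval_eq_on hJ hne fun x hx => by
          rw [eval_mul, eval_mul, ← hup x hx, ← hg x hx]; ring
        have := congrArg (eval x₀) this
        rw [eval_mul, pe, eval_sextic] at this
        simpa [hb] using this)
      have h4 := iterate_derivative_taylor x₀ p 3
      have h5 := congrArg (eval 0) h4
      rw [taylor_eval, zero_add, h3, hpt, (iterate_derivative_sextic _ _ _ _ _ _ _).2.1,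
        eval_sextic] at h5
      have hb3 : b₃ = 0 := by linear_combination h5 / 6
      refine ⟨x₀, b₂ / c, Or.inr (Or.inl ⟨3 * b₄ / c, -b₀ / c, fun x hx => ?_⟩)⟩
      have hx0 : x - x₀ ≠ 0 := by
        intro hx0
        have := hup x hx
        rw [pe, eval_sextic, hx0] at this
        obtain rfl : x = x₀ := by linear_combination hx0
        simp at this
        exact hb this.symm
      have := hV' x hx
      rw [typeII]
      generalize x - x₀ = t at *
      field_simp
      rw [hb3] at this
      linear_combination this

end Rational

/-! ### Weyl ordering of the equation of motion -/

section Moyal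

variable {A : Type*} [CommRing A] [Algebra ℂ A]

/-- Families of coefficients of `p₁ ^ a p₂ ^ b`. -/
abbrev Coeffs (A : Type*) := ℕ → ℕ → A

/-- The coefficients of `p₁ ∂₁ + p₂ ∂₂`. -/
def transport (dx dy : Derivation ℂ A A) : Coeffs A →ₗ[ℂ] Coeffs A where
  toFun C a b := (if a = 0 then 0 else dx (C (a - 1) b)) + (if b = 0 then 0 else dy (C a (b - 1)))
  map_add' C C' := by
    funext a b
    by_cases ha : a = 0 <;> by_cases hb : b = 0 <;> simp [ha, hb]
    ring
  map_smul' r C := by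
    funext a b
    by_cases ha : a = 0 <;> by_cases hb : b = 0 <;> simp [ha, hb]

/-- The coefficients of `∂_q · ∂_p`. -/
def mixedDeriv (dx dy : Derivation ℂ A A) : Coeffs A →ₗ[ℂ] Coeffs A where
  toFun C a b := ((a : A) + 1) * dx (C (a + 1) b) + ((b : A) + 1) * dy (C a (b + 1))
  map_add' C C' := by
    funext a b
    simp
    ring
  map_smul' r C := by
    funext a b
    simp

/-- The coefficients of the Laplacian in the coordinates. -/
def laplace (dx dy : Derivation ℂ A A) : Coeffs A →ₗ[ℂ] Coeffs A where
  toFun C a b := dx (dx (C a b)) + dy (dy (C a b))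
  map_add' C C' := by
    funext a b
    simp
    ring
  map_smul' r C := by
    funext a b
    simp

/-- The coefficients of the derivative in the first momentum. -/
def momDeriv₁ (C : Coeffs A) : Coeffs A := fun a b => ((a : A) + 1) * C (a + 1) b

/-- The coefficients of the derivative in the second momentum. -/
def momDeriv₂ (C : Coeffs A) : Coeffs A := fun a b => ((b : A) + 1) * C a (b + 1)

variable {dx dy : Derivation ℂ A A}

/-- The Heisenberg commutator of ∂_p and p in each degree of freedom, combined with ∂_q, produces
the Laplacian. -/
theorem mixedDeriv_transport (hc : ∀ f, dy (dx f) = dx (dy f)) (C : Coeffs A) :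
    mixedDeriv dx dy (transport dx dy C) =
      transport dx dy (mixedDeriv dx dy C) + laplace dx dy C := by
  funext a b
  have hn : ∀ n : ℕ, dx (n : A) = 0 := fun n => dx.map_natCast n
  have hn' : ∀ n : ℕ, dy (n : A) = 0 := fun n => dy.map_natCast n
  rcases a with _ | a <;> rcases b with _ | b <;>
    simp [mixedDeriv, transport, laplace, hc, hn, hn'] <;> ring

theorem mixedDeriv_laplace (hc : ∀ f, dy (dx f) = dx (dy f)) (C : Coeffs A) :
    mixedDeriv dx dy (laplace dx dy C) = laplace dx dy (mixedDeriv dx dy C) := by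
  funext a b
  have hn : ∀ n : ℕ, dx (n : A) = 0 := fun n => dx.map_natCast n
  have hn' : ∀ n : ℕ, dy (n : A) = 0 := fun n => dy.map_natCast n
  simp [mixedDeriv, laplace, hc, hn, hn']
  ring

/-- By the Leibniz rule ∂_q·∂_p acts on the coefficients or puts one derivative on V and one on the
momentum. -/
theorem mixedDeriv_smul_momDeriv₁ {V : A} (hV : dy V = 0) (C : Coeffs A) (k : ℕ) :
    mixedDeriv dx dy (V • momDeriv₁^[k] C) =
      V • momDeriv₁^[k] (mixedDeriv dx dy C) + dx V • momDeriv₁^[k + 1] C := by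
  have hn : ∀ n : ℕ, dx (n : A) = 0 := fun n => dx.map_natCast n
  have hn' : ∀ n : ℕ, dy (n : A) = 0 := fun n => dy.map_natCast n
  have h1 : ∀ C : Coeffs A, mixedDeriv dx dy (momDeriv₁ C) = momDeriv₁ (mixedDeriv dx dy C) := by
    intro C
    funext a b
    simp [mixedDeriv, momDeriv₁, hn, hn']
    ring
  have h2 : ∀ (C : Coeffs A) n, mixedDeriv dx dy (momDeriv₁^[n] C) =
      momDeriv₁^[n] (mixedDeriv dx dy C) := by
    intro C n
    induction n generalizing C with
    | zero => rfl
    | succ n ih => rw [Function.iterate_succ_apply, ih, h1, Function.iterate_succ_apply]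
  rw [← h2, Function.iterate_succ_apply']
  funext a b
  simp [mixedDeriv, momDeriv₁, hV]
  ring

theorem mixedDeriv_smul_momDeriv₂ {V : A} (hV : dx V = 0) (C : Coeffs A) (k : ℕ) :
    mixedDeriv dx dy (V • momDeriv₂^[k] C) =
      V • momDeriv₂^[k] (mixedDeriv dx dy C) + dy V • momDeriv₂^[k + 1] C := by
  have hn : ∀ n : ℕ, dx (n : A) = 0 := fun n => dx.map_natCast n
  have hn' : ∀ n : ℕ, dy (n : A) = 0 := fun n => dy.map_natCast n
  have h1 : ∀ C : Coeffs A, mixedDeriv dx dy (momDeriv₂ C) = momDeriv₂ (mixedDeriv dx dy C) := by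
    intro C
    funext a b
    simp [mixedDeriv, momDeriv₂, hn, hn']
    ring
  have h2 : ∀ (C : Coeffs A) n, mixedDeriv dx dy (momDeriv₂^[n] C) =
      momDeriv₂^[n] (mixedDeriv dx dy C) := by
    intro C n
    induction n generalizing C with
    | zero => rfl
    | succ n ih => rw [Function.iterate_succ_apply, ih, h1, Function.iterate_succ_apply]
  rw [← h2, Function.iterate_succ_apply']
  funext a b
  simp [mixedDeriv, momDeriv₂, hV]
  ring

/-- Conjugation of the equation of motion by `exp (-(h / 2) ∂_q · ∂_p)` removes the terms of even
order. -/
theorem transport_weyl {E : Type*} [AddCommGroup E] [Module ℂ E] {M P L : E →ₗ[ℂ] E}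
    (hMP : ∀ x, M (P x) = P (M x) + L x) (hML : ∀ x, M (L x) = L (M x)) {h : ℂ} {X : ℕ → E}
    (hX : ∀ j, M (X j) = X (j + 1)) (hX5 : X 5 = 0) {B : ℕ → ℕ → E}
    (hB : ∀ m l, M (B m l) = B m (l + 1) + B (m + 1) l) (hB5 : ∀ m l, 5 ≤ m + l → B m l = 0)
    (heq : P (X 0) + (h / 2) • L (X 0) =
      B 1 0 + (h / 2) • B 2 0 + (h ^ 2 / 6) • B 3 0 + (h ^ 3 / 24) • B 4 0) :
    P (X 0 + (-h / 2) • X 1 + (h ^ 2 / 8) • X 2 + (-h ^ 3 / 48) • X 3 + (h ^ 4 / 384) • X 4) =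
      (B 1 0 + (-h / 2) • B 1 1 + (h ^ 2 / 8) • B 1 2 + (-h ^ 3 / 48) • B 1 3) +
        (h ^ 2 / 24) • (B 3 0 + (-h / 2) • B 3 1) := by
  have b5 : ∀ l, B 5 l = 0 := fun l => hB5 _ _ (by omega)
  have b41 : B 4 1 = 0 := hB5 _ _ (by omega)
  have b32 : B 3 2 = 0 := hB5 _ _ (by omega)
  have b23 : B 2 3 = 0 := hB5 _ _ (by omega)
  have b14 : B 1 4 = 0 := hB5 _ _ (by omega)
  have p : ∀ j, P (X (j + 1)) = M (P (X j)) - L (X j) := fun j => by rw [hMP, hX]; abel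
  have l : ∀ j, M (L (X j)) = L (X (j + 1)) := fun j => by rw [hML, hX]
  have e0 : P (X 0) = B 1 0 + (h / 2) • B 2 0 + (h ^ 2 / 6) • B 3 0 + (h ^ 3 / 24) • B 4 0
      - (h / 2) • L (X 0) := by rw [← heq]; abel
  have e1 := p 0
  rw [e0] at e1
  simp only [map_add, map_sub, map_smul, hB, l, Nat.reduceAdd, b5, b41] at e1
  have e2 := p 1
  rw [e1] at e2
  simp only [map_add, map_sub, map_smul, hB, l, Nat.reduceAdd, b5, b41, b32, map_zero] at e2
  have e3 := p 2
  rw [e2] at e3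
  simp only [map_add, map_sub, map_smul, hB, l, Nat.reduceAdd, b5, b41, b32, b23, map_zero] at e3
  have e4 := p 3
  rw [e3] at e4
  simp only [map_add, map_sub, map_smul, hB, l, Nat.reduceAdd, b5, b41, b32, b23, b14, map_zero] at e4
  -- As X 5 = 0 this is a constraint; it absorbs the terms left over by truncating the exponential.
  have e5 := p 4
  rw [e4] at e5
  simp only [map_add, map_sub, map_smul, l, Nat.reduceAdd, map_zero, hX5] at e5
  simp only [map_add, map_smul]
  -- The weights are (-h/2)^j / j!, the coefficients of exp(-(h/2) M). On the potential side
  -- exp(-hD/2)(exp(hD) - 1)/h = (2/h) sinh(hD/2) = D + h²D³/24 + …, and the next term needs five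
  -- momentum derivatives.
  linear_combination (norm := module) e0 + (-h / 2) • e1 + (h ^ 2 / 8) • e2 + (-h ^ 3 / 48) • e3 + (h ^ 4 / 384) • e4 + (-h ^ 5 / 3840) • e5

theorem iterate_mixedDeriv_eq_zero {C : Coeffs A} {n : ℕ} (hC : ∀ a b, n < a + b → C a b = 0)
    (j a b : ℕ) (h : n < a + b + j) : (mixedDeriv dx dy)^[j] C a b = 0 := by
  induction j generalizing a b with
  | zero => exact hC a b h
  | succ j ih =>
    rw [Function.iterate_succ_apply']
    change ((a : A) + 1) * dx ((mixedDeriv dx dy)^[j] C (a + 1) b) +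
      ((b : A) + 1) * dy ((mixedDeriv dx dy)^[j] C a (b + 1)) = 0
    rw [ih (a + 1) b (by omega), ih a (b + 1) (by omega)]
    simp

/-- The coefficients of an integral of motion after Weyl ordering. -/
theorem exists_weylForm (hc : ∀ f, dy (dx f) = dx (dy f)) {V W : A} (hV : dy V = 0)
    (hW : dx W = 0) {C : Coeffs A} {n : ℕ} (hn : n ≤ 4) (hC : ∀ a b, n < a + b → C a b = 0) {h : ℂ}
    (heq : transport dx dy C + (h / 2) • laplace dx dy C =
      (dx V • momDeriv₁ C + dy W • momDeriv₂ C) +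
      (h / 2) • (dx^[2] V • momDeriv₁^[2] C + dy^[2] W • momDeriv₂^[2] C) +
      (h ^ 2 / 6) • (dx^[3] V • momDeriv₁^[3] C + dy^[3] W • momDeriv₂^[3] C) +
      (h ^ 3 / 24) • (dx^[4] V • momDeriv₁^[4] C + dy^[4] W • momDeriv₂^[4] C)) :
    ∃ Z : Coeffs A, (∀ a b, n < a + b → Z a b = 0) ∧ (∀ a b, a + b = n → Z a b = C a b) ∧
      ∀ a b, transport dx dy Z a b =
        dx V * momDeriv₁ Z a b + dy W * momDeriv₂ Z a b +
          (h ^ 2 / 24) • (dx (dx (dx V)) * momDeriv₁^[3] Z a b +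
            dy (dy (dy W)) * momDeriv₂^[3] Z a b) := by
  have hV' : ∀ m, dy (dx^[m] V) = 0 := by
    intro m
    induction m with
    | zero => exact hV
    | succ m ih => rw [Function.iterate_succ_apply', hc, ih, map_zero]
  have hW' : ∀ m, dx (dy^[m] W) = 0 := by
    intro m
    induction m with
    | zero => exact hW
    | succ m ih => rw [Function.iterate_succ_apply', ← hc, ih, map_zero]
  set X : ℕ → Coeffs A := fun j => (mixedDeriv dx dy)^[j] C with hXdef
  have hX0 : ∀ j a b, n < a + b + j → X j a b = 0 := iterate_mixedDeriv_eq_zero hC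
  have hD1 : ∀ m j a b, n < a + b + m + j → momDeriv₁^[m] (X j) a b = 0 := by
    intro m
    induction m with
    | zero => exact fun j a b h => hX0 j a b h
    | succ m ih =>
      intro j a b h
      rw [Function.iterate_succ_apply']
      simp [momDeriv₁, ih j (a + 1) b (by omega)]
  have hD2 : ∀ m j a b, n < a + b + m + j → momDeriv₂^[m] (X j) a b = 0 := by
    intro m
    induction m with
    | zero => exact fun j a b h => hX0 j a b h
    | succ m ih =>
      intro j a b h
      rw [Function.iterate_succ_apply']
      simp [momDeriv₂, ih j a (b + 1) (by omega)]
  have hXs : ∀ j, mixedDeriv dx dy (X j) = X (j + 1) := fun j =>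
    (Function.iterate_succ_apply' (mixedDeriv dx dy) j C).symm
  have key := transport_weyl (M := mixedDeriv dx dy) (P := transport dx dy)
    (L := laplace dx dy) (mixedDeriv_transport hc) (mixedDeriv_laplace hc) (h := h) (X := X)
    hXs (by funext a b; exact hX0 5 a b (by omega))
    (B := fun m l => dx^[m] V • momDeriv₁^[m] (X l) + dy^[m] W • momDeriv₂^[m] (X l))
    (by
      intro m l
      rw [map_add, mixedDeriv_smul_momDeriv₁ (hV' m), mixedDeriv_smul_momDeriv₂ (hW' m), hXs,
        ← Function.iterate_succ_apply' dx, ← Function.iterate_succ_apply' dy]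
      abel)
    (by
      intro m l hml
      funext a b
      simp [hD1 m l a b (by omega), hD2 m l a b (by omega)])
    heq
  refine ⟨_, ?_, ?_, fun a b => (congrFun (congrFun key a) b).trans ?_⟩
  · intro a b hab
    simp [hX0 0 a b (by omega), hX0 1 a b (by omega), hX0 2 a b (by omega),
      hX0 3 a b (by omega), hX0 4 a b (by omega)]
  · intro a b hab
    simp [hX0 1 a b (by omega), hX0 2 a b (by omega), hX0 3 a b (by omega), hX0 4 a b (by omega)]
    rfl
  · simp [momDeriv₁, momDeriv₂, hX0 4 (a + 1) b (by omega), hX0 4 a (b + 1) (by omega),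
      hX0 2 (a + 1 + 1 + 1) b (by omega), hX0 3 (a + 1 + 1 + 1) b (by omega),
      hX0 4 (a + 1 + 1 + 1) b (by omega), hX0 2 a (b + 1 + 1 + 1) (by omega),
      hX0 3 a (b + 1 + 1 + 1) (by omega), hX0 4 a (b + 1 + 1 + 1) (by omega)]
    simp only [Algebra.smul_def]
    ring

end Moyal

/-! ### Elimination of coefficients: the compatibility equations -/

section DifferentialAlgebra

variable {A : Type*} [CommRing A] [Algebra ℂ A]

/-- `V`, `W` are functions of the first and of the second coordinate; `Q`, `Y`, `R` are primitives
of `V`, `V ^ 2`, `W`. -/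
structure Potentials (dx dy : Derivation ℂ A A) (Q V Y W R : A) : Prop where
  comm : ∀ f, dy (dx f) = dx (dy f)
  dxQ : dx Q = V
  dyQ : dy Q = 0
  dxY : dx Y = V ^ 2
  dyR : dy R = W
  dxR : dx R = 0

/-- Compatibility equations for an integral whose components `z`, `G` are affine in the first
coordinate. -/
structure AffineCompat (dx dy : Derivation ℂ A A) (Q W R z G : A) (c : ℕ) : Prop where
  z_two : dx^[2] z = 0
  zQ_five : dx^[5] (z * Q) = 0
  G_two : dx^[2] G = 0
  GQ_five : dx^[5] (G * Q) = 0
  link : dx^[3] (z * Q) = dy^[2] (c * W * z + dy z * R - G)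

/-- The expression of the non-linear compatibility equation. -/
def nonlinearExpr (dx : Derivation ℂ A A) (s Q V Y ζ G : A) : A :=
  6 * ζ * Y + 2 * dx ζ * Q ^ 2 + s * ζ * dx V + 2 * s * dx ζ * V + 4 * G * Q

/-- Linear and non-linear compatibility equations. -/
structure QuadraticCompat (dx dy : Derivation ℂ A A) (s Q V Y W R ζ z G : A) (c : ℕ) : Prop where
  ζ_two : dx^[2] ζ = 0
  link_two : dx^[2] z = dy^[2] ζ
  link_five : dx^[5] (z * Q) = dy^[4] (c * W * ζ + dy ζ * R)
  G_four : dx^[4] G = 0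
  N_seven : dx^[7] (nonlinearExpr dx s Q V Y ζ G) = 0
  of_const : dx ζ = 0 → dx^[3] G = 0 ∧ dx^[6] (nonlinearExpr dx s Q V Y ζ G) = 0

variable {dx dy : Derivation ℂ A A} {Q V Y W R : A}

theorem Derivation.iterate_const_mul (D : Derivation ℂ A A) {c : A} (hc : D c = 0) (f : A) (k : ℕ) :
    D^[k] (c * f) = c * D^[k] f := by
  induction k generalizing f with
  | zero => rfl
  | succ k ih =>
    rw [Function.iterate_succ_apply, Derivation.leibniz, hc, smul_zero, add_zero, smul_eq_mul, ih,
      Function.iterate_succ_apply]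

@[simp]
theorem Derivation.apply_ofNat (D : Derivation ℂ A A) (n : ℕ) [n.AtLeastTwo] :
    D (ofNat(n) : A) = 0 :=
  D.map_natCast n

theorem Derivation.iterate_mul_eq_zero_of_nonlinearExpr {s G : A} {j : ℕ}
    (h : dx^[j] (nonlinearExpr dx s Q V Y 0 G) = 0) : dx^[j] (G * Q) = 0 := by
  have h1 : nonlinearExpr dx s Q V Y 0 G = (algebraMap ℂ A 4) * (G * Q) := by
    simp [nonlinearExpr, mul_assoc, map_ofNat]
  rw [h1, dx.iterate_const_mul (by simp), ← Algebra.smul_def] at h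
  have h2 := congrArg (fun t => (4 : ℂ)⁻¹ • t) h
  simpa [smul_smul] using h2

namespace Potentials

variable (P : Potentials dx dy Q V Y W R)
include P

theorem dyV : dy V = 0 := by rw [← P.dxQ, P.comm, P.dyQ, map_zero]

theorem dxW : dx W = 0 := by rw [← P.dyR, ← P.comm, P.dxR, map_zero]

theorem iterate_comm (m l : ℕ) (f : A) : dx^[m] (dy^[l] f) = dy^[l] (dx^[m] f) :=
  (Function.Commute.iterate_iterate (f := dx) (g := dy) (fun f => (P.comm f).symm) m l) f

/-- Coefficients independent of x, and differentiation in y, do not raise the degree in x. This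
turns a formula for a derivative of the nonlinear expression into a degree bound. -/
theorem iterate_eq_zero {z G F c₁ c₂ c₃ c₄ : A} {j : ℕ} (hz : dx^[j] z = 0) (hG : dx^[j] G = 0)
    (h₁ : dx c₁ = 0) (h₂ : dx c₂ = 0) (h₃ : dx c₃ = 0) (h₄ : dx c₄ = 0)
    (hF : F = c₁ * z + c₂ * dy z + c₃ * G + c₄ * dy G) : dx^[j] F = 0 := by
  have hz' : dx^[j] (dy z) = 0 :=
    (P.iterate_comm j 1 z).trans (by rw [hz]; exact map_zero dy)
  have hG' : dx^[j] (dy G) = 0 :=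
    (P.iterate_comm j 1 G).trans (by rw [hG]; exact map_zero dy)
  rw [hF]
  simp only [iterate_map_add]
  rw [dx.iterate_const_mul h₁, dx.iterate_const_mul h₂, dx.iterate_const_mul h₃,
    dx.iterate_const_mul h₄, hz, hz', hG, hG']
  simp

/-- The equation of degree zero in the momenta is zV' + W' Z₀₁ = 0, and ∂ₓZ₀₁ = -∂ᵧz eliminates Z₀₁.
-/
theorem affineCompat_of_order_one {Z : Coeffs A} {k : A} (hZ : ∀ a b, 1 < a + b → Z a b = 0)
    (hT : ∀ a b, transport dx dy Z a b =
        dx V * momDeriv₁ Z a b + dy W * momDeriv₂ Z a b +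
          k * (dx (dx (dx V)) * momDeriv₁^[3] Z a b + dy (dy (dy W)) * momDeriv₂^[3] Z a b)) :
    AffineCompat dx dy Q W R (Z 1 0) 0 0 := by
  have t02 := hT 0 2
  have t11 := hT 1 1
  have t20 := hT 2 0
  have t00 := hT 0 0
  simp [transport, momDeriv₁, momDeriv₂, hZ] at t02 t11 t20 t00
  have hdxW := P.dxW
  have hc := P.comm
  have hyy : dy (dy (Z 1 0)) = 0 := by
    have := congrArg dy t11
    simp [hc, t02] at this
    exact this
  have e0 : dx^[2] (Z 1 0 * Q) = -(dy W * Z 0 1) := by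
    simp [t20, P.dxQ]
    linear_combination -t00
  have e1 : dx^[3] (Z 1 0 * Q) = dy W * dy (Z 1 0) := by
    rw [Function.iterate_succ_apply', e0]
    simp [← hc, hdxW]
    linear_combination -dy W * t11
  refine ⟨by simp [t20], ?_, by simp, by simp, ?_⟩
  · rw [Function.iterate_succ_apply', Function.iterate_succ_apply', e1]
    simp [← hc, hdxW, t20]
  · rw [e1]
    simp [hyy, P.dyR]
    ring

/-- Equality of the mixed derivatives of Z₀₀ is the Bertrand–Darboux equation for z = Z₁₁, whose two
sides are third derivatives of zQ and zR. -/
theorem affineCompat_of_order_two {Z : Coeffs A} {k : A} (hZ : ∀ a b, 2 < a + b → Z a b = 0)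
    (hT : ∀ a b, transport dx dy Z a b =
        dx V * momDeriv₁ Z a b + dy W * momDeriv₂ Z a b +
          k * (dx (dx (dx V)) * momDeriv₁^[3] Z a b + dy (dy (dy W)) * momDeriv₂^[3] Z a b)) :
    AffineCompat dx dy Q W R (Z 1 1) 0 1 := by
  have t03 := hT 0 3
  have t12 := hT 1 2
  have t21 := hT 2 1
  have t30 := hT 3 0
  have t01 := hT 0 1
  have t10 := hT 1 0
  simp [transport, momDeriv₁, momDeriv₂, hZ] at t03 t12 t21 t30 t01 t10
  have hdyV := P.dyV
  have hdxW := P.dxW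
  have hc := P.comm
  have hyy : dy (dy (Z 1 1)) = 0 := by
    have := congrArg dy t12
    simp [hc, t03] at this
    exact this
  have hxx : dx (dx (Z 1 1)) = 0 := by
    have := congrArg dx t21
    simp [← hc, t30] at this
    exact this
  have a1 := congrArg dx t01
  have a2 := congrArg dy t10
  simp [← hc, hdxW] at a1 a2
  simp [hc, hdyV] at a2
  simp [hc] at a1
  have e1 : dx^[3] (Z 1 1 * Q) = dy^[3] (Z 1 1 * R) := by
    simp [hxx, hyy, P.dxQ, P.dyR]
    linear_combination a2 - a1 - 2 * dy W * t12 + 2 * dx V * t21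
  refine ⟨hxx, ?_, by simp, by simp, ?_⟩
  · rw [Function.iterate_add_apply dx 2 3, e1, P.iterate_comm]
    simp [hxx, P.dxR]
  · rw [e1, Function.iterate_succ_apply]
    simp [P.dyR]
    ring

/-- The equations of degree five make the leading coefficients polynomial, those of degree three
determine ∂ₓ²Z₁₁ and ∂ᵧ²Z₁₁, and those of degree one, through the mixed derivatives of Z₀₀, give the
nonlinear equation. -/
theorem quadraticCompat_of_order_four {Z : Coeffs A} {k : A} (hkx : dx k = 0) (hky : dy k = 0)
    (hZ : ∀ a b, 4 < a + b → Z a b = 0)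
    (hT : ∀ a b, transport dx dy Z a b =
        dx V * momDeriv₁ Z a b + dy W * momDeriv₂ Z a b +
          k * (dx (dx (dx V)) * momDeriv₁^[3] Z a b + dy (dy (dy W)) * momDeriv₂^[3] Z a b)) :
    ∃ G, QuadraticCompat dx dy (24 * k) Q V Y W R (Z 3 1) (Z 1 3) G 1 ∧
      (Z 3 1 = 0 → AffineCompat dx dy Q W R (Z 1 3) G 3) := by
  have t05 := hT 0 5
  have t14 := hT 1 4
  have t23 := hT 2 3
  have t32 := hT 3 2
  have t41 := hT 4 1
  have t50 := hT 5 0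
  have t03 := hT 0 3
  have t12 := hT 1 2
  have t21 := hT 2 1
  have t30 := hT 3 0
  have t01 := hT 0 1
  have t10 := hT 1 0
  simp [transport, momDeriv₁, momDeriv₂, hZ] at t05 t14 t23 t32 t41 t50 t03 t12 t21 t30 t01 t10
  have hdyV := P.dyV
  have hdxW := P.dxW
  have hc := P.comm
  have hWm : dx (dy W) = 0 := by simp [← hc, hdxW]
  have hWm2 : dx (dy (dy W)) = 0 := by simp [← hc, hdxW]
  have hWm3 : dx (dy (dy (dy W))) = 0 := by simp [← hc, hdxW]
  have hWm4 : dx (dy (dy (dy (dy W)))) = 0 := by simp [← hc, hdxW]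
  generalize Z 0 4 = z0 at *
  generalize Z 1 3 = z1 at *
  generalize Z 2 2 = z2 at *
  generalize Z 3 1 = z3 at *
  generalize Z 4 0 = z4 at *
  generalize Z 0 2 = f0 at *
  generalize Z 1 1 = f1 at *
  generalize Z 2 0 = f2 at *
  generalize Z 0 0 = e at *
  have r14 : dx z0 = -dy z1 := by linear_combination t14
  have r23 : dy z2 = -dx z1 := by linear_combination t23
  have r32 : dx z2 = -dy z3 := by linear_combination t32
  have r41 : dy z4 = -dx z3 := by linear_combination t41
  have z1yy : dy (dy z1) = 0 := by
    have := congrArg dy t14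
    simpa [hc, t05] using this
  have z3xx : dx (dx z3) = 0 := by
    have := congrArg dx t41
    simpa [← hc, t50] using this
  have z3xxy : dx (dx (dy z3)) = 0 := by rw [← hc, ← hc, z3xx, map_zero]
  have z1xx : dx (dx z1) = dy (dy z3) := by
    have h1 := congrArg dx t23
    have h2 := congrArg dy t32
    simp [hc] at h1 h2
    linear_combination h1 - h2
  have z1xxy : dx (dx (dy z1)) = dy (dy (dy z3)) := by rw [← hc, ← hc, z1xx]
  have f1xx : dx (dx f1) = 7 * dx z3 * dx V + 3 * z3 * dx (dx V) - 3 * dy z3 * dy W -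
      z3 * dy (dy W) := by
    have h1 := congrArg dx t21
    have h2 := congrArg dy t30
    simp [hc, hdyV, hWm] at h1 h2
    linear_combination h1 - h2 + 2 * dy W * r32 - 4 * dx V * r41
  have f1yy : dy (dy f1) = 7 * dy z1 * dy W + 3 * z1 * dy (dy W) - 3 * dx z1 * dx V -
      z1 * dx (dx V) := by
    have h1 := congrArg dy t12
    have h2 := congrArg dx t03
    simp [hc, hdyV, hWm] at h1 h2
    linear_combination h1 - h2 + 2 * dx V * r23 - 4 * dy W * r14
  -- The gradient of Z₀₀ is eliminated; what remains separates into a V-side and a W-side.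
  have hM : 6 * dx V ^ 2 * z3 - 3 * dx V * dx f1 - dx (dx V) * f1 -
      30 * k * dx (dx (dx V)) * dx z3 - 6 * k * dx (dx (dx (dx V))) * z3 =
      6 * dy W ^ 2 * z1 - 3 * dy W * dy f1 - dy (dy W) * f1 -
      30 * k * dy (dy (dy W)) * dy z1 - 6 * k * dy (dy (dy (dy W))) * z1 := by
    have h1 := congrArg dx t01
    have h2 := congrArg dy t10
    simp [hc, hdyV, hWm, hWm3, hkx, hky] at h1 h2
    linear_combination h1 - h2 - 2 * dx V * t21 + 2 * dy W * t12 +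
      24 * k * dy (dy (dy W)) * r14 - 24 * k * dx (dx (dx V)) * r41
  -- The subtracted terms carry the whole V-dependence of ∂ₓ²Z₁₁, so ∂ₓ²G involves only W and ζ and
  -- G is polynomial in x.
  obtain ⟨G, rfl⟩ : ∃ G, f1 = G + 3 * z3 * V + dx z3 * Q := ⟨f1 - 3 * z3 * V - dx z3 * Q, by ring⟩
  have Gxx : dx (dx G) = -(dy (dy W) * z3 + 3 * dy W * dy z3) := by
    simp [P.dxQ, z3xx] at f1xx
    linear_combination f1xx
  have Gxxx : dx (dx (dx G)) = -(dy (dy W) * dx z3 + 3 * dy W * dx (dy z3)) := by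
    rw [Gxx]
    simp [hWm, hWm2]
  have Gxxxx : dx (dx (dx (dx G))) = 0 := by
    rw [Gxxx]
    simp [hWm, hWm2, z3xx, z3xxy]
  clear t05 t14 t23 t32 t41 t50 t03 t12 t21 t30 t01 t10 hT hZ
  -- The nonlinear expression is a threefold x-integral of the V-side of the mixed-derivative
  -- identity, up to a factor. The W-side is linear in z₁, G and their y-derivatives with
  -- coefficients independent of x.
  have N3 : dx^[3] (nonlinearExpr dx (24 * k) Q V Y z3 G) =
      -(24 * dy W ^ 2 * z1) + 12 * dy W * dy G + 4 * dy (dy W) * G +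
        120 * k * dy (dy (dy W)) * dy z1 + 24 * k * dy (dy (dy (dy W))) * z1 := by
    simp [nonlinearExpr, P.dxQ, z3xx, P.dxY, hkx, Gxx, pow_two, hWm, hWm2]
    simp [hc, P.dyQ, hdyV, P.dxQ, z3xx] at hM
    linear_combination -4 * hM
  have hlink : dx^[3] (z1 * Q) = dy^[2] (3 * W * z1 + dy z1 * R - G) := by
    simp [hc, P.dyQ, hdyV] at f1yy
    simp [P.dxQ, z1xx, P.dyR, z1yy]
    linear_combination f1yy
  have hlink' : dx^[5] (z1 * Q) = dy^[4] (W * z3 + dy z3 * R) := by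
    rw [Function.iterate_add_apply dx 2 3, hlink, P.iterate_comm,
      Function.iterate_add_apply dy 2 2]
    congr 1
    simp [hdxW, P.dxR, z1xxy, z1xx, Gxx, P.dyR]
    ring
  have N4 : ∀ j, dx^[j] z1 = 0 → dx^[j] G = 0 →
      dx^[j + 3] (nonlinearExpr dx (24 * k) Q V Y z3 G) = 0 := by
    intro j h1 h2
    rw [Function.iterate_add_apply]
    refine P.iterate_eq_zero h1 h2 (c₁ := 24 * k * dy (dy (dy (dy W))) - 24 * dy W ^ 2)
      (c₂ := 120 * k * dy (dy (dy W))) (c₃ := 4 * dy (dy W)) (c₄ := 12 * dy W)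
      ?_ ?_ ?_ ?_ (by rw [N3]; ring)
    all_goals simp [hkx, hWm, hWm2, hWm3, hWm4, pow_two]
  have z1xxx : dx (dx (dx z1)) = dy (dy (dx z3)) := by rw [z1xx, hc, hc]
  refine ⟨G, ⟨z3xx, z1xx, ?_, Gxxxx, N4 4 ?_ Gxxxx, fun h => ⟨?_, N4 3 ?_ ?_⟩⟩, fun h => ?_⟩
  · simpa using hlink'
  · change dx (dx (dx (dx z1))) = 0
    rw [z1xxx, ← hc, ← hc, z3xx, map_zero, map_zero]
  · change dx (dx (dx G)) = 0
    rw [Gxxx, ← hc, h, map_zero]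
    simp
  · change dx (dx (dx z1)) = 0
    rw [z1xxx, h, map_zero, map_zero]
  · change dx (dx (dx G)) = 0
    rw [Gxxx, ← hc, h, map_zero]
    simp
  · subst h
    simp only [map_zero, mul_zero, zero_mul, neg_zero, add_zero] at hlink' Gxx z1xx
    refine ⟨z1xx, by rw [hlink', iterate_map_zero], Gxx, ?_, by simpa using hlink⟩
    exact dx.iterate_mul_eq_zero_of_nonlinearExpr (N4 2 z1xx Gxx)

/-- In odd order the last equation has degree zero in the momenta and yields the nonlinear
expression directly, without cross-differentiation. Moreover ∂ₓζ = 0, so the sharper degree bounds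
always hold. -/
theorem quadraticCompat_of_order_three {Z : Coeffs A} {k : A} (hkx : dx k = 0)
    (hZ : ∀ a b, 3 < a + b → Z a b = 0)
    (hT : ∀ a b, transport dx dy Z a b =
        dx V * momDeriv₁ Z a b + dy W * momDeriv₂ Z a b +
          k * (dx (dx (dx V)) * momDeriv₁^[3] Z a b + dy (dy (dy W)) * momDeriv₂^[3] Z a b)) :
    ∃ G, QuadraticCompat dx dy (24 * k) Q V Y W R (Z 3 0) (Z 1 2) G 0 ∧
      (Z 3 0 = 0 → AffineCompat dx dy Q W R (Z 1 2) G 2) := by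
  have t04 := hT 0 4
  have t13 := hT 1 3
  have t22 := hT 2 2
  have t31 := hT 3 1
  have t40 := hT 4 0
  have t02 := hT 0 2
  have t11 := hT 1 1
  have t20 := hT 2 0
  have t00 := hT 0 0
  simp [transport, momDeriv₁, momDeriv₂, hZ] at t04 t13 t22 t31 t40 t02 t11 t20 t00
  have hdyV := P.dyV
  have hdxW := P.dxW
  have hc := P.comm
  have hWm : dx (dy W) = 0 := by simp [← hc, hdxW]
  have hWm3 : dx (dy (dy (dy W))) = 0 := by simp [← hc, hdxW]
  generalize Z 0 3 = z0 at *
  generalize Z 1 2 = z1 at *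
  generalize Z 2 1 = z2 at *
  generalize Z 3 0 = z3 at *
  generalize Z 0 1 = f0 at *
  generalize Z 1 0 = f1 at *
  have r13 : dx z0 = -dy z1 := by linear_combination t13
  have r22 : dy z2 = -dx z1 := by linear_combination t22
  have r31 : dx z2 = -dy z3 := by linear_combination t31
  have z1yy : dy (dy z1) = 0 := by
    have := congrArg dy t13
    simpa [hc, t04] using this
  have z3xy : dx (dy z3) = 0 := by rw [← hc, t40, map_zero]
  have z1xx : dx (dx z1) = dy (dy z3) := by
    have h1 := congrArg dx t22
    have h2 := congrArg dy t31
    simp [hc] at h1 h2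
    linear_combination h1 - h2
  have z1xxy : dx (dx (dy z1)) = dy (dy (dy z3)) := by rw [← hc, ← hc, z1xx]
  have f1yy : dy (dy f1) = 5 * dy z1 * dy W + 2 * z1 * dy (dy W) - 3 * dx z1 * dx V -
      z1 * dx (dx V) := by
    have h1 := congrArg dy t11
    have h2 := congrArg dx t02
    simp [hc, hdyV, hWm] at h1 h2
    linear_combination h1 - h2 + 2 * dx V * r22 - 3 * dy W * r13
  obtain ⟨G, rfl⟩ : ∃ G, f1 = G + 3 * z3 * V := ⟨f1 - 3 * z3 * V, by ring⟩
  -- Z₀₁ is corrected too, so that ∂ₓg is free of V.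
  obtain ⟨g, rfl⟩ : ∃ g, f0 = g + 2 * z2 * V - dy z3 * Q :=
    ⟨f0 - 2 * z2 * V + dy z3 * Q, by ring⟩
  have Gx : dx G = dy W * z2 := by
    simp [t40] at t20
    linear_combination t20
  have gx : dx g = 2 * dy W * z1 - dy G := by
    simp [hdyV, P.dxQ, z3xy] at t11
    linear_combination t11 - 2 * V * r31
  have Gxx : dx (dx G) = -(dy W * dy z3) := by
    rw [Gx]
    simp [hWm, r31]
  have Gxxx : dx (dx (dx G)) = 0 := by
    rw [Gxx]
    simp [hWm, z3xy]
  have N2 : dx^[2] (nonlinearExpr dx (24 * k) Q V Y z3 G) =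
      -(4 * dy W * g) - 24 * k * dy (dy (dy W)) * z0 := by
    simp [nonlinearExpr, P.dxQ, t40, P.dxY, hkx, Gx, pow_two, hWm, r31]
    linear_combination -4 * t00
  have N3 : dx^[3] (nonlinearExpr dx (24 * k) Q V Y z3 G) =
      -(8 * dy W ^ 2 * z1) + 4 * dy W * dy G + 24 * k * dy (dy (dy W)) * dy z1 := by
    rw [Function.iterate_succ_apply', N2]
    simp [gx, hWm, hkx, hWm3, r13]
    ring
  clear t04 t13 t22 t31 t02 t11 t20 t00 hT hZ
  have hlink : dx^[3] (z1 * Q) = dy^[2] (2 * W * z1 + dy z1 * R - G) := by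
    simp [hdyV] at f1yy
    simp [P.dxQ, z1xx, P.dyR, z1yy, ← hc, t40]
    linear_combination f1yy
  have hlink' : dx^[5] (z1 * Q) = dy^[4] (dy z3 * R) := by
    rw [Function.iterate_add_apply dx 2 3, hlink, P.iterate_comm,
      Function.iterate_add_apply dy 2 2]
    congr 1
    simp [hdxW, P.dxR, z1xxy, z1xx, Gxx, P.dyR]
    ring
  have N4 : ∀ j, dx^[j] z1 = 0 → dx^[j] G = 0 →
      dx^[j + 3] (nonlinearExpr dx (24 * k) Q V Y z3 G) = 0 := by
    intro j h1 h2
    rw [Function.iterate_add_apply]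
    refine P.iterate_eq_zero h1 h2 (c₁ := -(8 * dy W ^ 2))
      (c₂ := 24 * k * dy (dy (dy W))) (c₃ := 0) (c₄ := 4 * dy W)
      ?_ ?_ ?_ ?_ (by rw [N3]; ring)
    all_goals simp [hkx, hWm, hWm3, pow_two]
  have z1xxx : dx (dx (dx z1)) = 0 := by rw [z1xx, ← hc, ← hc, t40, map_zero, map_zero]
  have h6 := N4 3 z1xxx Gxxx
  refine ⟨G, ⟨by simp [t40], z1xx, by simpa using hlink', ?_, ?_, fun _ => ⟨Gxxx, h6⟩⟩, fun h => ?_⟩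
  · rw [Function.iterate_succ_apply']
    exact (congrArg dx Gxxx).trans (map_zero dx)
  · rw [Function.iterate_succ_apply', h6, map_zero]
  · subst h
    simp only [map_zero, mul_zero, zero_mul, neg_zero] at hlink' Gxx z1xx
    refine ⟨z1xx, by rw [hlink', iterate_map_zero], Gxx, ?_, by simpa using hlink⟩
    exact dx.iterate_mul_eq_zero_of_nonlinearExpr (N4 2 z1xx Gxx)

end Potentials

end DifferentialAlgebra

/-! ### Smooth functions on the domain as a differential algebra -/

section SmoothFunctions

/-- The extension by zero of a function on a subset of the plane. -/
noncomputable def extendZero (S : Set (ℝ × ℝ)) (f : S → ℂ) : ℝ × ℝ → ℂ :=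
  Function.extend Subtype.val f 0

variable {S : Set (ℝ × ℝ)}

@[simp]
theorem extendZero_coe (f : S → ℂ) (p : S) : extendZero S f p = f p :=
  Subtype.val_injective.extend_apply f 0 p

theorem extendZero_eqOn {f : S → ℂ} {g : ℝ × ℝ → ℂ} (h : ∀ p : S, f p = g p) :
    Set.EqOn (extendZero S f) g S :=
  fun p hp => (extendZero_coe f ⟨p, hp⟩).trans (h ⟨p, hp⟩)

/-- Smooth complex-valued functions on a subset of the plane. -/
def smoothSubalgebra (S : Set (ℝ × ℝ)) : Subalgebra ℂ (S → ℂ) where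
  carrier := {f | ContDiffOn ℝ ∞ (extendZero S f) S}
  mul_mem' {f g} hf hg :=
    (ContDiffOn.mul hf hg).congr (extendZero_eqOn fun p => by simp)
  add_mem' {f g} hf hg :=
    (ContDiffOn.add hf hg).congr (extendZero_eqOn fun p => by simp)
  algebraMap_mem' r :=
    (contDiffOn_const (c := r)).congr (extendZero_eqOn fun p => by simp)

/-- The restriction of a smooth function. -/
def smoothRestrict (g : ℝ × ℝ → ℂ) (hg : ContDiffOn ℝ ∞ g S) : smoothSubalgebra S :=
  ⟨fun p => g p, hg.congr (extendZero_eqOn fun _ => rfl)⟩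

theorem extendZero_eventuallyEq (hS : IsOpen S) {f : S → ℂ} {g : ℝ × ℝ → ℂ}
    (h : ∀ p : S, f p = g p) (p : S) : extendZero S f =ᶠ[nhds (p : ℝ × ℝ)] g :=
  (extendZero_eqOn h).eventuallyEq_of_mem (hS.mem_nhds p.2)

theorem differentiableAt_extendZero (hS : IsOpen S) (f : smoothSubalgebra S) (p : S) :
    DifferentiableAt ℝ (extendZero S f.1) p :=
  ((f.2 : ContDiffOn ℝ ∞ _ _).contDiffAt (hS.mem_nhds p.2)).differentiableAt (by simp)

/-- The directional derivative of smooth functions. -/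
noncomputable def dirDeriv (hS : IsOpen S) (v : ℝ × ℝ) :
    Derivation ℂ (smoothSubalgebra S) (smoothSubalgebra S) :=
  Derivation.mk'
    { toFun := fun f => smoothRestrict (fun p => fderiv ℝ (extendZero S f.1) p v)
        (((f.2 : ContDiffOn ℝ ∞ _ _).fderiv_of_isOpen hS (m := ∞) (by simp)).clm_apply
          contDiffOn_const)
      map_add' := fun f g => by
        ext p
        change fderiv ℝ (extendZero S (f + g).1) p v =
          fderiv ℝ (extendZero S f.1) p v + fderiv ℝ (extendZero S g.1) p v
        rw [(extendZero_eventuallyEq hS (g := extendZero S f.1 + extendZero S g.1)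
          (fun p => by simp) p).fderiv_eq, fderiv_add (differentiableAt_extendZero hS f p)
          (differentiableAt_extendZero hS g p)]
        rfl
      map_smul' := fun r f => by
        ext p
        change fderiv ℝ (extendZero S (r • f).1) p v = r * fderiv ℝ (extendZero S f.1) p v
        rw [(extendZero_eventuallyEq hS (g := r • extendZero S f.1)
          (fun p => by simp) p).fderiv_eq, fderiv_const_smul (differentiableAt_extendZero hS f p)]
        rfl }
    (fun f g => by
      ext p
      change fderiv ℝ (extendZero S (f * g).1) p v =
        f.1 p * fderiv ℝ (extendZero S g.1) p v + g.1 p * fderiv ℝ (extendZero S f.1) p v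
      rw [(extendZero_eventuallyEq hS (g := extendZero S f.1 * extendZero S g.1)
          (fun p => by simp) p).fderiv_eq, fderiv_mul (differentiableAt_extendZero hS f p)
          (differentiableAt_extendZero hS g p)]
      simp)

theorem dirDeriv_apply (hS : IsOpen S) (v : ℝ × ℝ) (f : smoothSubalgebra S) (p : S) :
    (dirDeriv hS v f).1 p = fderiv ℝ (extendZero S f.1) p v := rfl

theorem dirDeriv_comm (hS : IsOpen S) (v w : ℝ × ℝ) (f : smoothSubalgebra S) :
    dirDeriv hS w (dirDeriv hS v f) = dirDeriv hS v (dirDeriv hS w f) := by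
  ext p
  have h : ∀ v w : ℝ × ℝ, (dirDeriv hS w (dirDeriv hS v f)).1 p =
      fderiv ℝ (fderiv ℝ (extendZero S f.1)) p w v := by
    intro v w
    have hf := ((f.2 : ContDiffOn ℝ ∞ _ _).fderiv_of_isOpen hS (m := ∞) (by simp)).contDiffAt
      (hS.mem_nhds p.2)
    rw [dirDeriv_apply, (extendZero_eventuallyEq hS
      (f := (dirDeriv hS v f).1)
      (g := fun p => fderiv ℝ (extendZero S f.1) p v) (fun p => rfl) p).fderiv_eq,
      fderiv_clm_apply (hf.differentiableAt (by simp)) (differentiableAt_const v)]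
    simp
  rw [h, h]
  exact ((f.2 : ContDiffOn ℝ ∞ _ _).contDiffAt (hS.mem_nhds p.2)).isSymmSndFDerivAt
    (by simp only [minSmoothness_of_isRCLikeNormedField]; exact WithTop.coe_le_coe.2 (le_top (a := (2 : ℕ∞)))) w v

theorem hasDerivAt_fst (hS : IsOpen S) (f : smoothSubalgebra S) {x y : ℝ} (h : (x, y) ∈ S) :
    HasDerivAt (fun t => extendZero S f.1 (t, y))
      (extendZero S (dirDeriv hS (1, 0) f).1 (x, y)) x := by
  have h1 := (differentiableAt_extendZero hS f ⟨_, h⟩).hasFDerivAt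
  have h2 : HasDerivAt (fun t : ℝ => (t, y)) ((1 : ℝ), (0 : ℝ)) x :=
    (hasDerivAt_id x).prodMk (hasDerivAt_const x y)
  rw [show extendZero S (dirDeriv hS (1, 0) f).1 (x, y) = _ from
    extendZero_coe (dirDeriv hS (1, 0) f).1 ⟨_, h⟩]
  exact h1.comp_hasDerivAt x h2

theorem hasDerivAt_snd (hS : IsOpen S) (f : smoothSubalgebra S) {x y : ℝ} (h : (x, y) ∈ S) :
    HasDerivAt (fun t => extendZero S f.1 (x, t))
      (extendZero S (dirDeriv hS (0, 1) f).1 (x, y)) y := by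
  have h1 := (differentiableAt_extendZero hS f ⟨_, h⟩).hasFDerivAt
  have h2 : HasDerivAt (fun t : ℝ => (x, t)) ((0 : ℝ), (1 : ℝ)) y :=
    (hasDerivAt_const y x).prodMk (hasDerivAt_id y)
  rw [show extendZero S (dirDeriv hS (0, 1) f).1 (x, y) = _ from
    extendZero_coe (dirDeriv hS (0, 1) f).1 ⟨_, h⟩]
  exact h1.comp_hasDerivAt y h2

end SmoothFunctions

/-! ### Conditions at a common zero of the leading coefficients -/

section Central

variable {A : Type*} [CommRing A] [Algebra ℂ A] {dx dy : Derivation ℂ A A} {s Q V Y W R : A}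

/-- For t = x₀ - x the operator F ↦ F + t ∂ₓF evaluates functions affine in x at x₀, even when x₀ is
outside the interval. It commutes with y-derivatives because t does not depend on y. -/
theorem Potentials.iterate_central (P : Potentials dx dy Q V Y W R) {t : A} (ht : dy t = 0) (F : A)
    (k : ℕ) : dy^[k] F + t * dx (dy^[k] F) = dy^[k] (F + t * dx F) := by
  rw [iterate_map_add, dy.iterate_const_mul ht]
  congr 2
  exact P.iterate_comm 1 k F

/-- W and R do not depend on x, so the right side of `link` vanishes at x₀ along with z and G. This
makes the third derivative of zQ vanish at a pole. -/
theorem AffineCompat.central {z G : A} {c : ℕ} (h : AffineCompat dx dy Q W R z G c)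
    (P : Potentials dx dy Q V Y W R) {t : A} (ht : dy t = 0) (hz : z + t * dx z = 0)
    (hG : G + t * dx G = 0) : dx^[3] (z * Q) + t * dx (dx^[3] (z * Q)) = 0 := by
  have hz' := congrArg dy hz
  simp [ht, P.comm] at hz'
  rw [h.link, P.iterate_central ht,
    show c * W * z + dy z * R - G + t * dx (c * W * z + dy z * R - G) = 0 by
      simp [P.dxW, P.dxR]
      linear_combination c * W * hz + R * hz' - hG, iterate_map_zero]

/-- Both links express x-derivatives of z and zQ by y-derivatives of expressions linear in ζ and
ζ_y, which vanish at x₀ with ζ. These are the conditions of `CentralZero`. -/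
theorem QuadraticCompat.central {ζ z G : A} {c : ℕ} (h : QuadraticCompat dx dy s Q V Y W R ζ z G c)
    (P : Potentials dx dy Q V Y W R) {t : A} (ht : dy t = 0) (hζ : ζ + t * dx ζ = 0) :
    dx^[2] z + t * dx (dx^[2] z) = 0 ∧ dx^[5] (z * Q) + t * dx (dx^[5] (z * Q)) = 0 := by
  have hζ' := congrArg dy hζ
  simp [ht, P.comm] at hζ'
  rw [h.link_two, h.link_five, P.iterate_central ht, P.iterate_central ht, hζ,
    show c * W * ζ + dy ζ * R + t * dx (c * W * ζ + dy ζ * R) = 0 by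
      simp [P.dxW, P.dxR]
      linear_combination c * W * hζ + R * hζ', iterate_map_zero, iterate_map_zero]
  exact ⟨rfl, rfl⟩

theorem AffineCompat.zQ_four {z G : A} {c : ℕ} (h : AffineCompat dx dy Q W R z G c)
    (P : Potentials dx dy Q V Y W R) (hz : dx z = 0) (hG : dx G = 0) : dx^[4] (z * Q) = 0 := by
  rw [Function.iterate_succ_apply', h.link]
  refine (P.iterate_comm 1 2 _).trans ?_
  rw [show dx^[1] (c * W * z + dy z * R - G) = 0 by simp [P.dxW, P.dxR, hz, hG, ← P.comm],
    iterate_map_zero]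

theorem QuadraticCompat.z_four {ζ z G : A} {c : ℕ} (h : QuadraticCompat dx dy s Q V Y W R ζ z G c)
    (P : Potentials dx dy Q V Y W R) : dx^[4] z = 0 := by
  rw [Function.iterate_add_apply dx 2 2, h.link_two, P.iterate_comm, h.ζ_two, iterate_map_zero]

theorem QuadraticCompat.zQ_seven {ζ z G : A} {c : ℕ} (h : QuadraticCompat dx dy s Q V Y W R ζ z G c)
    (P : Potentials dx dy Q V Y W R) : dx^[7] (z * Q) = 0 := by
  have hζ := h.ζ_two
  have hζ' : dx (dx (dy ζ)) = 0 := by rw [← P.comm, ← P.comm]; exact (congrArg dy hζ).trans (map_zero dy)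
  simp only [Function.iterate_succ, Function.iterate_zero, Function.comp_apply, id] at hζ
  rw [Function.iterate_add_apply dx 2 5, h.link_five, P.iterate_comm,
    show dx^[2] (c * W * ζ + dy ζ * R) = 0 by simp [P.dxW, P.dxR, hζ, hζ'], iterate_map_zero]

end Central

/-! ### Restriction to horizontal lines: real polynomials in x -/

section Slices

open Polynomial

theorem exists_derivative_eq (P : ℝ[X]) : ∃ R : ℝ[X], derivative R = P := by
  induction P using Polynomial.induction_on' with
  | add p q hp hq =>
    obtain ⟨r, rfl⟩ := hp
    obtain ⟨t, rfl⟩ := hq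
    exact ⟨r + t, by simp⟩
  | monomial n a =>
    refine ⟨monomial (n + 1) (a / (n + 1)), ?_⟩
    rw [derivative_monomial]
    congr 1
    push_cast
    field_simp

theorem natDegree_le_natDegree_derivative_add_one (P : ℝ[X]) :
    P.natDegree ≤ (derivative P).natDegree + 1 := by
  rcases Nat.eq_zero_or_pos P.natDegree with h | h
  · omega
  · have := natDegree_eq_of_degree_eq_some (degree_derivative (p := P) h.ne')
    omega

theorem eval_of_natDegree_le_one {P : ℝ[X]} (hP : P.natDegree ≤ 1) (x x₀ : ℝ) :
    P.eval x₀ = P.eval x + (x₀ - x) * (derivative P).eval x := by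
  rw [eq_X_add_C_of_natDegree_le_one hP]
  simp
  ring

variable {J₁ J₂ : Set ℝ}

/-- `P` is the restriction to a horizontal line of a real component of `f`. -/
def IsSlice (ℓ : ℂ →L[ℝ] ℝ) (f : smoothSubalgebra (J₁ ×ˢ J₂)) (y : ℝ) (P : ℝ[X]) : Prop :=
  ∀ x ∈ J₁, P.eval x = ℓ (extendZero _ f.1 (x, y))

variable {ℓ : ℂ →L[ℝ] ℝ} {f g : smoothSubalgebra (J₁ ×ˢ J₂)} {y : ℝ} {P : ℝ[X]}

theorem hasDerivAt_slice (hJ₁ : IsOpen J₁) (hJ₂ : IsOpen J₂) (hy : y ∈ J₂) {x : ℝ} (hx : x ∈ J₁) :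
    HasDerivAt (fun t => ℓ (extendZero _ f.1 (t, y)))
      (ℓ (extendZero _ (dirDeriv (hJ₁.prod hJ₂) (1, 0) f).1 (x, y))) x :=
  ℓ.hasFDerivAt.comp_hasDerivAt x (hasDerivAt_fst (hJ₁.prod hJ₂) f ⟨hx, hy⟩)

theorem IsSlice.derivative (hJ₁ : IsOpen J₁) (hJ₂ : IsOpen J₂) (hy : y ∈ J₂)
    (h : IsSlice ℓ f y P) :
    IsSlice ℓ (dirDeriv (hJ₁.prod hJ₂) (1, 0) f) y (derivative P) := by
  intro x hx
  refine ((P.hasDerivAt x).congr_of_eventuallyEq ?_).unique (hasDerivAt_slice hJ₁ hJ₂ hy hx)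
  filter_upwards [hJ₁.mem_nhds hx] with t ht using (h t ht).symm

theorem IsSlice.iterate_derivative (hJ₁ : IsOpen J₁) (hJ₂ : IsOpen J₂) (hy : y ∈ J₂)
    (h : IsSlice ℓ f y P) (k : ℕ) :
    IsSlice ℓ ((dirDeriv (hJ₁.prod hJ₂) (1, 0))^[k] f) y (Polynomial.derivative^[k] P) := by
  induction k with
  | zero => exact h
  | succ k ih =>
    rw [Function.iterate_succ_apply', Function.iterate_succ_apply']
    exact ih.derivative hJ₁ hJ₂ hy

theorem exists_isSlice_of_derivative (hJ₁ : IsOpen J₁) (hJ₂ : IsOpen J₂) (hc : IsPreconnected J₁)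
    (hy : y ∈ J₂) (h : IsSlice ℓ (dirDeriv (hJ₁.prod hJ₂) (1, 0) f) y P) :
    ∃ R, derivative R = P ∧ IsSlice ℓ f y R := by
  obtain ⟨R, rfl⟩ := exists_derivative_eq P
  have hd : ∀ x ∈ J₁, HasDerivAt (fun t => ℓ (extendZero _ f.1 (t, y)) - R.eval t) 0 x := by
    intro x hx
    have := (hasDerivAt_slice (f := f) (ℓ := ℓ) hJ₁ hJ₂ hy hx).sub (R.hasDerivAt x)
    rwa [h x hx, sub_self] at this
  obtain ⟨a, ha⟩ := hJ₁.exists_is_const_of_deriv_eq_zero hc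
    (fun x hx => (hd x hx).differentiableAt.differentiableWithinAt) (fun x hx => (hd x hx).deriv)
  refine ⟨R + C a, by simp, fun x hx => ?_⟩
  rw [eval_add, eval_C, ← ha x hx]
  ring

theorem exists_isSlice (hJ₁ : IsOpen J₁) (hJ₂ : IsOpen J₂) (hc : IsPreconnected J₁) (hy : y ∈ J₂)
    (ℓ : ℂ →L[ℝ] ℝ) {k : ℕ} (h : (dirDeriv (hJ₁.prod hJ₂) (1, 0))^[k + 1] f = 0) :
    ∃ P : ℝ[X], P.natDegree ≤ k ∧ IsSlice ℓ f y P := by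
  induction k generalizing f with
  | zero =>
    obtain ⟨R, h1, h2⟩ := exists_isSlice_of_derivative (f := f) (ℓ := ℓ) (P := 0) hJ₁ hJ₂ hc hy (by
      intro x hx
      rw [show dirDeriv (hJ₁.prod hJ₂) (1, 0) f = 0 from h]
      have := extendZero_coe (S := J₁ ×ˢ J₂) 0 ⟨(x, y), hx, hy⟩
      simp only at this
      simp [this])
    exact ⟨R, (derivative_eq_zero.1 h1).le, h2⟩
  | succ k ih =>
    obtain ⟨P, hP, hs⟩ := ih (f := dirDeriv (hJ₁.prod hJ₂) (1, 0) f) h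
    obtain ⟨R, rfl, h2⟩ := exists_isSlice_of_derivative hJ₁ hJ₂ hc hy hs
    exact ⟨R, (natDegree_le_natDegree_derivative_add_one R).trans (by omega), h2⟩

/-- Real and imaginary parts on all horizontal lines determine the function. -/
theorem eq_zero_of_slices (h : ∀ ℓ : ℂ →L[ℝ] ℝ, ∀ y ∈ J₂, IsSlice ℓ f y 0) : f = 0 := by
  ext p
  have h1 := h Complex.reCLM _ p.2.2 _ p.2.1
  have h2 := h Complex.imCLM _ p.2.2 _ p.2.1
  rw [Prod.mk.eta, extendZero_coe] at h1 h2
  exact Complex.ext (by simpa using h1.symm) (by simpa using h2.symm)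

theorem IsSlice.eq_zero (hJ₁ : IsOpen J₁) (hne : J₁.Nonempty) (hy : y ∈ J₂)
    (h : IsSlice ℓ (0 : smoothSubalgebra (J₁ ×ˢ J₂)) y P) : P = 0 :=
  eq_of_eval_eq_on hJ₁ hne fun x hx => by
    have := extendZero_coe (S := J₁ ×ˢ J₂) 0 ⟨(x, y), hx, hy⟩
    simp only at this
    rw [h x hx]
    simp [this]

theorem slice_mul_real {a : smoothSubalgebra (J₁ ×ˢ J₂)} {x r : ℝ} (hx : x ∈ J₁) (hy : y ∈ J₂)
    (ha : a.1 ⟨(x, y), hx, hy⟩ = (r : ℂ)) :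
    ℓ (extendZero _ (f * a).1 (x, y)) = ℓ (extendZero _ f.1 (x, y)) * r := by
  have h1 := extendZero_coe (f * a).1 ⟨(x, y), hx, hy⟩
  have h2 := extendZero_coe f.1 ⟨(x, y), hx, hy⟩
  simp only at h1 h2
  rw [h1, h2, show (f * a).1 ⟨(x, y), hx, hy⟩ = f.1 ⟨(x, y), hx, hy⟩ * a.1 ⟨(x, y), hx, hy⟩ from rfl,
    ha, mul_comm, ← Complex.real_smul, map_smul, smul_eq_mul, mul_comm]

theorem slice_add {x : ℝ} (hx : x ∈ J₁) (hy : y ∈ J₂) :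
    ℓ (extendZero _ (f + g).1 (x, y)) =
      ℓ (extendZero _ f.1 (x, y)) + ℓ (extendZero _ g.1 (x, y)) := by
  have h1 := extendZero_coe (f + g).1 ⟨(x, y), hx, hy⟩
  have h2 := extendZero_coe f.1 ⟨(x, y), hx, hy⟩
  have h3 := extendZero_coe g.1 ⟨(x, y), hx, hy⟩
  simp only at h1 h2 h3
  rw [h1, h2, h3, ← map_add]
  rfl

end Slices

/-! ### Standard forms from the compatibility equations -/

section Assembly

open Polynomial

variable {J₁ J₂ : Set ℝ}

theorem dirDeriv_fst_eq (hJ₁ : IsOpen J₁) (hJ₂ : IsOpen J₂) {a b : smoothSubalgebra (J₁ ×ˢ J₂)}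
    {r r' : ℝ → ℝ} (ha : ∀ p : ↥(J₁ ×ˢ J₂), a.1 p = (r p.1.1 : ℂ))
    (hb : ∀ p : ↥(J₁ ×ˢ J₂), b.1 p = (r' p.1.1 : ℂ)) (hr : ∀ x ∈ J₁, HasDerivAt r (r' x) x) :
    dirDeriv (hJ₁.prod hJ₂) (1, 0) a = b := by
  ext p
  have h1 := hasDerivAt_fst (hJ₁.prod hJ₂) a p.2
  have h2 : HasDerivAt (fun t => extendZero _ a.1 (t, p.1.2)) (r' p.1.1 : ℂ) p.1.1 := by
    refine (hr _ p.2.1).ofReal_comp.congr_of_eventuallyEq ?_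
    filter_upwards [hJ₁.mem_nhds p.2.1] with t ht
    exact (extendZero_coe a.1 ⟨(t, p.1.2), ht, p.2.2⟩).trans (ha _)
  rw [hb, ← h1.unique h2, Prod.mk.eta, extendZero_coe]

theorem dirDeriv_snd_eq (hJ₁ : IsOpen J₁) (hJ₂ : IsOpen J₂) {a b : smoothSubalgebra (J₁ ×ˢ J₂)}
    {r r' : ℝ → ℝ} (ha : ∀ p : ↥(J₁ ×ˢ J₂), a.1 p = (r p.1.2 : ℂ))
    (hb : ∀ p : ↥(J₁ ×ˢ J₂), b.1 p = (r' p.1.2 : ℂ)) (hr : ∀ x ∈ J₂, HasDerivAt r (r' x) x) :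
    dirDeriv (hJ₁.prod hJ₂) (0, 1) a = b := by
  ext p
  have h1 := hasDerivAt_snd (hJ₁.prod hJ₂) a p.2
  have h2 : HasDerivAt (fun t => extendZero _ a.1 (p.1.1, t)) (r' p.1.2 : ℂ) p.1.2 := by
    refine (hr _ p.2.2).ofReal_comp.congr_of_eventuallyEq ?_
    filter_upwards [hJ₂.mem_nhds p.2.2] with t ht
    exact (extendZero_coe a.1 ⟨(p.1.1, t), p.2.1, ht⟩).trans (ha _)
  rw [hb, ← h1.unique h2, Prod.mk.eta, extendZero_coe]

theorem dirDeriv_fst_eq_zero (hJ₁ : IsOpen J₁) (hJ₂ : IsOpen J₂) {a : smoothSubalgebra (J₁ ×ˢ J₂)}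
    {r : ℝ → ℝ} (ha : ∀ p : ↥(J₁ ×ˢ J₂), a.1 p = (r p.1.2 : ℂ)) :
    dirDeriv (hJ₁.prod hJ₂) (1, 0) a = 0 := by
  ext p
  have h1 := hasDerivAt_fst (hJ₁.prod hJ₂) a p.2
  have h2 : HasDerivAt (fun t => extendZero _ a.1 (t, p.1.2)) 0 p.1.1 := by
    refine (hasDerivAt_const p.1.1 (r p.1.2 : ℂ)).congr_of_eventuallyEq ?_
    filter_upwards [hJ₁.mem_nhds p.2.1] with t ht
    exact (extendZero_coe a.1 ⟨(t, p.1.2), ht, p.2.2⟩).trans (ha _)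
  have := h1.unique h2
  rwa [Prod.mk.eta, extendZero_coe] at this

theorem dirDeriv_snd_eq_zero (hJ₁ : IsOpen J₁) (hJ₂ : IsOpen J₂) {a : smoothSubalgebra (J₁ ×ˢ J₂)}
    {r : ℝ → ℝ} (ha : ∀ p : ↥(J₁ ×ˢ J₂), a.1 p = (r p.1.1 : ℂ)) :
    dirDeriv (hJ₁.prod hJ₂) (0, 1) a = 0 := by
  ext p
  have h1 := hasDerivAt_snd (hJ₁.prod hJ₂) a p.2
  have h2 : HasDerivAt (fun t => extendZero _ a.1 (p.1.1, t)) 0 p.1.2 := by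
    refine (hasDerivAt_const p.1.2 (r p.1.1 : ℂ)).congr_of_eventuallyEq ?_
    filter_upwards [hJ₂.mem_nhds p.2.2] with t ht
    exact (extendZero_coe a.1 ⟨(p.1.1, t), p.2.1, ht⟩).trans (ha _)
  have := h1.unique h2
  rwa [Prod.mk.eta, extendZero_coe] at this

/-- The function `x₀ - x`. -/
noncomputable def shiftFun (J₁ J₂ : Set ℝ) (x₀ : ℝ) : smoothSubalgebra (J₁ ×ˢ J₂) :=
  smoothRestrict (fun p => ((x₀ - p.1 : ℝ) : ℂ))
    (Complex.ofRealCLM.contDiff.comp (contDiff_const.sub contDiff_fst)).contDiffOn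

variable {ℓ : ℂ →L[ℝ] ℝ} {f : smoothSubalgebra (J₁ ×ˢ J₂)} {y x₀ : ℝ} {P : ℝ[X]}

theorem IsSlice.central (hJ₁ : IsOpen J₁) (hJ₂ : IsOpen J₂) (hy : y ∈ J₂) (h : IsSlice ℓ f y P)
    (hP : P.natDegree ≤ 1) {x : ℝ} (hx : x ∈ J₁) :
    ℓ (extendZero _ (f + shiftFun J₁ J₂ x₀ * dirDeriv (hJ₁.prod hJ₂) (1, 0) f).1 (x, y)) =
      P.eval x₀ := by
  rw [slice_add hx hy, mul_comm, slice_mul_real (r := x₀ - x) hx hy rfl, ← h x hx,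
    ← h.derivative hJ₁ hJ₂ hy x hx, eval_of_natDegree_le_one hP x x₀]
  ring

theorem IsSlice.eval_eq_zero_of_central (hJ₁ : IsOpen J₁) (hJ₂ : IsOpen J₂) (hne : J₁.Nonempty)
    (hy : y ∈ J₂) (h : IsSlice ℓ f y P) (hP : P.natDegree ≤ 1)
    (h0 : f + shiftFun J₁ J₂ x₀ * dirDeriv (hJ₁.prod hJ₂) (1, 0) f = 0) : P.eval x₀ = 0 := by
  obtain ⟨x, hx⟩ := hne
  have h1 := h.central (x₀ := x₀) hJ₁ hJ₂ hy hP hx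
  have := extendZero_coe (S := J₁ ×ˢ J₂) 0 ⟨(x, y), hx, hy⟩
  simp only at this
  rw [h0] at h1
  rw [← h1]
  simp [this]

theorem central_eq_zero (hJ₁ : IsOpen J₁) (hJ₂ : IsOpen J₂)
    (h : ∀ (ℓ : ℂ →L[ℝ] ℝ), ∀ y ∈ J₂, ∃ P : ℝ[X], P.natDegree ≤ 1 ∧ IsSlice ℓ f y P ∧
      P.eval x₀ = 0) :
    f + shiftFun J₁ J₂ x₀ * dirDeriv (hJ₁.prod hJ₂) (1, 0) f = 0 := by
  refine eq_zero_of_slices fun ℓ y hy x hx => ?_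
  obtain ⟨P, hP, hs, h0⟩ := h ℓ y hy
  rw [hs.central hJ₁ hJ₂ hy hP hx, h0, eval_zero]

theorem natDegree_iterate_derivative_le {k m : ℕ} (hP : P.natDegree ≤ k + m) :
    (derivative^[k] P).natDegree ≤ m :=
  (natDegree_iterate_derivative P k).trans (by omega)

theorem exists_slice_ne_zero (hJ₁ : IsOpen J₁) (hJ₂ : IsOpen J₂) (hc : IsPreconnected J₁)
    (hf0 : f ≠ 0) {k : ℕ} (hf : (dirDeriv (hJ₁.prod hJ₂) (1, 0))^[k + 1] f = 0) :
    ∃ (ℓ : ℂ →L[ℝ] ℝ), ∃ y ∈ J₂, ∃ P : ℝ[X], P.natDegree ≤ k ∧ IsSlice ℓ f y P ∧ P ≠ 0 := by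
  by_contra! hcon
  refine hf0 (eq_zero_of_slices fun ℓ y hy => ?_)
  obtain ⟨P, hP, hs⟩ := exists_isSlice hJ₁ hJ₂ hc hy ℓ hf
  rwa [hcon ℓ y hy P hP hs] at hs

/-- A slice whose degree is one unless the function does not depend on the first coordinate. -/
theorem exists_slice_affine (hJ₁ : IsOpen J₁) (hJ₂ : IsOpen J₂) (hc : IsPreconnected J₁)
    (hne : J₁.Nonempty) (hf0 : f ≠ 0) (hf : (dirDeriv (hJ₁.prod hJ₂) (1, 0))^[2] f = 0) :
    ∃ (ℓ : ℂ →L[ℝ] ℝ), ∃ y ∈ J₂, ∃ P : ℝ[X], P.natDegree ≤ 1 ∧ IsSlice ℓ f y P ∧ P ≠ 0 ∧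
      (P.natDegree = 0 → dirDeriv (hJ₁.prod hJ₂) (1, 0) f = 0) := by
  by_cases h0 : dirDeriv (hJ₁.prod hJ₂) (1, 0) f = 0
  · obtain ⟨ℓ, y, hy, P, hP, hs, hP0⟩ := exists_slice_ne_zero hJ₁ hJ₂ hc hf0 hf
    exact ⟨ℓ, y, hy, P, hP, hs, hP0, fun _ => h0⟩
  -- The slice is chosen where ∂ₓf, not merely f, is non-zero, which makes its degree exactly one.
  · obtain ⟨ℓ, y, hy, R, -, hs, hR0⟩ := exists_slice_ne_zero (k := 0) hJ₁ hJ₂ hc h0 hf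
    obtain ⟨P, hP, hs'⟩ := exists_isSlice hJ₁ hJ₂ hc hy ℓ hf
    have hPR : derivative P = R := eq_of_eval_eq_on hJ₁ hne fun x hx =>
      (hs'.derivative hJ₁ hJ₂ hy x hx).trans (hs x hx).symm
    refine ⟨ℓ, y, hy, P, hP, hs', ?_, fun h => ?_⟩
    · rintro rfl
      exact hR0 (by rw [← hPR, derivative_zero])
    · exact absurd (by rw [← hPR, derivative_of_natDegree_zero h]) hR0

variable {Q V Y : ℝ → ℝ} {QA VA YA WA RA z G ζ : smoothSubalgebra (J₁ ×ˢ J₂)} {c : ℕ} {ħ : ℝ}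

/-- All slices of z and G are multipliers of the same Q. If Q has a pole at x₀ they all vanish
there, and `AffineCompat.central` gives the missing condition. -/
theorem hasStandardForm_of_affineCompat (hJ₁ : IsOpen J₁) (hJ₂ : IsOpen J₂)
    (hc : IsPreconnected J₁) (hne : J₁.Nonempty) (hQ : ∀ x ∈ J₁, HasDerivAt Q (V x) x)
    (hQA : ∀ p : ↥(J₁ ×ˢ J₂), QA.1 p = (Q p.1.1 : ℂ))
    (hP : Potentials (dirDeriv (hJ₁.prod hJ₂) (1, 0)) (dirDeriv (hJ₁.prod hJ₂) (0, 1))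
      QA VA YA WA RA)
    (h : AffineCompat (dirDeriv (hJ₁.prod hJ₂) (1, 0)) (dirDeriv (hJ₁.prod hJ₂) (0, 1))
      QA WA RA z G c) (hz : z ≠ 0) : HasStandardForm ħ J₁ V := by
  have hmul : ∀ {ℓ : ℂ →L[ℝ] ℝ} {y : ℝ}, y ∈ J₂ → ∀ {f : smoothSubalgebra (J₁ ×ˢ J₂)} {u p : ℝ[X]},
      IsSlice ℓ f y u → IsSlice ℓ (f * QA) y p → ∀ x ∈ J₁, u.eval x * Q x = p.eval x := by
    intro ℓ y hy f u p hu hp x hx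
    rw [hu x hx, hp x hx, slice_mul_real hx hy (hQA ⟨(x, y), hx, hy⟩)]
  obtain ⟨ℓ, y, hy, u, hu1, hus, hu0, hconst⟩ := exists_slice_affine hJ₁ hJ₂ hc hne hz h.z_two
  obtain ⟨p, hp4, hps⟩ := exists_isSlice hJ₁ hJ₂ hc hy ℓ h.zQ_five
  refine hasStandardForm_of_affine_mul hJ₁ hne hQ hu0 hu1 hp4 (hmul hy hus hps) ?_ ?_
  · intro hu
    by_contra hp3
    have hp : p.natDegree = 4 := by omega
    -- If Q were a quartic polynomial, the quartic bound on GQ would force G to be independent of x,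
    -- and then zQ would be at most cubic in x.
    have hG : dirDeriv (hJ₁.prod hJ₂) (1, 0) G = 0 := by
      refine eq_zero_of_slices fun ℓ' y' hy' => ?_
      obtain ⟨g, hg1, hgs⟩ := exists_isSlice hJ₁ hJ₂ hc hy' ℓ' h.G_two
      obtain ⟨m, hm4, hms⟩ := exists_isSlice hJ₁ hJ₂ hc hy' ℓ' h.GQ_five
      have hgm : g * p = u * m := eq_of_eval_eq_on hJ₁ hne fun x hx => by
        rw [eval_mul, eval_mul, ← hmul hy hus hps x hx, ← hmul hy' hgs hms x hx]
        ring
      have hg0 : g.natDegree = 0 := by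
        by_contra hg
        have hg' : g ≠ 0 := by rintro rfl; exact hg natDegree_zero
        have hp' : p ≠ 0 := by rintro rfl; simp at hp
        have h1 := natDegree_mul hg' hp'
        have h2 := natDegree_mul_le (p := u) (q := m)
        rw [hgm] at h1
        omega
      have := hgs.derivative hJ₁ hJ₂ hy'
      rwa [derivative_of_natDegree_zero hg0] at this
    have h4 := hps.iterate_derivative hJ₁ hJ₂ hy 4
    rw [h.zQ_four hP (hconst hu) hG] at h4
    have h5 := h4.eq_zero hJ₁ hne hy
    have h6 := congrArg (fun q => q.coeff 0) h5
    simp only [coeff_iterate_derivative, coeff_zero] at h6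
    have h7 : p.coeff 4 ≠ 0 := by
      rw [← hp]
      exact leadingCoeff_ne_zero.2 (by rintro rfl; simp at hp)
    simp at h6
    exact h7 h6
  · intro x₀ hx₀
    refine (hps.iterate_derivative hJ₁ hJ₂ hy 3).eval_eq_zero_of_central hJ₁ hJ₂ hne hy
      (natDegree_iterate_derivative_le (k := 3) hp4)
      (h.central hP (dirDeriv_snd_eq_zero (r := fun x => x₀ - x) hJ₁ hJ₂ fun p => rfl)
      (central_eq_zero hJ₁ hJ₂ fun ℓ y hy => ?_) (central_eq_zero hJ₁ hJ₂ fun ℓ y hy => ?_))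
    · obtain ⟨g, hg1, hgs⟩ := exists_isSlice hJ₁ hJ₂ hc hy ℓ h.z_two
      obtain ⟨m, hm4, hms⟩ := exists_isSlice hJ₁ hJ₂ hc hy ℓ h.zQ_five
      exact ⟨g, hg1, hgs, hx₀ g m (hmul hy hgs hms)⟩
    · obtain ⟨g, hg1, hgs⟩ := exists_isSlice hJ₁ hJ₂ hc hy ℓ h.G_two
      obtain ⟨m, hm4, hms⟩ := exists_isSlice hJ₁ hJ₂ hc hy ℓ h.GQ_five
      exact ⟨g, hg1, hgs, hx₀ g m (hmul hy hgs hms)⟩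

/-- The expression is linear in ζ, ζ_x and G with real coefficients depending on x only, so a real
functional passes through. -/
theorem nonlinearCompat_of_isSlice (hJ₁ : IsOpen J₁) (hJ₂ : IsOpen J₂) {V' : ℝ → ℝ}
    (hQA : ∀ p : ↥(J₁ ×ˢ J₂), QA.1 p = (Q p.1.1 : ℂ))
    (hVA : ∀ p : ↥(J₁ ×ˢ J₂), VA.1 p = (V p.1.1 : ℂ))
    (hV'A : ∀ p : ↥(J₁ ×ˢ J₂), (dirDeriv (hJ₁.prod hJ₂) (1, 0) VA).1 p = (V' p.1.1 : ℂ))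
    (hYA : ∀ p : ↥(J₁ ×ˢ J₂), YA.1 p = (Y p.1.1 : ℂ)) (hy : y ∈ J₂) {u g m : ℝ[X]}
    (hu : IsSlice ℓ ζ y u) (hg : IsSlice ℓ G y g)
    (hm : IsSlice ℓ (nonlinearExpr (dirDeriv (hJ₁.prod hJ₂) (1, 0))
      (algebraMap ℂ _ ((-ħ ^ 2 : ℝ) : ℂ)) QA VA YA ζ G) y m) :
    NonlinearCompat ħ J₁ Q V V' Y u g (C (1 / 4) * m) := by
  intro x hx
  have h1 := hm x hx
  rw [show nonlinearExpr (dirDeriv (hJ₁.prod hJ₂) (1, 0))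
      (algebraMap ℂ _ ((-ħ ^ 2 : ℝ) : ℂ)) QA VA YA ζ G =
      ζ * (6 * YA + algebraMap ℂ _ ((-ħ ^ 2 : ℝ) : ℂ) * dirDeriv (hJ₁.prod hJ₂) (1, 0) VA) +
      dirDeriv (hJ₁.prod hJ₂) (1, 0) ζ *
        (2 * QA ^ 2 + 2 * algebraMap ℂ _ ((-ħ ^ 2 : ℝ) : ℂ) * VA) + G * (4 * QA) by
      unfold nonlinearExpr; ring, slice_add hx hy, slice_add hx hy,
    slice_mul_real (r := 6 * Y x + -ħ ^ 2 * V' x) hx hy,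
    slice_mul_real (r := 2 * Q x ^ 2 + 2 * -ħ ^ 2 * V x) hx hy,
    slice_mul_real (r := 4 * Q x) hx hy, ← hu x hx, ← hu.derivative hJ₁ hJ₂ hy x hx,
    ← hg x hx] at h1
  · rw [eval_mul, eval_C, h1]
    ring
  · change 4 * QA.1 _ = _
    rw [hQA]
    push_cast
    rfl
  · change 2 * QA.1 _ ^ 2 + 2 * ((-ħ ^ 2 : ℝ) : ℂ) * VA.1 _ = _
    rw [hQA, hVA]
    push_cast
    rfl
  · change 6 * YA.1 _ + ((-ħ ^ 2 : ℝ) : ℂ) * (dirDeriv (hJ₁.prod hJ₂) (1, 0) VA).1 _ = _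
    rw [hYA, hV'A]
    push_cast
    rfl

/-- The slices of z and of ζ may come from different lines and functionals, since both give
equations for the same Q. -/
theorem hasStandardForm_of_quadraticCompat (hJ₁ : IsOpen J₁) (hJ₂ : IsOpen J₂)
    (hc : IsPreconnected J₁) (hne : J₁.Nonempty) {V' : ℝ → ℝ} (hQ : ∀ x ∈ J₁, HasDerivAt Q (V x) x)
    (hV : ∀ x ∈ J₁, HasDerivAt V (V' x) x) (hY : ∀ x ∈ J₁, HasDerivAt Y (V x ^ 2) x)
    (hQA : ∀ p : ↥(J₁ ×ˢ J₂), QA.1 p = (Q p.1.1 : ℂ))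
    (hVA : ∀ p : ↥(J₁ ×ˢ J₂), VA.1 p = (V p.1.1 : ℂ))
    (hV'A : ∀ p : ↥(J₁ ×ˢ J₂), (dirDeriv (hJ₁.prod hJ₂) (1, 0) VA).1 p = (V' p.1.1 : ℂ))
    (hYA : ∀ p : ↥(J₁ ×ˢ J₂), YA.1 p = (Y p.1.1 : ℂ))
    (hP : Potentials (dirDeriv (hJ₁.prod hJ₂) (1, 0)) (dirDeriv (hJ₁.prod hJ₂) (0, 1))
      QA VA YA WA RA)
    (h : QuadraticCompat (dirDeriv (hJ₁.prod hJ₂) (1, 0)) (dirDeriv (hJ₁.prod hJ₂) (0, 1))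
      (algebraMap ℂ _ ((-ħ ^ 2 : ℝ) : ℂ)) QA VA YA WA RA ζ z G c) (hz : z ≠ 0) (hζ : ζ ≠ 0) :
    HasStandardForm ħ J₁ V := by
  have hN : ∀ {ℓ : ℂ →L[ℝ] ℝ} {y : ℝ}, y ∈ J₂ → ∀ {u g m : ℝ[X]}, IsSlice ℓ ζ y u →
      IsSlice ℓ G y g → IsSlice ℓ (nonlinearExpr (dirDeriv (hJ₁.prod hJ₂) (1, 0))
        (algebraMap ℂ _ ((-ħ ^ 2 : ℝ) : ℂ)) QA VA YA ζ G) y m →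
      NonlinearCompat ħ J₁ Q V V' Y u g (C (1 / 4) * m) := fun hy _ _ _ hu hg hm =>
    nonlinearCompat_of_isSlice hJ₁ hJ₂ hQA hVA hV'A hYA hy hu hg hm
  obtain ⟨ℓ, y, hy, w, hw1, hws, hw0, hconst⟩ := exists_slice_affine hJ₁ hJ₂ hc hne hζ h.ζ_two
  obtain ⟨g, hg, hgs⟩ : ∃ g : ℝ[X], g.natDegree ≤ 2 + w.natDegree ∧ IsSlice ℓ G y g := by
    rcases Nat.le_one_iff_eq_zero_or_eq_one.1 hw1 with h0 | h1
    · rw [h0]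
      exact exists_isSlice hJ₁ hJ₂ hc hy ℓ (h.of_const (hconst h0)).1
    · rw [h1]
      exact exists_isSlice hJ₁ hJ₂ hc hy ℓ h.G_four
  obtain ⟨m, hm, hms⟩ : ∃ m : ℝ[X], m.natDegree ≤ 5 + w.natDegree ∧
      IsSlice ℓ (nonlinearExpr (dirDeriv (hJ₁.prod hJ₂) (1, 0))
        (algebraMap ℂ _ ((-ħ ^ 2 : ℝ) : ℂ)) QA VA YA ζ G) y m := by
    rcases Nat.le_one_iff_eq_zero_or_eq_one.1 hw1 with h0 | h1
    · rw [h0]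
      exact exists_isSlice hJ₁ hJ₂ hc hy ℓ (h.of_const (hconst h0)).2
    · rw [h1]
      exact exists_isSlice hJ₁ hJ₂ hc hy ℓ h.N_seven
  obtain ⟨ℓ₁, y₁, hy₁, u, hu3, hus, hu0⟩ := exists_slice_ne_zero hJ₁ hJ₂ hc hz (h.z_four hP)
  obtain ⟨p, hp6, hps⟩ := exists_isSlice hJ₁ hJ₂ hc hy₁ ℓ₁ (h.zQ_seven hP)
  refine hasStandardForm_of_compat (p := p) hJ₁ hne hQ hV hY hu0 hu3 (fun x hx => ?_) hw0 hw1 hg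
    ((natDegree_C_mul_le _ _).trans hm) (hN hy hws hgs hms) fun x₀ _ => ?_
  · rw [hus x hx, hps x hx, slice_mul_real hx hy₁ (hQA ⟨(x, y₁), hx, hy₁⟩)]
  -- Either some slice of ζ is non-zero at x₀ and fixes the residue, or x₀ is a common zero and the
  -- central conditions apply.
  by_cases hex : ∃ (ℓ : ℂ →L[ℝ] ℝ), ∃ y ∈ J₂, ∃ P : ℝ[X], P.natDegree ≤ 1 ∧ IsSlice ℓ ζ y P ∧
      P.eval x₀ ≠ 0
  · left
    obtain ⟨ℓ', y', hy', w', hw1', hws', hw0'⟩ := hex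
    obtain ⟨g', -, hgs'⟩ := exists_isSlice hJ₁ hJ₂ hc hy' ℓ' h.G_four
    obtain ⟨m', -, hms'⟩ := exists_isSlice hJ₁ hJ₂ hc hy' ℓ' h.N_seven
    exact ⟨w', g', _, hw1', hw0', hN hy' hws' hgs' hms'⟩
  · right
    push Not at hex
    have hcen := h.central hP
      (dirDeriv_snd_eq_zero (r := fun x => x₀ - x) (a := shiftFun J₁ J₂ x₀) hJ₁ hJ₂ fun p => rfl)
      (central_eq_zero hJ₁ hJ₂ fun ℓ y hy => by
        obtain ⟨P, hP1, hPs⟩ := exists_isSlice hJ₁ hJ₂ hc hy ℓ h.ζ_two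
        exact ⟨P, hP1, hPs, hex ℓ y hy P hP1 hPs⟩)
    exact ⟨(hus.iterate_derivative hJ₁ hJ₂ hy₁ 2).eval_eq_zero_of_central hJ₁ hJ₂ hne hy₁
        (natDegree_iterate_derivative_le (k := 2) hu3) hcen.1,
      (hps.iterate_derivative hJ₁ hJ₂ hy₁ 5).eval_eq_zero_of_central hJ₁ hJ₂ hne hy₁
        (natDegree_iterate_derivative_le (k := 5) hp6) hcen.2⟩

end Assembly

/-! ### The bracket with a separable Hamiltonian -/

section Bracket

variable {J : Fin 2 → Set ℝ} {V : Fin 2 → ℝ → ℝ}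

/-- Equality of phase space functions above the coordinate domain. -/
def BoxEq (J : Fin 2 → Set ℝ) (F G : PhaseFun) : Prop :=
  ∀ q ∈ box J, ∀ p, F q p = G q p

theorem update_mem_box {q : Fin 2 → ℝ} (hq : q ∈ box J) {l : Fin 2} {t : ℝ} (ht : t ∈ J l) :
    Function.update q l t ∈ box J := by
  intro k
  rcases eq_or_ne k l with rfl | hk
  · simpa using ht
  · simpa [hk] using hq k

theorem BoxEq.dq (hJ : ∀ i, IsOpen (J i)) {F G : PhaseFun} (h : BoxEq J F G) (l : Fin 2) :
    BoxEq J (dq l F) (dq l G) := by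
  intro q hq p
  refine Filter.EventuallyEq.deriv_eq ?_
  filter_upwards [(hJ l).mem_nhds (hq l)] with t ht using h _ (update_mem_box hq ht) p

theorem BoxEq.dp {F G : PhaseFun} (h : BoxEq J F G) (l : Fin 2) : BoxEq J (dp l F) (dp l G) := by
  intro q hq p
  simp only [_root_.dp, h q hq]

theorem BoxEq.iterate_dq (hJ : ∀ i, IsOpen (J i)) {F G : PhaseFun} (h : BoxEq J F G) (l : Fin 2)
    (m : ℕ) : BoxEq J ((_root_.dq l)^[m] F) ((_root_.dq l)^[m] G) := by
  induction m generalizing F G with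
  | zero => exact h
  | succ m ih => exact ih (h.dq hJ l)

theorem BoxEq.iterate_dp {F G : PhaseFun} (h : BoxEq J F G) (l : Fin 2) (m : ℕ) :
    BoxEq J ((_root_.dp l)^[m] F) ((_root_.dp l)^[m] G) := by
  induction m generalizing F G with
  | zero => exact h
  | succ m ih => exact ih (h.dp l)

theorem BoxEq.trans {F G H : PhaseFun} (h : BoxEq J F G) (h' : BoxEq J G H) : BoxEq J F H :=
  fun q hq p => (h q hq p).trans (h' q hq p)

theorem contDiffOn_iterate_deriv {s : Set ℝ} (hs : IsOpen s) {r : ℝ → ℝ} (hr : ContDiffOn ℝ ∞ r s)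
    (m : ℕ) : ContDiffOn ℝ ∞ (deriv^[m] r) s := by
  induction m generalizing r with
  | zero => exact hr
  | succ m ih => exact ih (hr.deriv_of_isOpen hs (by simp))

theorem hasDerivAt_iterate_deriv {s : Set ℝ} (hs : IsOpen s) {r : ℝ → ℝ}
    (hr : ContDiffOn ℝ ∞ r s) (m : ℕ) {x : ℝ} (hx : x ∈ s) :
    HasDerivAt (deriv^[m] r) (deriv^[m + 1] r x) x := by
  rw [Function.iterate_succ_apply']
  exact (((contDiffOn_iterate_deriv hs hr m).contDiffAt (hs.mem_nhds hx)).differentiableAt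
    (by simp)).hasDerivAt

theorem dp_zero (l : Fin 2) : dp l (fun _ _ => 0) = fun _ _ => 0 := by
  funext q p
  simp [dp]

theorem dq_zero (l : Fin 2) : dq l (fun _ _ => 0) = fun _ _ => 0 := by
  funext q p
  simp [dq]

theorem dp_hamiltonian (l : Fin 2) : dp l (hamiltonian V) = fun _ p => (p l : ℂ) := by
  funext q p
  refine HasDerivAt.deriv ?_
  refine HasDerivAt.ofReal_comp (f := fun t => ∑ i, (Function.update p l t i ^ 2 / 2 + V i (q i))) ?_
  have h : ∀ k : ℝ, HasDerivAt (fun t : ℝ => t ^ 2 / 2 + k) (p l) (p l) := fun k => by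
    have := (((hasDerivAt_id (p l)).pow 2).div_const 2).add_const k
    simpa using this
  fin_cases l
  · convert h (V 0 (q 0) + (p 1 ^ 2 / 2 + V 1 (q 1))) using 1
    funext t
    simp
    ring
  · convert h (V 1 (q 1) + (p 0 ^ 2 / 2 + V 0 (q 0))) using 1
    funext t
    simp
    ring

theorem dp_mom (l k : Fin 2) :
    dp l (fun _ p => (p k : ℂ)) = fun _ _ => if l = k then 1 else 0 := by
  funext q p
  refine HasDerivAt.deriv ?_
  split_ifs with h
  · subst h
    simpa using (hasDerivAt_id (p l)).ofReal_comp
  · simpa [Ne.symm h] using hasDerivAt_const (p l) (p k : ℂ)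

theorem dp_const (l : Fin 2) (a : ℂ) : dp l (fun _ _ => a) = fun _ _ => 0 := by
  funext q p
  simp [dp]

theorem iterate_dp_zero (l : Fin 2) (m : ℕ) : (dp l)^[m] (fun _ _ => 0) = fun _ _ => 0 :=
  Function.iterate_fixed (dp_zero l) m

theorem iterate_dq_zero (l : Fin 2) (m : ℕ) : (dq l)^[m] (fun _ _ => 0) = fun _ _ => 0 :=
  Function.iterate_fixed (dq_zero l) m

theorem iterate_dp_hamiltonian (l : Fin 2) (m : ℕ) :
    (dp l)^[m + 3] (hamiltonian V) = fun _ _ => 0 := by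
  rw [Function.iterate_add_apply]
  simp only [Function.iterate_succ, Function.iterate_zero, Function.comp_apply, id,
    dp_hamiltonian, dp_mom, if_true, dp_const]
  exact iterate_dp_zero l m

theorem iterate_dp_dp_hamiltonian {l k : Fin 2} (h : l ≠ k) (m m' : ℕ) :
    (dp l)^[m + 1] ((dp k)^[m' + 1] (hamiltonian V)) = fun _ _ => 0 := by
  rcases m' with _ | _ | m'
  · simp only [Function.iterate_succ_apply, Function.iterate_zero, id, dp_hamiltonian, dp_mom, h,
      if_false, iterate_dp_zero]
  · simp only [Function.iterate_succ_apply, Function.iterate_zero, id, dp_hamiltonian, dp_mom,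
      if_true, dp_const, iterate_dp_zero]
  · rw [iterate_dp_hamiltonian, iterate_dp_zero]

theorem dq_coordinate (hJ : ∀ i, IsOpen (J i)) {l k : Fin 2} {r : ℝ → ℝ}
    (hr : ContDiffOn ℝ ∞ r (J k)) :
    BoxEq J (dq l fun q _ => (r (q k) : ℂ)) (fun q _ => if l = k then ((deriv r (q k) : ℝ) : ℂ) else 0) := by
  intro q hq p
  refine HasDerivAt.deriv ?_
  split_ifs with h
  · subst h
    simpa using (hasDerivAt_iterate_deriv (hJ l) hr 0 (hq l)).ofReal_comp
  · simpa [Ne.symm h] using hasDerivAt_const (q l) (r (q k) : ℂ)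

theorem dq_hamiltonian (hJ : ∀ i, IsOpen (J i)) (hV : ∀ i, ContDiffOn ℝ ∞ (V i) (J i)) (l : Fin 2) :
    BoxEq J (dq l (hamiltonian V)) (fun q _ => ((deriv (V l) (q l) : ℝ) : ℂ)) := by
  intro q hq p
  refine HasDerivAt.deriv ?_
  refine HasDerivAt.ofReal_comp
    (f := fun t => ∑ i, (p i ^ 2 / 2 + V i (Function.update q l t i))) ?_
  have h : ∀ k : ℝ, HasDerivAt (fun t : ℝ => V l t + k) (deriv (V l) (q l)) (q l) := fun k =>
    (hasDerivAt_iterate_deriv (hJ l) (hV l) 0 (hq l)).add_const k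
  fin_cases l
  · convert h (p 0 ^ 2 / 2 + (p 1 ^ 2 / 2 + V 1 (q 1))) using 1
    funext t
    simp
    ring
  · convert h (p 1 ^ 2 / 2 + (p 0 ^ 2 / 2 + V 0 (q 0))) using 1
    funext t
    simp
    ring

theorem iterate_dq_hamiltonian (hJ : ∀ i, IsOpen (J i)) (hV : ∀ i, ContDiffOn ℝ ∞ (V i) (J i))
    (l : Fin 2) (m : ℕ) : BoxEq J ((dq l)^[m + 1] (hamiltonian V))
      (fun q _ => ((deriv^[m + 1] (V l) (q l) : ℝ) : ℂ)) := by
  induction m with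
  | zero => exact dq_hamiltonian hJ hV l
  | succ m ih =>
    rw [Function.iterate_succ_apply']
    refine (ih.dq hJ l).trans ((dq_coordinate hJ
      (contDiffOn_iterate_deriv (hJ l) (hV l) (m + 1))).trans fun q _ _ => ?_)
    simp only [if_true]
    rw [← Function.iterate_succ_apply' deriv]

theorem iterate_dq_dq_hamiltonian (hJ : ∀ i, IsOpen (J i)) (hV : ∀ i, ContDiffOn ℝ ∞ (V i) (J i))
    {l k : Fin 2} (h : l ≠ k) (m m' : ℕ) :
    BoxEq J ((dq l)^[m + 1] ((dq k)^[m' + 1] (hamiltonian V))) fun _ _ => 0 := by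
  refine ((iterate_dq_hamiltonian hJ hV k m').iterate_dq hJ l (m + 1)).trans ?_
  rw [Function.iterate_succ_apply]
  refine ((dq_coordinate hJ (contDiffOn_iterate_deriv (hJ k) (hV k) (m' + 1))).iterate_dq
    hJ l m).trans fun q _ p => ?_
  simp only [h, if_false, iterate_dq_zero]

theorem sum_erase_eq_of_mixed {T : ℕ × ℕ → ℂ} (hT : ∀ a b, T (a + 1, b + 1) = 0) (N : ℕ) :
    ∑ k ∈ (Finset.range (N + 1) ×ˢ Finset.range (N + 1)).erase (0, 0), T k =
      ∑ m ∈ Finset.range N, T (m + 1, 0) + ∑ m ∈ Finset.range N, T (0, m + 1) := by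
  have h := Finset.add_sum_erase (Finset.range (N + 1) ×ˢ Finset.range (N + 1)) T
    (a := (0, 0)) (by simp)
  rw [Finset.sum_product, Finset.sum_range_succ', Finset.sum_range_succ'] at h
  simp only [Finset.sum_range_succ' _ N, hT, Finset.sum_const_zero, zero_add] at h
  linear_combination h

/-- The Hamiltonian is a sum over the degrees of freedom, so its mixed derivatives vanish and the
double series collapses to two single ones. -/
theorem bracket_hamiltonian (hJ : ∀ i, IsOpen (J i)) (hV : ∀ i, ContDiffOn ℝ ∞ (V i) (J i))
    (N : ℕ) (ħ : ℝ) (f : PhaseFun) :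
    BoxEq J (bracket N ħ f (hamiltonian V)) fun q p => ∑ l : Fin 2, ∑ m ∈ Finset.range N,
      1 / ((m + 1)! : ℂ) * ((ħ : ℂ) / Complex.I) ^ m *
        ((dq l)^[m + 1] f q p * (dp l)^[m + 1] (hamiltonian V) q p -
          (dp l)^[m + 1] f q p * (dq l)^[m + 1] (hamiltonian V) q p) := by
  intro q hq p
  rw [bracket, sum_erase_eq_of_mixed]
  · simp
  · intro a b
    simp only
    rw [iterate_dp_dp_hamiltonian (by decide), iterate_dq_dq_hamiltonian hJ hV (by decide) a b q hq p]
    simp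

end Bracket

/-! ### Derivatives of polynomials in the momenta -/

section PhasePolynomials

open Polynomial in
theorem eq_zero_of_sum_pow_eq_zero {N : ℕ} {k : ℕ → ℂ}
    (h : ∀ x : ℝ, ∑ a ∈ Finset.range N, k a * (x : ℂ) ^ a = 0) {a : ℕ} (ha : a < N) : k a = 0 := by
  set P : ℂ[X] := ∑ a ∈ Finset.range N, C (k a) * X ^ a with hP
  have h0 : P = 0 := by
    refine eq_zero_of_infinite_isRoot P
      ((Set.infinite_range_of_injective Complex.ofReal_injective).mono ?_)
    rintro _ ⟨x, rfl⟩
    have := h x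
    simpa [hP, IsRoot, eval_finsetSum] using this
  have h1 := congrArg (fun q => q.coeff a) h0
  simpa [hP, finsetSum_coeff, coeff_X_pow, ha] using h1

theorem eq_zero_of_sum_sum_pow_eq_zero {N : ℕ} {k : ℕ → ℕ → ℂ}
    (h : ∀ x y : ℝ, ∑ a ∈ Finset.range N, ∑ b ∈ Finset.range N,
      k a b * (x : ℂ) ^ a * (y : ℂ) ^ b = 0) {a b : ℕ} (ha : a < N) (hb : b < N) : k a b = 0 := by
  refine eq_zero_of_sum_pow_eq_zero (k := k a) (fun y => ?_) hb
  refine eq_zero_of_sum_pow_eq_zero (k := fun a => ∑ b ∈ Finset.range N, k a b * (y : ℂ) ^ b)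
    (fun x => ?_) ha
  rw [← h x y]
  refine Finset.sum_congr rfl fun a _ => ?_
  rw [Finset.sum_mul]
  exact Finset.sum_congr rfl fun b _ => by ring

variable {J : Fin 2 → Set ℝ} {i j : Fin 2}

/-- The phase space polynomial with given coefficients. -/
noncomputable def phasePoly (J : Fin 2 → Set ℝ) (i j : Fin 2) (N : ℕ)
    (C : Coeffs (smoothSubalgebra (J i ×ˢ J j))) : PhaseFun := fun q p =>
  ∑ a ∈ Finset.range N, ∑ b ∈ Finset.range N,
    extendZero _ (C a b).1 (q i, q j) * (p i : ℂ) ^ a * (p j : ℂ) ^ b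

variable {N : ℕ} {C : Coeffs (smoothSubalgebra (J i ×ˢ J j))}

theorem dq_fst_phasePoly (hJ : ∀ i, IsOpen (J i)) (hij : j ≠ i) :
    BoxEq J (dq i (phasePoly J i j N C))
      (phasePoly J i j N fun a b => dirDeriv ((hJ i).prod (hJ j)) (1, 0) (C a b)) := by
  intro q hq p
  refine HasDerivAt.deriv ?_
  unfold phasePoly
  simp only [Function.update_self, Function.update_of_ne hij]
  refine HasDerivAt.fun_sum fun a _ => HasDerivAt.fun_sum fun b _ => ?_
  exact ((hasDerivAt_fst ((hJ i).prod (hJ j)) (C a b) ⟨hq i, hq j⟩).mul_const _).mul_const _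

theorem dq_snd_phasePoly (hJ : ∀ i, IsOpen (J i)) (hij : j ≠ i) :
    BoxEq J (dq j (phasePoly J i j N C))
      (phasePoly J i j N fun a b => dirDeriv ((hJ i).prod (hJ j)) (0, 1) (C a b)) := by
  intro q hq p
  refine HasDerivAt.deriv ?_
  unfold phasePoly
  simp only [Function.update_self, Function.update_of_ne hij.symm]
  refine HasDerivAt.fun_sum fun a _ => HasDerivAt.fun_sum fun b _ => ?_
  exact ((hasDerivAt_snd ((hJ i).prod (hJ j)) (C a b) ⟨hq i, hq j⟩).mul_const _).mul_const _

theorem extendZero_mul {S : Set (ℝ × ℝ)} {s : ℝ × ℝ} (hs : s ∈ S)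
    (f g : smoothSubalgebra S) : extendZero S (f * g).1 s = extendZero S f.1 s * extendZero S g.1 s := by
  have h1 := extendZero_coe (f * g).1 ⟨s, hs⟩
  have h2 := extendZero_coe f.1 ⟨s, hs⟩
  have h3 := extendZero_coe g.1 ⟨s, hs⟩
  simp only at h1 h2 h3
  rw [h1, h2, h3]
  rfl

theorem dp_fst_phasePoly (hij : j ≠ i) (hC : ∀ b, C N b = 0) :
    BoxEq J (dp i (phasePoly J i j N C)) (phasePoly J i j N (momDeriv₁ C)) := by
  intro q hq p
  have hs : (q i, q j) ∈ J i ×ˢ J j := ⟨hq i, hq j⟩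
  refine HasDerivAt.deriv ?_
  have h : HasDerivAt (fun t : ℝ => ∑ a ∈ Finset.range N, ∑ b ∈ Finset.range N,
      extendZero _ (C a b).1 (q i, q j) * (t : ℂ) ^ a * (p j : ℂ) ^ b)
      (∑ a ∈ Finset.range N, ∑ b ∈ Finset.range N,
      extendZero _ (C a b).1 (q i, q j) * (a * (p i : ℂ) ^ (a - 1)) * (p j : ℂ) ^ b) (p i) := by
    refine HasDerivAt.fun_sum fun a _ => HasDerivAt.fun_sum fun b _ => ?_
    exact ((((hasDerivAt_id (p i : ℂ)).pow a).comp_ofReal.congr_deriv (by simp)).const_mul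
      _).mul_const _
  unfold phasePoly
  simp only [Function.update_self, Function.update_of_ne hij]
  refine h.congr_deriv ?_
  have h0 : ∀ b, extendZero _ (C N b).1 (q i, q j) = 0 := fun b => by
    rw [hC]
    exact extendZero_coe (S := J i ×ˢ J j) 0 ⟨_, hs⟩
  have h1 := Finset.sum_range_succ (fun a => ∑ b ∈ Finset.range N,
      extendZero _ (C a b).1 (q i, q j) * (a * (p i : ℂ) ^ (a - 1)) * (p j : ℂ) ^ b) N
  rw [Finset.sum_range_succ'] at h1
  simp only [h0, zero_mul, Finset.sum_const_zero, add_zero, Nat.cast_zero, mul_zero] at h1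
  rw [← h1]
  refine Finset.sum_congr rfl fun a _ => Finset.sum_congr rfl fun b _ => ?_
  rw [momDeriv₁, extendZero_mul hs, show extendZero (J i ×ˢ J j)
    ((a : smoothSubalgebra (J i ×ˢ J j)) + 1).1 (q i, q j) = (a : ℂ) + 1 from
    (extendZero_coe ((a : smoothSubalgebra (J i ×ˢ J j)) + 1).1 ⟨_, hs⟩)]
  rw [Nat.add_sub_cancel]
  push_cast
  ring

theorem dp_snd_phasePoly (hij : j ≠ i) (hC : ∀ a, C a N = 0) :
    BoxEq J (dp j (phasePoly J i j N C)) (phasePoly J i j N (momDeriv₂ C)) := by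
  intro q hq p
  have hs : (q i, q j) ∈ J i ×ˢ J j := ⟨hq i, hq j⟩
  refine HasDerivAt.deriv ?_
  have h : HasDerivAt (fun t : ℝ => ∑ a ∈ Finset.range N, ∑ b ∈ Finset.range N,
      extendZero _ (C a b).1 (q i, q j) * (p i : ℂ) ^ a * (t : ℂ) ^ b)
      (∑ a ∈ Finset.range N, ∑ b ∈ Finset.range N,
      extendZero _ (C a b).1 (q i, q j) * (p i : ℂ) ^ a * (b * (p j : ℂ) ^ (b - 1))) (p j) := by
    refine HasDerivAt.fun_sum fun a _ => HasDerivAt.fun_sum fun b _ => ?_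
    exact (((hasDerivAt_id (p j : ℂ)).pow b).comp_ofReal.congr_deriv (by simp)).const_mul _
  unfold phasePoly
  simp only [Function.update_self, Function.update_of_ne hij.symm]
  refine h.congr_deriv ?_
  have h0 : ∀ a, extendZero _ (C a N).1 (q i, q j) = 0 := fun a => by
    rw [hC]
    exact extendZero_coe (S := J i ×ˢ J j) 0 ⟨_, hs⟩
  refine Finset.sum_congr rfl fun a _ => ?_
  have h1 := Finset.sum_range_succ (fun b =>
      extendZero _ (C a b).1 (q i, q j) * (p i : ℂ) ^ a * (b * (p j : ℂ) ^ (b - 1))) N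
  rw [Finset.sum_range_succ'] at h1
  rw [h0 a] at h1
  simp only [zero_mul, add_zero, Nat.cast_zero, mul_zero] at h1
  rw [← h1]
  refine Finset.sum_congr rfl fun b _ => ?_
  rw [momDeriv₂, extendZero_mul hs, show extendZero (J i ×ˢ J j)
    ((b : smoothSubalgebra (J i ×ˢ J j)) + 1).1 (q i, q j) = (b : ℂ) + 1 from
    (extendZero_coe ((b : smoothSubalgebra (J i ×ˢ J j)) + 1).1 ⟨_, hs⟩)]
  rw [Nat.add_sub_cancel]
  push_cast
  ring

end PhasePolynomials

/-! ### Comparison of momentum coefficients -/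

section Extraction

variable {J : Fin 2 → Set ℝ} {i j : Fin 2} {N n : ℕ} {C D : Coeffs (smoothSubalgebra (J i ×ˢ J j))}
  {q p : Fin 2 → ℝ}

theorem extendZero_add {S : Set (ℝ × ℝ)} {s : ℝ × ℝ} (hs : s ∈ S) (f g : smoothSubalgebra S) :
    extendZero S (f + g).1 s = extendZero S f.1 s + extendZero S g.1 s := by
  have h1 := extendZero_coe (f + g).1 ⟨s, hs⟩
  have h2 := extendZero_coe f.1 ⟨s, hs⟩
  have h3 := extendZero_coe g.1 ⟨s, hs⟩
  simp only at h1 h2 h3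
  rw [h1, h2, h3]
  rfl

theorem extendZero_algebraMap {S : Set (ℝ × ℝ)} {s : ℝ × ℝ} (hs : s ∈ S) (r : ℂ) :
    extendZero S (algebraMap ℂ (smoothSubalgebra S) r).1 s = r :=
  extendZero_coe (algebraMap ℂ (smoothSubalgebra S) r).1 ⟨s, hs⟩

theorem extendZero_zero {S : Set (ℝ × ℝ)} {s : ℝ × ℝ} (hs : s ∈ S) :
    extendZero S (0 : smoothSubalgebra S).1 s = 0 :=
  extendZero_coe (0 : smoothSubalgebra S).1 ⟨s, hs⟩

theorem phasePoly_add (hq : q ∈ box J) :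
    phasePoly J i j N (C + D) q p = phasePoly J i j N C q p + phasePoly J i j N D q p := by
  have hs : (q i, q j) ∈ J i ×ˢ J j := ⟨hq i, hq j⟩
  simp only [phasePoly, Pi.add_apply, extendZero_add hs, add_mul, Finset.sum_add_distrib]

theorem phasePoly_smul (hq : q ∈ box J) (g : smoothSubalgebra (J i ×ˢ J j)) :
    phasePoly J i j N (g • C) q p = extendZero _ g.1 (q i, q j) * phasePoly J i j N C q p := by
  have hs : (q i, q j) ∈ J i ×ˢ J j := ⟨hq i, hq j⟩
  simp only [phasePoly, Pi.smul_apply, smul_eq_mul, extendZero_mul hs, Finset.mul_sum, mul_assoc]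

theorem phasePoly_complex_smul (hq : q ∈ box J) (r : ℂ) :
    phasePoly J i j N (r • C) q p = r * phasePoly J i j N C q p := by
  have hs : (q i, q j) ∈ J i ×ˢ J j := ⟨hq i, hq j⟩
  rw [show r • C = algebraMap ℂ (smoothSubalgebra (J i ×ˢ J j)) r • C by
    funext a b
    simp [Algebra.smul_def], phasePoly_smul hq, extendZero_algebraMap hs]

theorem phasePoly_sub (hq : q ∈ box J) :
    phasePoly J i j N (C - D) q p = phasePoly J i j N C q p - phasePoly J i j N D q p := by
  rw [eq_sub_iff_add_eq, ← phasePoly_add hq, sub_add_cancel]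

theorem mul_fst_phasePoly (hq : q ∈ box J) (hC : ∀ b, C N b = 0) :
    phasePoly J i j (N + 1) C q p * p i =
      phasePoly J i j (N + 1) (fun a b => if a = 0 then 0 else C (a - 1) b) q p := by
  have hs : (q i, q j) ∈ J i ×ˢ J j := ⟨hq i, hq j⟩
  unfold phasePoly
  refine (congrArg (· * (p i : ℂ)) (Finset.sum_range_succ _ N)).trans
    (Eq.trans ?_ (Finset.sum_range_succ' _ N).symm)
  simp only [hC, extendZero_zero hs, if_true, zero_mul, Finset.sum_const_zero, add_zero,
    Finset.sum_mul, Nat.add_eq_zero_iff, one_ne_zero, and_false, if_false, Nat.add_sub_cancel]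
  exact Finset.sum_congr rfl fun a _ => Finset.sum_congr rfl fun b _ => by ring

theorem mul_snd_phasePoly (hq : q ∈ box J) (hC : ∀ a, C a N = 0) :
    phasePoly J i j (N + 1) C q p * p j =
      phasePoly J i j (N + 1) (fun a b => if b = 0 then 0 else C a (b - 1)) q p := by
  have hs : (q i, q j) ∈ J i ×ˢ J j := ⟨hq i, hq j⟩
  unfold phasePoly
  rw [Finset.sum_mul]
  refine Finset.sum_congr rfl fun a _ => ?_
  refine (congrArg (· * (p j : ℂ)) (Finset.sum_range_succ _ N)).trans
    (Eq.trans ?_ (Finset.sum_range_succ' _ N).symm)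
  simp only [hC, extendZero_zero hs, if_true, zero_mul, add_zero,
    Finset.sum_mul, Nat.add_eq_zero_iff, one_ne_zero, and_false, if_false, Nat.add_sub_cancel]
  exact Finset.sum_congr rfl fun b _ => by ring

theorem coeff_eq_zero_of_phasePoly (hij : j ≠ i) (h : BoxEq J (phasePoly J i j N C) fun _ _ => 0)
    {a b : ℕ} (ha : a < N) (hb : b < N) : C a b = 0 := by
  ext s
  set q : Fin 2 → ℝ := fun l => if l = i then s.1.1 else s.1.2 with hqdef
  have hqi : q i = s.1.1 := by simp [hqdef]
  have hqj : q j = s.1.2 := by simp [hqdef, hij]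
  have hq : q ∈ box J := by
    intro l
    rcases eq_or_ne l i with rfl | hl
    · rw [hqi]; exact s.2.1
    · have : l = j := by omega
      rw [this, hqj]
      exact s.2.2
  have h1 := eq_zero_of_sum_sum_pow_eq_zero (N := N) (k := fun a b => (C a b).1 s) (fun x y => by
    have h2 := h q hq fun l => if l = i then x else y
    simp only [phasePoly, if_true, hij, if_false] at h2
    rw [hqi, hqj, Prod.mk.eta] at h2
    simpa only [extendZero_coe] using h2) ha hb
  exact h1

variable (hJ : ∀ i, IsOpen (J i))

theorem iterate_dq_fst_phasePoly (hij : j ≠ i) (m : ℕ) :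
    BoxEq J ((dq i)^[m] (phasePoly J i j N C))
      (phasePoly J i j N fun a b => (dirDeriv ((hJ i).prod (hJ j)) (1, 0))^[m] (C a b)) := by
  induction m generalizing C with
  | zero => exact fun _ _ _ => rfl
  | succ m ih => exact ((dq_fst_phasePoly hJ hij).iterate_dq hJ i m).trans ih

theorem iterate_dq_snd_phasePoly (hij : j ≠ i) (m : ℕ) :
    BoxEq J ((dq j)^[m] (phasePoly J i j N C))
      (phasePoly J i j N fun a b => (dirDeriv ((hJ i).prod (hJ j)) (0, 1))^[m] (C a b)) := by
  induction m generalizing C with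
  | zero => exact fun _ _ _ => rfl
  | succ m ih => exact ((dq_snd_phasePoly hJ hij).iterate_dq hJ j m).trans ih

theorem iterate_momDeriv₁_eq_zero {A : Type*} [CommRing A] {C : Coeffs A}
    (hC : ∀ a b, n < a + b → C a b = 0) (m a b : ℕ) (h : n < a + b + m) :
    momDeriv₁^[m] C a b = 0 := by
  induction m generalizing a b with
  | zero => exact hC a b h
  | succ m ih =>
    rw [Function.iterate_succ_apply']
    simp [momDeriv₁, ih (a + 1) b (by omega)]

theorem iterate_momDeriv₂_eq_zero {A : Type*} [CommRing A] {C : Coeffs A}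
    (hC : ∀ a b, n < a + b → C a b = 0) (m a b : ℕ) (h : n < a + b + m) :
    momDeriv₂^[m] C a b = 0 := by
  induction m generalizing a b with
  | zero => exact hC a b h
  | succ m ih =>
    rw [Function.iterate_succ_apply']
    simp [momDeriv₂, ih a (b + 1) (by omega)]

theorem iterate_dp_fst_phasePoly (hij : j ≠ i) (hn : n < N) (hC : ∀ a b, n < a + b → C a b = 0)
    (m : ℕ) : BoxEq J ((dp i)^[m] (phasePoly J i j N C)) (phasePoly J i j N (momDeriv₁^[m] C)) := by
  induction m with
  | zero => exact fun _ _ _ => rfl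
  | succ m ih =>
    rw [Function.iterate_succ_apply', Function.iterate_succ_apply']
    exact (ih.dp i).trans
      (dp_fst_phasePoly hij fun b => iterate_momDeriv₁_eq_zero hC m N b (by omega))

theorem iterate_dp_snd_phasePoly (hij : j ≠ i) (hn : n < N) (hC : ∀ a b, n < a + b → C a b = 0)
    (m : ℕ) : BoxEq J ((dp j)^[m] (phasePoly J i j N C)) (phasePoly J i j N (momDeriv₂^[m] C)) := by
  induction m with
  | zero => exact fun _ _ _ => rfl
  | succ m ih =>
    rw [Function.iterate_succ_apply', Function.iterate_succ_apply']
    exact (ih.dp j).trans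
      (dp_snd_phasePoly hij fun a => iterate_momDeriv₂_eq_zero hC m a N (by omega))

theorem component_eq (hij : j ≠ i) (c : ℕ → ℕ → (Fin 2 → ℝ) → ℂ) {m N : ℕ} (hm : m < N) :
    component c m q p = ∑ a ∈ Finset.range N, ∑ b ∈ Finset.range N,
      if a + b = m then (if i = 0 then c a b q else c b a q) * (p i : ℂ) ^ a * (p j : ℂ) ^ b
      else 0 := by
  have h : component c m q p = ∑ a ∈ Finset.range N, ∑ b ∈ Finset.range N,
      if a + b = m then c a b q * (p 0 : ℂ) ^ a * (p 1 : ℂ) ^ b else 0 := by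
    rw [component, ← Finset.sum_product', ← Finset.sum_filter]
    refine Finset.sum_congr ?_ fun _ _ => rfl
    ext ⟨a, b⟩
    simp only [Finset.HasAntidiagonal.mem_antidiagonal, Finset.mem_filter, Finset.mem_product,
      Finset.mem_range]
    omega
  obtain ⟨rfl, rfl⟩ | ⟨rfl, rfl⟩ : (i = 0 ∧ j = 1) ∨ (i = 1 ∧ j = 0) := by omega
  · simpa using h
  · rw [h, Finset.sum_comm]
    refine Finset.sum_congr rfl fun a _ => Finset.sum_congr rfl fun b _ => ?_
    simp [add_comm b a, mul_right_comm]

/-- The distinguished index i becomes the first coordinate, with exponents swapped if i = 1, so the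
argument treats a single summand. The bound n + 2 leaves room for the degree n + 1 produced by
transport. -/
theorem exists_coeffs (hij : j ≠ i) {c : ℕ → ℕ → (Fin 2 → ℝ) → ℂ}
    (hc : ∀ a b, a + b ≤ n → ContDiffOn ℝ ∞ (c a b) (box J)) :
    ∃ C : Coeffs (smoothSubalgebra (J i ×ˢ J j)), (∀ a b, n < a + b → C a b = 0) ∧
      BoxEq J (momentumPoly c n) (phasePoly J i j (n + 2) C) ∧
      BoxEq J (component c n)
        (phasePoly J i j (n + 2) fun a b => if a + b = n then C a b else 0) := by
  set pt : ℝ × ℝ → Fin 2 → ℝ := fun s l => if l = i then s.1 else s.2 with hpt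
  have hptq : ∀ q, pt (q i, q j) = q := by
    intro q
    funext l
    rcases eq_or_ne l i with rfl | hl
    · simp [hpt]
    · obtain rfl : l = j := by omega
      simp [hpt, hl]
  have hmaps : Set.MapsTo pt (J i ×ˢ J j) (box J) := by
    intro s hs l
    rcases eq_or_ne l i with rfl | hl
    · simpa [hpt] using hs.1
    · have : l = j := by omega
      subst this
      simpa [hpt, hl] using hs.2
  have hsm : ContDiff ℝ ∞ pt := by
    refine contDiff_pi.2 fun l => ?_
    by_cases hl : l = i
    · simpa [hpt, hl] using contDiff_fst
    · simpa [hpt, hl] using contDiff_snd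
  set d : ℕ → ℕ → (Fin 2 → ℝ) → ℂ := fun a b q =>
    if i = 0 then c a b q else c b a q with hd
  have hds : ∀ a b, a + b ≤ n → ContDiffOn ℝ ∞ (fun s => d a b (pt s)) (J i ×ˢ J j) := by
    intro a b hab
    refine ContDiffOn.comp (g := d a b) (t := box J) ?_ hsm.contDiffOn hmaps
    by_cases h0 : i = 0
    · simpa only [hd, h0, if_true] using hc a b hab
    · simpa only [hd, h0, if_false] using hc b a (by omega)
  set C : Coeffs (smoothSubalgebra (J i ×ˢ J j)) := fun a b =>
    if h : a + b ≤ n then smoothRestrict _ (hds a b h) else 0 with hCdef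
  have hC : ∀ a b, n < a + b → C a b = 0 := fun a b h => dif_neg (by omega)
  have hCv : ∀ a b, a + b ≤ n → ∀ q ∈ box J, extendZero _ (C a b).1 (q i, q j) = d a b q := by
    intro a b hab q hq
    have h1 := extendZero_coe (C a b).1 ⟨(q i, q j), hq i, hq j⟩
    simp only at h1
    rw [h1, hCdef]
    simp only [hab, dif_pos]
    exact congrArg (d a b) (hptq q)
  have hcomp : ∀ m ≤ n, BoxEq J (component c m)
      (phasePoly J i j (n + 2) fun a b => if a + b = m then C a b else 0) := by
    intro m hm q hq p
    rw [component_eq hij c (show m < n + 2 by omega), phasePoly]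
    refine Finset.sum_congr rfl fun a _ => Finset.sum_congr rfl fun b _ => ?_
    split_ifs with hab h0
    · rw [hCv a b (by omega) q hq]
      simp [hd, h0]
    · rw [hCv a b (by omega) q hq]
      simp [hd, h0]
    · rw [extendZero_zero (S := J i ×ˢ J j) ⟨hq i, hq j⟩]
      simp
  refine ⟨C, hC, fun q hq p => ?_, hcomp n le_rfl⟩
  rw [momentumPoly, Finset.sum_congr rfl fun m hm =>
    hcomp m (by have := Finset.mem_range.1 hm; omega) q hq p]
  simp only [phasePoly]
  rw [Finset.sum_comm]
  refine Finset.sum_congr rfl fun a _ => ?_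
  rw [Finset.sum_comm]
  refine Finset.sum_congr rfl fun b _ => ?_
  rw [← Finset.sum_mul, ← Finset.sum_mul]
  congr 2
  have hite : ∀ m, extendZero _ (if a + b = m then C a b else 0 :
      smoothSubalgebra (J i ×ˢ J j)).1 (q i, q j) =
      if a + b = m then extendZero _ (C a b).1 (q i, q j) else 0 := by
    intro m
    split_ifs
    · rfl
    · exact extendZero_zero ⟨hq i, hq j⟩
  simp only [hite, Finset.sum_ite_eq, Finset.mem_range]
  split_ifs with hab
  · rfl
  · rw [hC a b (by omega)]
    have hs : (q i, q j) ∈ J i ×ˢ J j := ⟨hq i, hq j⟩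
    exact (extendZero_zero hs).symm

end Extraction

/-! ### The equation of motion for the coefficients -/

section Equation

variable {J : Fin 2 → Set ℝ} {V : Fin 2 → ℝ → ℝ} {i j : Fin 2} {n : ℕ}
  {C : Coeffs (smoothSubalgebra (J i ×ˢ J j))} {q p : Fin 2 → ℝ}

/-- The Hamiltonian is quadratic in each momentum, which leaves two kinetic terms. Padding the
potential terms with zeros up to four makes the formula uniform in n. -/
theorem sum_range_bracket {n : ℕ} (hn : n ≤ 4) {w A B D E : ℕ → ℂ} {P : ℂ} (hB0 : B 0 = P)
    (hB1 : B 1 = 1) (hB : ∀ m, B (m + 2) = 0) (hD : ∀ m, n ≤ m → D m = 0) :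
    ∑ m ∈ Finset.range (n + 2), w m * (A m * B m - D m * E m) =
      w 0 * (A 0 * P) + w 1 * A 1 - (w 0 * (D 0 * E 0) + w 1 * (D 1 * E 1) + w 2 * (D 2 * E 2) +
        w 3 * (D 3 * E 3)) := by
  simp only [mul_sub, Finset.sum_sub_distrib]
  congr 1
  · rw [Finset.sum_range_succ', Finset.sum_range_succ']
    simp [hB, hB0, hB1]
    ring
  · have h : ∀ m ≥ n, w m * (D m * E m) = 0 := fun m hm => by rw [hD m hm]; ring
    rw [Finset.eventually_constant_sum h (by omega), ← Finset.eventually_constant_sum h hn]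
    simp [Finset.sum_range_succ]

theorem extendZero_iterate_dirDeriv_fst (hJ : ∀ i, IsOpen (J i))
    (hV : ∀ i, ContDiffOn ℝ ∞ (V i) (J i)) {VA : smoothSubalgebra (J i ×ˢ J j)}
    (hVA : ∀ s : ↥(J i ×ˢ J j), VA.1 s = (V i s.1.1 : ℂ)) (m : ℕ) (s : ↥(J i ×ˢ J j)) :
    ((dirDeriv ((hJ i).prod (hJ j)) (1, 0))^[m] VA).1 s = ((deriv^[m] (V i) s.1.1 : ℝ) : ℂ) := by
  induction m generalizing s with
  | zero => exact hVA s
  | succ m ih =>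
    rw [Function.iterate_succ_apply']
    have h1 := hasDerivAt_fst ((hJ i).prod (hJ j))
      ((dirDeriv ((hJ i).prod (hJ j)) (1, 0))^[m] VA) s.2
    have h2 : HasDerivAt (fun t => extendZero _
        ((dirDeriv ((hJ i).prod (hJ j)) (1, 0))^[m] VA).1 (t, s.1.2))
        ((deriv^[m + 1] (V i) s.1.1 : ℝ) : ℂ) s.1.1 := by
      refine (hasDerivAt_iterate_deriv (hJ i) (hV i) m s.2.1).ofReal_comp.congr_of_eventuallyEq ?_
      filter_upwards [(hJ i).mem_nhds s.2.1] with t ht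
      exact (extendZero_coe ((dirDeriv ((hJ i).prod (hJ j)) (1, 0))^[m] VA).1
        ⟨(t, s.1.2), ht, s.2.2⟩).trans (ih _)
    rw [← h1.unique h2, Prod.mk.eta, extendZero_coe]

theorem extendZero_iterate_dirDeriv_snd (hJ : ∀ i, IsOpen (J i))
    (hV : ∀ i, ContDiffOn ℝ ∞ (V i) (J i)) {WA : smoothSubalgebra (J i ×ˢ J j)}
    (hWA : ∀ s : ↥(J i ×ˢ J j), WA.1 s = (V j s.1.2 : ℂ)) (m : ℕ) (s : ↥(J i ×ˢ J j)) :
    ((dirDeriv ((hJ i).prod (hJ j)) (0, 1))^[m] WA).1 s = ((deriv^[m] (V j) s.1.2 : ℝ) : ℂ) := by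
  induction m generalizing s with
  | zero => exact hWA s
  | succ m ih =>
    rw [Function.iterate_succ_apply']
    have h1 := hasDerivAt_snd ((hJ i).prod (hJ j))
      ((dirDeriv ((hJ i).prod (hJ j)) (0, 1))^[m] WA) s.2
    have h2 : HasDerivAt (fun t => extendZero _
        ((dirDeriv ((hJ i).prod (hJ j)) (0, 1))^[m] WA).1 (s.1.1, t))
        ((deriv^[m + 1] (V j) s.1.2 : ℝ) : ℂ) s.1.2 := by
      refine (hasDerivAt_iterate_deriv (hJ j) (hV j) m s.2.2).ofReal_comp.congr_of_eventuallyEq ?_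
      filter_upwards [(hJ j).mem_nhds s.2.2] with t ht
      exact (extendZero_coe ((dirDeriv ((hJ i).prod (hJ j)) (0, 1))^[m] WA).1
        ⟨(s.1.1, t), s.2.1, ht⟩).trans (ih _)
    rw [← h1.unique h2, Prod.mk.eta, extendZero_coe]

theorem transport_eq_of_isMotionIntegral (hJ : ∀ i, IsOpen (J i))
    (hV : ∀ i, ContDiffOn ℝ ∞ (V i) (J i)) (hij : j ≠ i) (hn : n ≤ 4) {ħ : ℝ}
    {c : ℕ → ℕ → (Fin 2 → ℝ) → ℂ} (hX : IsMotionIntegral ħ V J n c)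
    (hC : ∀ a b, n < a + b → C a b = 0)
    (hcC : BoxEq J (momentumPoly c n) (phasePoly J i j (n + 2) C))
    {VA WA : smoothSubalgebra (J i ×ˢ J j)}
    (hVA : ∀ s : ↥(J i ×ˢ J j), VA.1 s = (V i s.1.1 : ℂ))
    (hWA : ∀ s : ↥(J i ×ˢ J j), WA.1 s = (V j s.1.2 : ℂ))
    {dx dy : Derivation ℂ (smoothSubalgebra (J i ×ˢ J j)) (smoothSubalgebra (J i ×ˢ J j))}
    (hdx : dx = dirDeriv ((hJ i).prod (hJ j)) (1, 0))
    (hdy : dy = dirDeriv ((hJ i).prod (hJ j)) (0, 1)) {h : ℂ} (hh : h = (ħ : ℂ) / Complex.I) :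
    transport dx dy C + (h / 2) • laplace dx dy C =
      (dx VA • momDeriv₁ C + dy WA • momDeriv₂ C) +
      (h / 2) • (dx^[2] VA • momDeriv₁^[2] C + dy^[2] WA • momDeriv₂^[2] C) +
      (h ^ 2 / 6) • (dx^[3] VA • momDeriv₁^[3] C + dy^[3] WA • momDeriv₂^[3] C) +
      (h ^ 3 / 24) • (dx^[4] VA • momDeriv₁^[4] C + dy^[4] WA • momDeriv₂^[4] C) := by
  subst hdx hdy
  rw [← sub_eq_zero]
  set dx := dirDeriv ((hJ i).prod (hJ j)) (1, 0)
  set dy := dirDeriv ((hJ i).prod (hJ j)) (0, 1)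
  set K := transport dx dy C + (h / 2) • laplace dx dy C -
      ((dx VA • momDeriv₁ C + dy WA • momDeriv₂ C) +
      (h / 2) • (dx^[2] VA • momDeriv₁^[2] C + dy^[2] WA • momDeriv₂^[2] C) +
      (h ^ 2 / 6) • (dx^[3] VA • momDeriv₁^[3] C + dy^[3] WA • momDeriv₂^[3] C) +
      (h ^ 3 / 24) • (dx^[4] VA • momDeriv₁^[4] C + dy^[4] WA • momDeriv₂^[4] C)) with hK
  have hK0 : BoxEq J (phasePoly J i j (n + 2) K) fun _ _ => 0 := by
    intro q hq p
    have hs : (q i, q j) ∈ J i ×ˢ J j := ⟨hq i, hq j⟩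
    have hb := hX.2 q hq p
    rw [bracket_hamiltonian hJ hV (n + 2) ħ _ q hq p] at hb
    have hfin : ∀ g : Fin 2 → ℂ, ∑ l, g l = g i + g j := by
      intro g
      obtain ⟨rfl, rfl⟩ | ⟨rfl, rfl⟩ : (i = 0 ∧ j = 1) ∨ (i = 1 ∧ j = 0) := by omega
      · exact Fin.sum_univ_two g
      · rw [Fin.sum_univ_two, add_comm]
    have hV1 : ∀ m, ((deriv^[m] (V i) (q i) : ℝ) : ℂ) = extendZero _ (dx^[m] VA).1 (q i, q j) :=
      fun m => ((extendZero_coe _ ⟨_, hs⟩).trans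
        (extendZero_iterate_dirDeriv_fst hJ hV hVA m ⟨_, hs⟩)).symm
    have hV2 : ∀ m, ((deriv^[m] (V j) (q j) : ℝ) : ℂ) = extendZero _ (dy^[m] WA).1 (q i, q j) :=
      fun m => ((extendZero_coe _ ⟨_, hs⟩).trans
        (extendZero_iterate_dirDeriv_snd hJ hV hWA m ⟨_, hs⟩)).symm
    have hD1 : ∀ m, n ≤ m → phasePoly J i j (n + 2) (momDeriv₁^[m + 1] C) q p = 0 := by
      intro m hm
      refine Finset.sum_eq_zero fun a _ => Finset.sum_eq_zero fun b _ => ?_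
      rw [iterate_momDeriv₁_eq_zero hC (m + 1) a b (by omega), extendZero_zero hs]
      ring
    have hD2 : ∀ m, n ≤ m → phasePoly J i j (n + 2) (momDeriv₂^[m + 1] C) q p = 0 := by
      intro m hm
      refine Finset.sum_eq_zero fun a _ => Finset.sum_eq_zero fun b _ => ?_
      rw [iterate_momDeriv₂_eq_zero hC (m + 1) a b (by omega), extendZero_zero hs]
      ring
    simp only [hfin, hcC.iterate_dq hJ i _ q hq p, hcC.iterate_dq hJ j _ q hq p,
      hcC.iterate_dp i _ q hq p, hcC.iterate_dp j _ q hq p,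
      iterate_dq_fst_phasePoly hJ hij _ q hq p, iterate_dq_snd_phasePoly hJ hij _ q hq p,
      iterate_dp_fst_phasePoly hij (show n < n + 2 by omega) hC _ q hq p,
      iterate_dp_snd_phasePoly hij (show n < n + 2 by omega) hC _ q hq p,
      iterate_dq_hamiltonian hJ hV _ _ q hq p, hV1, hV2] at hb
    rw [sum_range_bracket hn (by simp [dp_hamiltonian]; rfl) (by simp [dp_hamiltonian, dp_mom])
      (fun m => by rw [iterate_dp_hamiltonian]) hD1,
      sum_range_bracket hn (by simp [dp_hamiltonian]; rfl) (by simp [dp_hamiltonian, dp_mom])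
      (fun m => by rw [iterate_dp_hamiltonian]) hD2] at hb
    have h1 := mul_fst_phasePoly (p := p) (N := n + 1) (C := fun a b => dx (C a b)) hq
      (fun b => by rw [hC _ _ (by omega), map_zero])
    have h2 := mul_snd_phasePoly (p := p) (N := n + 1) (C := fun a b => dy (C a b)) hq
      (fun b => by rw [hC _ _ (by omega), map_zero])
    have ht : transport dx dy C = (fun a b => if a = 0 then 0 else dx (C (a - 1) b)) +
        fun a b => if b = 0 then 0 else dy (C a (b - 1)) := rfl
    have hl : laplace dx dy C = (fun a b => dx^[2] (C a b)) + fun a b => dy^[2] (C a b) := rfl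
    rw [hK, ht, hl]
    simp only [phasePoly_sub hq, phasePoly_add hq, phasePoly_smul hq, phasePoly_complex_smul hq]
    rw [← h1, ← h2]
    norm_num [Nat.factorial, ← hh] at hb
    simp only [Function.iterate_succ, Function.iterate_zero, Function.comp_apply, id]
    change _ = (0 : ℂ)
    linear_combination hb
  funext a b
  -- Above total degree n + 1 every term is zero; below, both exponents lie in the range where
  -- coefficients can be compared.
  by_cases hab : n + 1 < a + b
  · have e1 : ∀ m, momDeriv₁^[m] C a b = 0 := fun m =>
      iterate_momDeriv₁_eq_zero hC m a b (by omega)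
    have e2 : ∀ m, momDeriv₂^[m] C a b = 0 := fun m =>
      iterate_momDeriv₂_eq_zero hC m a b (by omega)
    have e3 : transport dx dy C a b = 0 := by
      change (if a = 0 then 0 else dx (C (a - 1) b)) + (if b = 0 then 0 else dy (C a (b - 1))) = 0
      split_ifs
      · rw [add_zero]
      · rw [hC a (b - 1) (by omega), map_zero, add_zero]
      · rw [hC (a - 1) b (by omega), map_zero, add_zero]
      · rw [hC (a - 1) b (by omega), hC a (b - 1) (by omega), map_zero, map_zero, add_zero]
    have e4 : laplace dx dy C a b = 0 := by
      change dx (dx (C a b)) + dy (dy (C a b)) = 0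
      rw [hC a b (by omega)]
      simp
    have e5 := e1 1
    have e6 := e2 1
    simp only [Function.iterate_one] at e5 e6
    simp only [hK, Pi.sub_apply, Pi.add_apply, Pi.smul_apply, e1, e2, e3, e4, e5, e6, smul_zero,
      add_zero, sub_zero, Pi.zero_apply]
  · exact coeff_eq_zero_of_phasePoly hij hK0 (by omega) (by omega)

end Equation

/-! ### Non-triviality and conclusion -/

section Main

theorem exists_primitive {s : Set ℝ} (hs : IsOpen s) (hc : IsConnected s) {r : ℝ → ℝ}
    (hr : ContDiffOn ℝ ∞ r s) :
    ∃ R : ℝ → ℝ, ContDiffOn ℝ ∞ R s ∧ ∀ x ∈ s, HasDerivAt R (r x) x := by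
  obtain ⟨⟨a, ha⟩, hpc⟩ := hc
  have hd : ∀ x ∈ s, HasDerivAt (fun x => ∫ t in a..x, r t) (r x) x := by
    intro x hx
    refine intervalIntegral.integral_hasDerivAt_right ?_ ?_ ?_
    · exact (hr.continuousOn.mono (hpc.ordConnected.uIcc_subset ha hx)).intervalIntegrable
    · exact hr.continuousOn.stronglyMeasurableAtFilter hs x hx
    · exact hr.continuousOn.continuousAt (hs.mem_nhds hx)
  refine ⟨_, (contDiffOn_infty_iff_deriv_of_isOpen hs).2
    ⟨fun x hx => (hd x hx).differentiableAt.differentiableWithinAt, ?_⟩, hd⟩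
  exact hr.congr fun x hx => (hd x hx).deriv

theorem contDiffOn_ofReal_fst {J₁ J₂ : Set ℝ} {r : ℝ → ℝ} (hr : ContDiffOn ℝ ∞ r J₁) :
    ContDiffOn ℝ ∞ (fun p : ℝ × ℝ => (r p.1 : ℂ)) (J₁ ×ˢ J₂) :=
  Complex.ofRealCLM.contDiff.comp_contDiffOn (hr.comp contDiffOn_fst fun _ h => h.1)

theorem contDiffOn_ofReal_snd {J₁ J₂ : Set ℝ} {r : ℝ → ℝ} (hr : ContDiffOn ℝ ∞ r J₂) :
    ContDiffOn ℝ ∞ (fun p : ℝ × ℝ => (r p.2 : ℂ)) (J₁ ×ˢ J₂) :=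
  Complex.ofRealCLM.contDiff.comp_contDiffOn (hr.comp contDiffOn_snd fun _ h => h.2)

variable {J : Fin 2 → Set ℝ} {i j : Fin 2} {N n : ℕ} {C : Coeffs (smoothSubalgebra (J i ×ˢ J j))}
  {q p : Fin 2 → ℝ}

theorem phasePoly_eq_zero (hq : q ∈ box J) (hp : p i = 0) (hC : ∀ b, C 0 b = 0) :
    phasePoly J i j N C q p = 0 := by
  have hs : (q i, q j) ∈ J i ×ˢ J j := ⟨hq i, hq j⟩
  refine Finset.sum_eq_zero fun a _ => Finset.sum_eq_zero fun b _ => ?_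
  rcases a with _ | a
  · rw [hC, extendZero_zero hs]
    ring
  · simp [hp]

/-- At p_i = 0 the p_i-derivative of the leading component sees only C₁,ₙ₋₁, and the q_i-derivative
sees only ∂ₓC₀,ₙ, which transport identifies with -∂ᵧC₁,ₙ₋₁. -/
theorem exists_coeff_ne_zero (hJ : ∀ i, IsOpen (J i)) (hij : j ≠ i)
    {c : ℕ → ℕ → (Fin 2 → ℝ) → ℂ} (hi : LinearCompatNontrivial J n c i)
    (hcC : BoxEq J (component c n)
      (phasePoly J i j (n + 2) fun a b => if a + b = n then C a b else 0))
    (hT : transport (dirDeriv ((hJ i).prod (hJ j)) (1, 0)) (dirDeriv ((hJ i).prod (hJ j)) (0, 1))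
      C 1 n = 0) : 0 < n ∧ C 1 (n - 1) ≠ 0 := by
  by_contra hcon
  have h1 : ∀ b, 1 + b = n → C 1 b = 0 := by
    intro b hb
    by_contra h
    refine hcon ⟨by omega, ?_⟩
    rwa [show n - 1 = b by omega]
  have h0 : dirDeriv ((hJ i).prod (hJ j)) (1, 0) (C 0 n) = 0 := by
    change dirDeriv ((hJ i).prod (hJ j)) (1, 0) (C 0 n) +
      (if n = 0 then 0 else dirDeriv ((hJ i).prod (hJ j)) (0, 1) (C 1 (n - 1))) = 0 at hT
    split_ifs at hT with hn
    · rwa [add_zero] at hT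
    · rwa [h1 (n - 1) (by omega), map_zero, add_zero] at hT
  obtain ⟨q, hq, p, hp, h | h⟩ := hi
  · refine h ?_
    rw [hcC.dq hJ i q hq p, dq_fst_phasePoly hJ hij q hq p]
    refine phasePoly_eq_zero hq hp fun b => ?_
    split_ifs with hb
    · rw [show b = n by omega, h0]
    · exact map_zero _
  · refine h ?_
    rw [hcC.dp i q hq p, dp_fst_phasePoly hij (fun b => if_neg (by omega)) q hq p]
    refine phasePoly_eq_zero hq hp fun b => ?_
    rw [momDeriv₁]
    split_ifs with hb
    · rw [h1 b (by omega), mul_zero]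
    · exact mul_zero _

end Main

theorem mainTheorem1 (ħ : ℝ) (hħ : 0 ≤ ħ) (J : Fin 2 → Set ℝ)
    (hJ_open : ∀ i, IsOpen (J i)) (hJ_conn : ∀ i, IsConnected (J i))
    (V : Fin 2 → ℝ → ℝ) (hV : ∀ i, ContDiffOn ℝ ∞ (V i) (J i))
    (n : ℕ) (hn : n ≤ 4) (c : ℕ → ℕ → (Fin 2 → ℝ) → ℂ)
    (hX : IsMotionIntegral ħ V J n c)
    (i : Fin 2) (hi : LinearCompatNontrivial J n c i) :
    HasStandardForm ħ (J i) (V i) := by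
  obtain ⟨j, hij⟩ := exists_ne i
  obtain ⟨C, hC, hcC, hcC'⟩ := exists_coeffs hij hX.1
  obtain ⟨Q, hQs, hQ⟩ := exists_primitive (hJ_open i) (hJ_conn i) (hV i)
  obtain ⟨Y, hYs, hY⟩ := exists_primitive (hJ_open i) (hJ_conn i) ((hV i).pow 2)
  obtain ⟨R, hRs, hR⟩ := exists_primitive (hJ_open j) (hJ_conn j) (hV j)
  set QA : smoothSubalgebra (J i ×ˢ J j) := smoothRestrict _ (contDiffOn_ofReal_fst hQs)
  set YA : smoothSubalgebra (J i ×ˢ J j) := smoothRestrict _ (contDiffOn_ofReal_fst hYs)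
  set VA : smoothSubalgebra (J i ×ˢ J j) := smoothRestrict _ (contDiffOn_ofReal_fst (hV i))
  set RA : smoothSubalgebra (J i ×ˢ J j) := smoothRestrict _ (contDiffOn_ofReal_snd hRs)
  set WA : smoothSubalgebra (J i ×ˢ J j) := smoothRestrict _ (contDiffOn_ofReal_snd (hV j))
  set hS := (hJ_open i).prod (hJ_open j)
  have hP : Potentials (dirDeriv hS (1, 0)) (dirDeriv hS (0, 1)) QA VA YA WA RA :=
    { comm := dirDeriv_comm hS (1, 0) (0, 1)
      dxQ := dirDeriv_fst_eq (hJ_open i) (hJ_open j) (fun _ => rfl) (fun _ => rfl) hQ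
      dyQ := dirDeriv_snd_eq_zero (hJ_open i) (hJ_open j) (fun _ => rfl)
      dxY := dirDeriv_fst_eq (r' := fun x => V i x ^ 2) (hJ_open i) (hJ_open j) (fun _ => rfl)
        (fun p => by push_cast; rfl) hY
      dyR := dirDeriv_snd_eq (hJ_open i) (hJ_open j) (fun _ => rfl) (fun _ => rfl) hR
      dxR := dirDeriv_fst_eq_zero (hJ_open i) (hJ_open j) (fun _ => rfl) }
  set h : ℂ := (ħ : ℂ) / Complex.I with hh
  obtain ⟨Z, hZ0, hZC, hZT⟩ := exists_weylForm hP.comm hP.dyV hP.dxW hn hC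
    (transport_eq_of_isMotionIntegral hJ_open hV hij hn hX hC hcC (fun _ => rfl) (fun _ => rfl)
      rfl rfl hh)
  obtain ⟨hn0, hz⟩ := exists_coeff_ne_zero (C := Z) hJ_open hij hi
    (fun q hq p => (hcC' q hq p).trans (by
      congr 1
      funext a b
      split_ifs with hab
      · exact (hZC a b hab).symm
      · rfl))
    (by
      rw [hZT]
      simp [momDeriv₁, momDeriv₂, hZ0 (1 + 1) n (by omega), hZ0 1 (n + 1) (by omega),
        hZ0 (1 + 1 + 1 + 1) n (by omega), hZ0 1 (n + 1 + 1 + 1) (by omega)])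
  set k : smoothSubalgebra (J i ×ˢ J j) := algebraMap ℂ _ (h ^ 2 / 24) with hk
  have hkx : dirDeriv hS (1, 0) k = 0 := Derivation.map_algebraMap _ _
  have hky : dirDeriv hS (0, 1) k = 0 := Derivation.map_algebraMap _ _
  -- The square (ħ/√-1)² = -ħ² gives the real coefficient of the quantum terms.
  have hk24 : 24 * k = algebraMap ℂ _ ((-ħ ^ 2 : ℝ) : ℂ) := by
    rw [hk, ← map_ofNat (algebraMap ℂ (smoothSubalgebra (J i ×ˢ J j))) 24, ← map_mul, hh, div_pow,
      Complex.I_sq]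
    congr 1
    push_cast
    ring
  simp only [Algebra.smul_def, ← hk] at hZT
  have hcn := (hJ_conn i).isPreconnected
  have hne := (hJ_conn i).nonempty
  have hV' : ∀ x ∈ J i, HasDerivAt (V i) (deriv (V i) x) x := fun x hx =>
    hasDerivAt_iterate_deriv (hJ_open i) (hV i) 0 hx
  have hV'A := extendZero_iterate_dirDeriv_fst (VA := VA) hJ_open hV (fun _ => rfl) 1
  -- Orders three and four end alike: the nonlinear equation is used if ζ ≠ 0, and the system
  -- degenerates to the affine one if ζ = 0.
  have hQuad : ∀ {ζ z G : smoothSubalgebra (J i ×ˢ J j)} {m m' : ℕ},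
      QuadraticCompat (dirDeriv hS (1, 0)) (dirDeriv hS (0, 1)) (24 * k) QA VA YA WA RA ζ z G m →
      (ζ = 0 → AffineCompat (dirDeriv hS (1, 0)) (dirDeriv hS (0, 1)) QA WA RA z G m') →
      z ≠ 0 → HasStandardForm ħ (J i) (V i) := by
    intro ζ z G m m' h1 h2 h3
    by_cases h4 : ζ = 0
    · exact hasStandardForm_of_affineCompat (hJ_open i) (hJ_open j) hcn hne hQ (fun _ => rfl) hP
        (h2 h4) h3
    · rw [hk24] at h1
      exact hasStandardForm_of_quadraticCompat (hJ_open i) (hJ_open j) hcn hne hQ hV' hY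
        (fun _ => rfl) (fun _ => rfl) hV'A (fun _ => rfl) hP h1 h3 h4
  obtain rfl | rfl | rfl | rfl : n = 1 ∨ n = 2 ∨ n = 3 ∨ n = 4 := by omega
  · exact hasStandardForm_of_affineCompat (hJ_open i) (hJ_open j) hcn hne hQ (fun _ => rfl) hP
      (hP.affineCompat_of_order_one hZ0 hZT) hz
  · exact hasStandardForm_of_affineCompat (hJ_open i) (hJ_open j) hcn hne hQ (fun _ => rfl) hP
      (hP.affineCompat_of_order_two hZ0 hZT) hz
  · obtain ⟨G, h1, h2⟩ := hP.quadraticCompat_of_order_three hkx hZ0 hZT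
    exact hQuad h1 h2 hz
  · obtain ⟨G, h1, h2⟩ := hP.quadraticCompat_of_order_four hkx hky hZ0 hZT
    exact hQuad h1 h2 hz
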